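/- **Proposition 3.1 (Unique continuation).** Let $n,k\ge 0$, let $U\subset\mathbb{R}^n$ be open (the range of a coordinate chart of an $n$-manifold $X$), and let $M=[0,1)_\tau\times U$ with interior $M^\circ=(0,1)\times U$. Write $V_0=\tau\partial_\tau$, $V_j=\tau\partial_{x^j}$ ($1\le j\le n$), ${}^0\nabla u=(V_0u,\dots,V_nu)$, $|{}^0\nabla u|^2=\sum_\mu|V_\mu u|^2$. Let ${}^0\mathcal C^0(M)=L^\infty_{\rm loc}(M)\cap\mathcal C^0(M^\circ)$, let ${}^0\mathcal C^1(M)$ be the space of $u\in{}^0\mathcal C^0(M)$ with $V_\mu u\in{}^0\mathcal C^0(M)$ for all $\mu$, and let $\tau^\eta\,{}^0\mathcal C^1(M)=\{\tau^\eta v: v\in{}^0\mathcal C^1(M)\}$. Let $\eta>0$ and let $g=\tau^{-2}\bar g$ be a Lorentzian metric (signature $(-,+,\dots,+)$), where $\bar g=-d\tau^2+h(x,dx)+\bar g'$ is Lorentzian on $M$, $h$ is a $\mathcal C^1$ Riemannian metric on $U$, and the coefficients of $\bar g'$ lie in $\tau^\eta\,{}^0\mathcal C^1(M)$. Let $\tau_0\in(0,\frac12]$,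 $C>0$, $R_0>C\tau_0$, and $$\Omega^{\tau_0}=\{(\tau,x):0\le\tau\le\tau_0,\ |x|\le R_0-C\tau\}\subset M,$$ and assume that the level sets of $\tau$ in $\Omega^{\tau_0}$ and the lateral hypersurface $\{0\le\tau\le\tau_0,\ |x|=R_0-C\tau\}$ are spacelike for $\bar g$. Let $L=L_0+\tilde L$ be a second order operator acting on $\mathbb{R}^k$-valued functions, where $$L_0=\sum_{\mu,\nu}A_0^{\mu\nu}V_\mu V_\nu+\sum_\mu B_0^\mu V_\mu+Z_0,\qquad A_0^{\mu\nu}=A_0^{\nu\mu},$$ has $k\times k$ matrix coefficients smooth on $M$ (up to $\tau=0$), and $\tilde L$ is of the same form with coefficients in $\tau^\eta\,{}^0\mathcal C^1(M)$. Suppose the principal symbol of $L$ is scalar and given by the dual metric function $\zeta\mapsto g^{-1}(\zeta,\zeta)$ (that is, $L$ has the same principal part as $\Box_g=-\nabla^\mu\nabla_\mu$). Then there exists $N<\infty$, depending only on the coefficients $A_0^{\mu\nu},B_0^\mu,Z_0$ at $\Omega^{\tau_0}\cap\{\tau=0\}=\{|x|\le R_0\}$ (and not otherwise on $U,\eta,g,L_0,\tilde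 L,C,\tau_0$), such that: every $u\in{}^0\mathcal C^1(\Omega^{\tau_0};\mathbb{R}^k)$ (i.e. $u$ is bounded and continuous on $\Omega^{\tau_0}\cap\{\tau>0\}$ and $\mathcal C^1$ in the interior of $\Omega^{\tau_0}$, and the $V_\mu u$ extend to bounded continuous functions on $\Omega^{\tau_0}\cap\{\tau>0\}$) which solves $Lu=0$ in the sense of distributions in the interior of $\Omega^{\tau_0}$ and satisfies $|u|,|{}^0\nabla u|\le K\tau^N$ for some $K\in\mathbb{R}$ vanishes identically on $\Omega^{\tau_0}$. -/

import Mathlib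

open scoped ContDiff

noncomputable section

namespace ZeroGeometry

/-- Coordinates `(τ, x)` with `τ ∈ ℝ` and `x ∈ ℝⁿ` (Euclidean norm on `ℝⁿ`). -/
abbrev Spacetime (n : ℕ) := ℝ × EuclideanSpace ℝ (Fin n)

/-- The fibre `ℝᵏ` in which the unknown takes its values. -/
abbrev Fibre (k : ℕ) := EuclideanSpace ℝ (Fin k)

/-- Real `k × k` matrices, as endomorphisms of `ℝᵏ` with the operator norm. -/
abbrev EndFibre (k : ℕ) := Fibre k →L[ℝ] Fibre k

/-- `M = [0,1)_τ × U`, where `U ⊆ ℝⁿ` is the range of a coordinate chart. -/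
def chartM {n : ℕ} (U : Set (EuclideanSpace ℝ (Fin n))) : Set (Spacetime n) :=
  {p | 0 ≤ p.1 ∧ p.1 < 1 ∧ p.2 ∈ U}

/-- The domain `Ω^{τ₀} = {0 ≤ τ ≤ τ₀, |x| ≤ R₀ - C τ}`. -/
def Omega (n : ℕ) (R₀ C τ₀ : ℝ) : Set (Spacetime n) :=
  {p | 0 ≤ p.1 ∧ p.1 ≤ τ₀ ∧ ‖p.2‖ ≤ R₀ - C * p.1}

/-- The coordinate frame: index `0` is `∂_τ`, index `j + 1` is `∂_{x^j}`. -/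
def coordFrame (n : ℕ) : Fin (n + 1) → Spacetime n :=
  Fin.cons ((1 : ℝ), 0) fun j => ((0 : ℝ), EuclideanSpace.single j (1 : ℝ))

section Functions

variable {n : ℕ} {V : Type*} [NormedAddCommGroup V] [NormedSpace ℝ V]

/-- Derivative along the 0-frame: `τ∂_τ f` for `μ = 0` and `τ∂_{x^j} f` for `μ = j + 1`. -/
def zeroDeriv (μ : Fin (n + 1)) (f : Spacetime n → V) (p : Spacetime n) : V :=
  p.1 • fderiv ℝ f p (coordFrame n μ)

/-- `|⁰∇ f|`. -/
def zeroGradNorm (f : Spacetime n → V) (p : Spacetime n) : ℝ :=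
  Real.sqrt (∑ μ : Fin (n + 1), ‖zeroDeriv μ f p‖ ^ 2)

/-- `⁰C⁰(S)` for `S ⊆ {τ ≥ 0}`: continuous on `S ∩ {τ > 0}`, and locally bounded on `S`
(up to and including `τ = 0`). Values at `τ = 0` play no role. -/
def ZeroC0On (S : Set (Spacetime n)) (f : Spacetime n → V) : Prop :=
  ContinuousOn f (S ∩ {p | 0 < p.1}) ∧
    ∀ p ∈ S, ∃ W ∈ nhds p, ∃ B : ℝ, ∀ q ∈ W ∩ (S ∩ {p | 0 < p.1}), ‖f q‖ ≤ B

/-- `⁰C¹(S)`: the function and its derivatives along the 0-frame lie in `⁰C⁰(S)`, where at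
points of `S ∩ {τ > 0}` that are not interior to `S` the derivatives are understood as continuous
extensions from the interior. For `S = chartM U` with `U` open there are no such points. -/
def ZeroC1On (S : Set (Spacetime n)) (f : Spacetime n → V) : Prop :=
  ZeroC0On S f ∧ DifferentiableOn ℝ f (interior S) ∧
    ∀ μ : Fin (n + 1), ∃ w : Spacetime n → V,
      ZeroC0On S w ∧ ∀ p ∈ interior S, w p = zeroDeriv μ f p

/-- `τ^η ⁰C¹(S)`. For `η > 0` elements are continuous up to `τ = 0` and vanish there. -/
def WeightedZeroC1On (S : Set (Spacetime n)) (η : ℝ) (f : Spacetime n → V) : Prop :=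
  ∃ v : Spacetime n → V, ZeroC1On S v ∧ ∀ p ∈ S, f p = p.1 ^ η • v p

end Functions

section Metrics

variable {n : ℕ}

/-- A symmetric bilinear form of signature `(-,+,…,+)`. -/
def IsLorentzian (G : Matrix (Fin (n + 1)) (Fin (n + 1)) ℝ) : Prop :=
  ∃ P : Matrix (Fin (n + 1)) (Fin (n + 1)) ℝ, IsUnit P.det ∧
    P.transpose * G * P = Matrix.diagonal (Fin.cons (-1) fun _ => 1)

/-- The matrix of `-dτ² + h`. -/
def modelMetric (h : Matrix (Fin n) (Fin n) ℝ) : Matrix (Fin (n + 1)) (Fin (n + 1)) ℝ :=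
  Matrix.of (Fin.cons (Fin.cons (-1) fun _ => 0) fun i => Fin.cons 0 (h i))

/-- `ḡ = -dτ² + h(x,dx) + ḡ'` is Lorentzian on `M = [0,1) × U`, with `h` a `C¹` Riemannian metric
on `U` and `ḡ' ∈ τ^η ⁰C¹(M)`. Here `gbar p` is the matrix of `ḡ` in the frame `∂_τ, ∂_x`;
equivalently, it is the matrix of `g = τ⁻² ḡ` in the 0-frame `τ∂_τ, τ∂_x`. -/
def IsAsymptoticallyDeSitter (U : Set (EuclideanSpace ℝ (Fin n))) (η : ℝ)
    (gbar : Spacetime n → Matrix (Fin (n + 1)) (Fin (n + 1)) ℝ) : Prop :=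
  (∀ p ∈ chartM U, IsLorentzian (gbar p)) ∧
    ∃ (h : EuclideanSpace ℝ (Fin n) → Matrix (Fin n) (Fin n) ℝ)
      (g' : Spacetime n → Matrix (Fin (n + 1)) (Fin (n + 1)) ℝ),
      (∀ i j, ContDiffOn ℝ 1 (fun x => h x i j) U) ∧
      (∀ x ∈ U, (h x).PosDef) ∧
      (∀ μ ν, WeightedZeroC1On (chartM U) η fun p => g' p μ ν) ∧
      ∀ p ∈ chartM U, gbar p = modelMetric (h p.2) + g' p

/-- The dual metric function `ζ ↦ G⁻¹(ζ,ζ)`. With `G = gbar p` and `ζ` the components of a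
0-covector `ζ₀ dτ/τ + ∑ ζ_j dx^j/τ`, this is `g⁻¹(ζ,ζ)`. -/
def dualMetric (G : Matrix (Fin (n + 1)) (Fin (n + 1)) ℝ) (ζ : Fin (n + 1) → ℝ) : ℝ :=
  ζ ⬝ᵥ (G⁻¹).mulVec ζ

/-- A hypersurface with conormal `ζ` at a point is spacelike there: `ζ` is timelike. -/
def IsSpacelikeConormal (G : Matrix (Fin (n + 1)) (Fin (n + 1)) ℝ) (ζ : Fin (n + 1) → ℝ) :
    Prop :=
  dualMetric G ζ < 0

/-- The conormal `dτ` of the level sets of `τ`. -/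
def levelConormal (n : ℕ) : Fin (n + 1) → ℝ :=
  Fin.cons 1 fun _ => 0

/-- The conormal `C dτ + d|x|` of the lateral hypersurface `|x| = R₀ - C τ`. -/
def lateralConormal (C : ℝ) (x : EuclideanSpace ℝ (Fin n)) : Fin (n + 1) → ℝ :=
  Fin.cons C fun j => x j / ‖x‖

end Metrics

section Operators

/-- The second order operator `∑ A^{μν} V_μ V_ν + ∑ B^μ V_μ + Z` acting on `ℝᵏ`-valued functions,
where `V₀ = τ∂_τ` and `V_{j+1} = τ∂_{x^j}`. Requiring `A^{μν} = A^{νμ}` makes the coefficients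
unique (the `V_μ` do not commute). -/
structure ZeroOp (n k : ℕ) where
  second : Fin (n + 1) → Fin (n + 1) → Spacetime n → EndFibre k
  first : Fin (n + 1) → Spacetime n → EndFibre k
  zeroth : Spacetime n → EndFibre k
  symm : ∀ μ ν, second μ ν = second ν μ

variable {n k : ℕ}

instance : Add (ZeroOp n k) where
  add L L' :=
    { second := fun μ ν => L.second μ ν + L'.second μ ν
      first := fun μ => L.first μ + L'.first μ
      zeroth := L.zeroth + L'.zeroth
      symm := fun μ ν => by rw [L.symm, L'.symm] }

/-- `L ∈ Diff₀²(M; ℝᵏ)`: coefficients smooth on `S`, up to `τ = 0`. -/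
def ZeroOp.IsSmoothOn (L : ZeroOp n k) (S : Set (Spacetime n)) : Prop :=
  (∀ μ ν, ContDiffOn ℝ ∞ (L.second μ ν) S) ∧ (∀ μ, ContDiffOn ℝ ∞ (L.first μ) S) ∧
    ContDiffOn ℝ ∞ L.zeroth S

/-- `L ∈ τ^η ⁰C¹ Diff₀²(M; ℝᵏ)`. -/
def ZeroOp.IsWeightedZeroC1On (L : ZeroOp n k) (S : Set (Spacetime n)) (η : ℝ) : Prop :=
  (∀ μ ν, WeightedZeroC1On S η (L.second μ ν)) ∧ (∀ μ, WeightedZeroC1On S η (L.first μ)) ∧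
    WeightedZeroC1On S η L.zeroth

/-- The principal symbol of `L` at the 0-covector with components `ζ`, in the convention
`σ(V_μ) = i ζ_μ`; so the wave operator `-∇^μ∇_μ` has symbol `g⁻¹(ζ,ζ)`. -/
def ZeroOp.principalSymbol (L : ZeroOp n k) (p : Spacetime n) (ζ : Fin (n + 1) → ℝ) :
    EndFibre k :=
  -∑ μ, ∑ ν, (ζ μ * ζ ν) • L.second μ ν p

/-- `L u = 0` in the sense of distributions on the open set `O ⊆ {τ > 0}`, for `u ∈ C¹(O)` and `L`
with `C¹` coefficients on `O`: the outer derivative in `A^{μν} τ∂_μ (V_ν u)` is moved onto the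
coefficient and the test function. -/
def ZeroOp.IsDistribSolutionOn (L : ZeroOp n k) (O : Set (Spacetime n))
    (u : Spacetime n → Fibre k) : Prop :=
  ∀ φ : Spacetime n → ℝ, ContDiff ℝ ∞ φ → HasCompactSupport φ → tsupport φ ⊆ O →
    ∫ p in O,
      (-(∑ μ, ∑ ν, (fderiv ℝ (fun q : Spacetime n => (q.1 * φ q) • L.second μ ν q) p
            (coordFrame n μ)) (zeroDeriv ν u p))
        + ∑ μ, φ p • L.first μ p (zeroDeriv μ u p)
        + φ p • L.zeroth p (u p)) = 0

end Operators

end ZeroGeometry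

end

open ZeroGeometry

/-! The proof is a weighted energy estimate. Contracting the energy-momentum tensor of `u` with the
gradient of `τ`, and adding `|u|²` to the `τ`-component, gives a current `J`. By the dominant energy
condition its density `E = J⁰` is positive definite in the 0-jet `(V_μ u, u)`, and its flux through
the spacelike lateral boundary is outgoing. The equation gives `div J = τ⁻¹ Q`, where `Q` is a
quadratic form in the 0-jet with coefficients continuous up to `τ = 0`. On a compact set, `Q ≤ M E`
for some `M`.

Test this identity with `τ^{-(M+1)}` times cutoffs. Differentiating the weight produces `-(M+1)
τ^{-M-2} E`, which beats the source `M τ^{-M-2} E`. The cutoffs at late time and at the lateral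
boundary contribute with a favourable sign. The cutoff on `ε ≤ τ ≤ 2ε` contributes `O(ε)` as soon as
`E = O(τ^{M+2})`. Letting `ε → 0` forces `E = 0` (`density_eq_zero_of_divergence_le`).

The order `N` depends only on data at `τ = 0`: there the `τ^η` perturbations vanish, and so do the
derivatives of the metric along the 0-frame, since these carry a factor `τ`. If `Q ≤ m E` at `τ =
0`, then `Q ≤ (m+1) E` for small `τ` by compactness, and `N = m + 2` suffices to kill `E` there.
Further in, only some larger `M` is available, but `E` now vanishes near `τ = 0` and hence decays to
every order, so a second application finishes (`eq_zero_of_zeroJet_le`).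

As `u` is only a `C¹` weak solution, the energy identity is obtained by mollification. By
Friedrichs' lemma (`norm_commutator_mollifier_le`) the mollified functions converge in `C¹` on
compact sets, and the principal part applied to them converges uniformly. The identity for smooth
functions involves second derivatives only through the principal part, so it passes to the limit
(`weak_energy_identity`). -/

/-! ### Mollifiers and Friedrichs' lemma -/

section Mollification

open MeasureTheory Metric Module

variable {E : Type*} [NormedAddCommGroup E] [NormedSpace ℝ E] [FiniteDimensional ℝ E]
  [MeasurableSpace E] [BorelSpace E]
variable {F : Type*} [NormedAddCommGroup F] [NormedSpace ℝ F]

/-- A family of mollifiers with the scaling bounds of `x ↦ δ⁻ᵈ ρ (x / δ)`. -/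
theorem exists_mollifier_family (μ : Measure E) [μ.IsAddHaarMeasure] :
    ∃ (ρ : ℝ → E → ℝ) (B : ℝ), 0 ≤ B ∧ ∀ δ : ℝ, 0 < δ →
      ContDiff ℝ ∞ (ρ δ) ∧ Function.support (ρ δ) ⊆ ball 0 δ ∧ (∀ x, 0 ≤ ρ δ x) ∧
      ∫ x, ρ δ x ∂μ = 1 ∧ (∀ x, ρ δ x * δ ^ finrank ℝ E ≤ B) ∧
      ∀ x, ‖fderiv ℝ (ρ δ) x‖ * δ ^ (finrank ℝ E + 1) ≤ B := by
  let b : ContDiffBump (0 : E) := ⟨1 / 2, 1, by norm_num, by norm_num⟩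
  set ρ : E → ℝ := b.normed μ with hρ
  have hs : ContDiff ℝ ∞ ρ := b.contDiff_normed
  have hc : HasCompactSupport ρ := b.hasCompactSupport_normed
  have hsupp : Function.support ρ = ball 0 1 := b.support_normed_eq
  obtain ⟨B₁, hB₁⟩ := hs.continuous.bounded_above_of_compact_support hc
  obtain ⟨B₂, hB₂⟩ := (hs.continuous_fderiv (by simp)).bounded_above_of_compact_support
    (hc.fderiv ℝ)
  refine ⟨fun δ x => (δ ^ finrank ℝ E)⁻¹ * ρ (δ⁻¹ • x), max B₁ B₂,
    le_max_of_le_left ((norm_nonneg _).trans (hB₁ 0)), fun δ hδ => ?_⟩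
  have hd : 0 < δ ^ finrank ℝ E := by positivity
  refine ⟨?_, ?_, ?_, ?_, ?_, ?_⟩
  · fun_prop
  · intro x hx
    have : δ⁻¹ • x ∈ Function.support ρ := fun h => hx (by simp [h])
    rw [hsupp, mem_ball_zero_iff, norm_smul, norm_inv, Real.norm_of_nonneg hδ.le,
      inv_mul_lt_iff₀ hδ, mul_one] at this
    simpa using this
  · exact fun x => mul_nonneg (inv_nonneg.2 hd.le) (b.nonneg_normed _)
  · rw [integral_const_mul, Measure.integral_comp_inv_smul_of_nonneg μ ρ hδ.le,
      b.integral_normed, smul_eq_mul, mul_one, inv_mul_cancel₀ hd.ne']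
  · intro x
    have := (Real.le_norm_self _).trans (hB₁ (δ⁻¹ • x))
    calc _ = ρ (δ⁻¹ • x) := by field_simp
      _ ≤ _ := this.trans (le_max_left _ _)
  · intro x
    have h1 : HasFDerivAt (fun x => (δ ^ finrank ℝ E)⁻¹ * ρ (δ⁻¹ • x))
        ((δ ^ finrank ℝ E)⁻¹ • ((fderiv ℝ ρ (δ⁻¹ • x)).comp
          (δ⁻¹ • ContinuousLinearMap.id ℝ E))) x := by
      have h2 : HasFDerivAt ρ (fderiv ℝ ρ (δ⁻¹ • x)) (δ⁻¹ • x) :=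
        (hs.differentiable (by simp) _).hasFDerivAt
      exact (h2.comp x ((hasFDerivAt_id x).const_smul δ⁻¹)).const_mul _
    rw [h1.fderiv, ContinuousLinearMap.comp_smul, ContinuousLinearMap.comp_id, norm_smul,
      norm_smul, norm_inv, norm_inv, Real.norm_of_nonneg hδ.le, Real.norm_of_nonneg hd.le]
    calc _ = ‖fderiv ℝ ρ (δ⁻¹ • x)‖ := by
          generalize ‖fderiv ℝ ρ (δ⁻¹ • x)‖ = c
          field_simp
          ring
      _ ≤ _ := (hB₂ _).trans (le_max_right _ _)

theorem integral_fderiv_apply_eq_zero {μ : Measure E} [μ.IsAddHaarMeasure] {f : E → ℝ}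
    (hf : ContDiff ℝ 1 f) (hc : HasCompactSupport f) (v : E) :
    ∫ x, fderiv ℝ f x v ∂μ = 0 := by
  have hd : Continuous fun x => fderiv ℝ f x v := (hf.continuous_fderiv one_ne_zero).clm_apply
    continuous_const
  have hdc : HasCompactSupport fun x => fderiv ℝ f x v := hc.fderiv_apply ℝ v
  -- Integration by parts against the constant function `1`.
  have := integral_mul_fderiv_eq_neg_fderiv_mul_of_integrable (μ := μ) (f := fun _ : E => (1 : ℝ))
    (g := f) (v := v) (by simp) (by simpa using hd.integrable_of_hasCompactSupport hdc)
    (by simpa using hf.continuous.integrable_of_hasCompactSupport hc)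
    (fun x _ => by fun_prop) (fun x _ => hf.differentiable one_ne_zero x)
  simpa using this

/-- **Friedrichs' lemma**: the commutator of mollification with `a ∂_e`, `a ∈ C¹`, tends to zero
uniformly on continuous functions. -/
theorem norm_commutator_mollifier_le [CompleteSpace F] {μ : Measure E} [μ.IsAddHaarMeasure]
    {ρ : E → ℝ} {B δ : ℝ}
    (hδ : 0 < δ) (hρ : ContDiff ℝ ∞ ρ) (hsupp : Function.support ρ ⊆ ball 0 δ)
    (hB : ∀ x, |ρ x| * δ ^ finrank ℝ E ≤ B)
    (hB' : ∀ x, ‖fderiv ℝ ρ x‖ * δ ^ (finrank ℝ E + 1) ≤ B)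
    {a : E → ℝ} (ha : ContDiff ℝ 1 a) {Λ : ℝ} (hΛ : ∀ x, ‖fderiv ℝ a x‖ ≤ Λ)
    {w : E → F} (hw : Continuous w) (e p : E) {κ : ℝ}
    (hκ : ∀ q ∈ closedBall p δ, ‖w q - w p‖ ≤ κ) :
    ‖a p • (∫ q, fderiv ℝ ρ (p - q) e • w q ∂μ) +
        ∫ q, fderiv ℝ (fun q => ρ (p - q) * a q) q e • w q ∂μ‖ ≤
      2 * B * Λ * ‖e‖ * κ * μ.real (closedBall 0 1) := by
  have hρ1 : ContDiff ℝ 1 ρ := hρ.of_le (by exact_mod_cast le_top)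
  have hcl : tsupport ρ ⊆ closedBall 0 δ :=
    closure_minimal (hsupp.trans ball_subset_closedBall) isClosed_closedBall
  have hρc : HasCompactSupport ρ := HasCompactSupport.of_support_subset_isCompact
    (isCompact_closedBall 0 δ) (hsupp.trans ball_subset_closedBall)
  have hρp : ContDiff ℝ 1 fun q => ρ (p - q) := by fun_prop
  have hρpc : HasCompactSupport fun q => ρ (p - q) :=
    hρc.comp_homeomorph (Homeomorph.subLeft p)
  -- Both integrals combine into `∫ ∂_e f • w`. As `∫ ∂_e f = 0`, the function `w` may be replaced
  -- by `w - w p`, which is small near `p`; the factor `a q - a p = O(δ)` absorbs the power of `δ`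
  -- lost in differentiating `ρ`.
  set f : E → ℝ := fun q => ρ (p - q) * (a q - a p) with hf
  have hf1 : ContDiff ℝ 1 f := by fun_prop
  have hfc : HasCompactSupport f := hρpc.mul_right
  have hdρ : ∀ q, fderiv ℝ (fun q => ρ (p - q)) q e = - fderiv ℝ ρ (p - q) e := by
    intro q
    have h1 : HasFDerivAt ρ (fderiv ℝ ρ (p - q)) (p - q) :=
      (hρ1.differentiable one_ne_zero _).hasFDerivAt
    have h2 := (h1.comp q ((hasFDerivAt_id q).const_sub p)).fderiv
    change fderiv ℝ (ρ ∘ fun q => p - q) q e = _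
    simp [h2]
  have hd1 : ∀ q, fderiv ℝ (fun q => ρ (p - q) * a q) q e =
      ρ (p - q) * fderiv ℝ a q e - a q * fderiv ℝ ρ (p - q) e := by
    intro q
    have := fderiv_fun_mul (hρp.differentiable one_ne_zero q) (ha.differentiable one_ne_zero q)
    rw [this]
    simp [hdρ]; ring
  have hd2 : ∀ q, fderiv ℝ f q e =
      ρ (p - q) * fderiv ℝ a q e - (a q - a p) * fderiv ℝ ρ (p - q) e := by
    intro q
    have := fderiv_fun_mul (hρp.differentiable one_ne_zero q)
      ((ha.differentiable one_ne_zero q).sub_const (a p))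
    rw [hf, this]
    simp [hdρ, fderiv_sub_const]; ring
  have hcρ' : Continuous fun q => fderiv ℝ ρ (p - q) e :=
    ((hρ1.continuous_fderiv one_ne_zero).comp (by fun_prop)).clm_apply continuous_const
  have hρ'c : HasCompactSupport fun q => fderiv ℝ ρ (p - q) e :=
    (hρc.fderiv_apply ℝ e).comp_homeomorph (Homeomorph.subLeft p)
  have hca' : Continuous fun q => fderiv ℝ a q e :=
    (ha.continuous_fderiv one_ne_zero).clm_apply continuous_const
  have hi1 : Integrable (fun q => fderiv ℝ ρ (p - q) e • w q) μ :=
    (hcρ'.smul hw).integrable_of_hasCompactSupport hρ'c.smul_right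
  have hi2 : Integrable (fun q => fderiv ℝ (fun q => ρ (p - q) * a q) q e • w q) μ := by
    refine Continuous.integrable_of_hasCompactSupport ?_ ?_
    · simp only [hd1]
      have := ha.continuous
      have := hρp.continuous
      fun_prop
    · exact ((hρpc.mul_right (f' := a)).fderiv_apply ℝ e).smul_right
  have hcf' : Continuous fun q => fderiv ℝ f q e :=
    (hf1.continuous_fderiv one_ne_zero).clm_apply continuous_const
  have hfc' : HasCompactSupport fun q => fderiv ℝ f q e := hfc.fderiv_apply ℝ e
  have key : a p • (∫ q, fderiv ℝ ρ (p - q) e • w q ∂μ) +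
        ∫ q, fderiv ℝ (fun q => ρ (p - q) * a q) q e • w q ∂μ =
      ∫ q, fderiv ℝ f q e • (w q - w p) ∂μ := by
    have h0 : ∫ q, fderiv ℝ f q e • w p ∂μ = 0 := by
      rw [integral_smul_const, integral_fderiv_apply_eq_zero hf1 hfc, zero_smul]
    have h3 : ∫ q, fderiv ℝ f q e • (w q - w p) ∂μ = ∫ q, fderiv ℝ f q e • w q ∂μ := by
      simp only [smul_sub]
      rw [integral_sub, h0, sub_zero]
      · exact (hcf'.smul hw).integrable_of_hasCompactSupport hfc'.smul_right
      · exact (hcf'.smul continuous_const).integrable_of_hasCompactSupport hfc'.smul_right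
    rw [h3, ← integral_smul, ← integral_add (hi1.fun_smul (a p)) hi2]
    refine integral_congr_ae (Filter.Eventually.of_forall fun q => ?_)
    simp only [hd1, hd2, smul_smul, ← add_smul]
    congr 1; ring
  rw [key]
  have hout : ∀ q, q ∉ closedBall p δ → fderiv ℝ f q e • (w q - w p) = 0 := by
    intro q hq
    have hq' : p - q ∉ tsupport ρ := fun h => hq (by
      have := hcl h
      rw [mem_closedBall_zero_iff] at this
      rwa [mem_closedBall, dist_eq_norm, norm_sub_rev])
    rw [hd2, image_eq_zero_of_notMem_tsupport hq', fderiv_of_notMem_tsupport ℝ hq']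
    simp
  rw [← setIntegral_eq_integral_of_forall_compl_eq_zero (s := closedBall p δ) hout]
  have hdp : 0 < δ ^ finrank ℝ E := by positivity
  have hκ0 : 0 ≤ κ := (norm_nonneg _).trans (hκ p (mem_closedBall_self hδ.le))
  have hΛ0 : 0 ≤ Λ := (norm_nonneg _).trans (hΛ p)
  -- The bound is of size `δ⁻ᵈ`, compensated by the volume of the ball of radius `δ`.
  have hpt : ∀ q ∈ closedBall p δ, ‖fderiv ℝ f q e • (w q - w p)‖ ≤
      2 * B * Λ * ‖e‖ * κ / δ ^ finrank ℝ E := by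
    intro q hq
    rw [norm_smul, le_div_iff₀ hdp]
    have hl : |a q - a p| ≤ Λ * δ := by
      have := Convex.norm_image_sub_le_of_norm_fderiv_le (𝕜 := ℝ) (s := Set.univ) (f := a)
        (x := p) (y := q) (fun x _ => ha.differentiable one_ne_zero x) (fun x _ => hΛ x)
        convex_univ trivial trivial
      rw [mem_closedBall, dist_eq_norm] at hq
      exact this.trans (by gcongr)
    have h1 : |ρ (p - q) * fderiv ℝ a q e| * δ ^ finrank ℝ E ≤ B * Λ * ‖e‖ := by
      rw [abs_mul]
      have := (fderiv ℝ a q).le_of_opNorm_le (hΛ q) e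
      calc |ρ (p - q)| * |fderiv ℝ a q e| * δ ^ finrank ℝ E
          = (|ρ (p - q)| * δ ^ finrank ℝ E) * |fderiv ℝ a q e| := by ring
        _ ≤ B * (Λ * ‖e‖) := by
          gcongr
          · exact le_trans (by positivity) (hB 0)
          · exact hB _
          · exact this
        _ = _ := by ring
    have h2 : |(a q - a p) * fderiv ℝ ρ (p - q) e| * δ ^ finrank ℝ E ≤ B * Λ * ‖e‖ := by
      rw [abs_mul]
      have := (fderiv ℝ ρ (p - q)).le_opNorm e
      calc |a q - a p| * |fderiv ℝ ρ (p - q) e| * δ ^ finrank ℝ E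
          ≤ (Λ * δ) * (‖fderiv ℝ ρ (p - q)‖ * ‖e‖) * δ ^ finrank ℝ E := by
            gcongr
            exact this
        _ = Λ * ‖e‖ * (‖fderiv ℝ ρ (p - q)‖ * δ ^ (finrank ℝ E + 1)) := by ring
        _ ≤ Λ * ‖e‖ * B := by gcongr; exact hB' _
        _ = _ := by ring
    have h3 : ‖fderiv ℝ f q e‖ * δ ^ finrank ℝ E ≤ 2 * B * Λ * ‖e‖ := by
      rw [hd2, Real.norm_eq_abs]
      calc _ ≤ (|ρ (p - q) * fderiv ℝ a q e| + |(a q - a p) * fderiv ℝ ρ (p - q) e|) *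
            δ ^ finrank ℝ E := by gcongr; exact abs_sub _ _
        _ ≤ _ := by linarith
    calc _ = ‖fderiv ℝ f q e‖ * δ ^ finrank ℝ E * ‖w q - w p‖ := by ring
      _ ≤ 2 * B * Λ * ‖e‖ * κ := by
        gcongr
        · exact le_trans (by positivity) h3
        · exact hκ q hq
  have := norm_setIntegral_le_of_norm_le_const (μ := μ)
    (measure_closedBall_lt_top (x := p) (r := δ)) hpt
  refine this.trans (le_of_eq ?_)
  rw [Measure.addHaar_real_closedBall' μ p hδ.le]
  field_simp

end Mollification

/-! ### Smooth approximation of weak solutions -/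

section Mollification

open MeasureTheory Metric Module

variable {E : Type*} [NormedAddCommGroup E] [NormedSpace ℝ E] [FiniteDimensional ℝ E]
  [MeasurableSpace E] [BorelSpace E]
variable {F : Type*} [NormedAddCommGroup F] [NormedSpace ℝ F]

open scoped Convolution in
theorem fderiv_convolution_lsmul_right [CompleteSpace F] {μ : Measure E} [μ.IsAddHaarMeasure]
    {ρ : E → ℝ}
    (hρ : Continuous ρ) {u : E → F} (hu : ContDiff ℝ 1 u) (huc : HasCompactSupport u)
    (p e : E) :
    fderiv ℝ (ρ ⋆[ContinuousLinearMap.lsmul ℝ ℝ, μ] u) p e =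
      (ρ ⋆[ContinuousLinearMap.lsmul ℝ ℝ, μ] fun q => fderiv ℝ u q e) p := by
  rw [(huc.hasFDerivAt_convolution_right (ContinuousLinearMap.lsmul ℝ ℝ)
    hρ.locallyIntegrable hu p).fderiv]
  exact convolution_precompR_apply _ hρ.locallyIntegrable (huc.fderiv ℝ)
    (hu.continuous_fderiv one_ne_zero) p e

open scoped Convolution in
theorem fderiv_convolution_lsmul_left [CompleteSpace F] {μ : Measure E} [μ.IsAddHaarMeasure]
    {ρ : E → ℝ}
    (hρ : ContDiff ℝ 1 ρ) (hρc : HasCompactSupport ρ) {w : E → F} (hw : Continuous w)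
    (p e : E) :
    fderiv ℝ (ρ ⋆[ContinuousLinearMap.lsmul ℝ ℝ, μ] w) p e =
      ∫ q, fderiv ℝ ρ (p - q) e • w q ∂μ := by
  rw [(hρc.hasFDerivAt_convolution_left (ContinuousLinearMap.lsmul ℝ ℝ) hρ
    hw.locallyIntegrable p).fderiv]
  have hex := (hρc.fderiv ℝ).convolutionExists_left
    ((ContinuousLinearMap.lsmul ℝ ℝ).precompL E : _ →L[ℝ] F →L[ℝ] E →L[ℝ] F)
    (hρ.continuous_fderiv one_ne_zero) (hw.locallyIntegrable (μ := μ)) p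
  rw [convolution_eq_swap, ContinuousLinearMap.integral_apply]
  · rfl
  · exact hex.integrable_swap

open scoped Convolution in
/-- Mollification of a compactly supported weak solution of `∑ g^{μν} ∂_μ ∂_ν u = f`. -/
theorem exists_smooth_approx_of_compactSupport [CompleteSpace F] {μ : Measure E}
    [μ.IsAddHaarMeasure]
    {ι : Type*} [Fintype ι] (e : ι → E) {g : ι → ι → E → ℝ} {u f : E → F} {O K : Set E}
    (hg : ∀ i j, ContDiff ℝ 1 (g i j)) (hgc : ∀ i j, HasCompactSupport (g i j))
    (hu : ContDiff ℝ 1 u) (huc : HasCompactSupport u)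
    (hf : Continuous f) (hfc : HasCompactSupport f) (hO : IsOpen O) (hK : IsCompact K)
    (hKO : K ⊆ O)
    (hweak : ∀ φ : E → ℝ, ContDiff ℝ ∞ φ → HasCompactSupport φ → tsupport φ ⊆ O →
      ∫ p, ((∑ i, ∑ j, fderiv ℝ (fun q => φ q * g i j q) p (e i) • fderiv ℝ u p (e j))
        + φ p • f p) ∂μ = 0)
    {ε : ℝ} (hε : 0 < ε) :
    ∃ v : E → F, ContDiff ℝ ∞ v ∧ ∀ p ∈ K, ‖v p - u p‖ ≤ ε ∧
      (∀ j, ‖fderiv ℝ v p (e j) - fderiv ℝ u p (e j)‖ ≤ ε) ∧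
      ‖(∑ i, ∑ j, g i j p • fderiv ℝ (fun q => fderiv ℝ v q (e j)) p (e i)) - f p‖ ≤ ε := by
  obtain ⟨ρ, B, hB0, hρ⟩ := exists_mollifier_family μ
  have hΛ : ∀ i j, ∃ Λ : ℝ, ∀ x, ‖fderiv ℝ (g i j) x‖ ≤ Λ := fun i j =>
    ((hg i j).continuous_fderiv one_ne_zero).bounded_above_of_compact_support ((hgc i j).fderiv ℝ)
  choose Λ hΛ using hΛ
  have hΛ0 : ∀ i j, 0 ≤ Λ i j := fun i j => (norm_nonneg _).trans (hΛ i j 0)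
  set V : ℝ := μ.real (closedBall (0 : E) 1)
  have hV : 0 ≤ V := measureReal_nonneg
  set S : ℝ := ∑ i, ∑ j, 2 * B * Λ i j * ‖e i‖ * ‖e j‖ * V
  have hS : 0 ≤ S := Finset.sum_nonneg fun i _ => Finset.sum_nonneg fun j _ => by
    have := hΛ0 i j
    positivity
  -- If `u`, its derivative and `f` oscillate by at most `κ` at scale `δ`, then the errors to be
  -- bounded are at most `κ`, `κ * ‖e j‖` and `κ * S + κ`. All of these are at most `κ * T = ε`.
  set T : ℝ := 1 + ∑ j, ‖e j‖ + S
  have hsum0 : 0 ≤ ∑ j, ‖e j‖ := Finset.sum_nonneg fun j _ => norm_nonneg _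
  have hT : 0 < T := by positivity
  set κ : ℝ := ε / T
  have hκ : 0 < κ := by positivity
  have hκT : κ * T = ε := div_mul_cancel₀ _ hT.ne'
  have hu' : Continuous (fderiv ℝ u) := hu.continuous_fderiv one_ne_zero
  have huc1 := huc.uniformContinuous_of_continuous hu.continuous
  have huc2 := (huc.fderiv ℝ).uniformContinuous_of_continuous hu'
  have huc3 := hfc.uniformContinuous_of_continuous hf
  obtain ⟨δ₁, hδ₁, h1⟩ := Metric.uniformContinuous_iff.1 huc1 κ hκ
  obtain ⟨δ₂, hδ₂, h2⟩ := Metric.uniformContinuous_iff.1 huc2 κ hκ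
  obtain ⟨δ₃, hδ₃, h3⟩ := Metric.uniformContinuous_iff.1 huc3 κ hκ
  -- This keeps the mollifier centred at a point of `K` supported in `O`, so that it is an
  -- admissible test function.
  obtain ⟨δ₄, hδ₄, h4⟩ := hK.exists_cthickening_subset_open hO hKO
  set δ : ℝ := min (min δ₁ δ₂) (min δ₃ δ₄) / 2
  have hδ : 0 < δ := by positivity
  have hm : 2 * δ = min (min δ₁ δ₂) (min δ₃ δ₄) := by simp only [δ]; ring
  have hδ1 : δ < δ₁ := by
    have : 2 * δ ≤ δ₁ := hm.le.trans ((min_le_left _ _).trans (min_le_left _ _))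
    linarith
  have hδ2 : δ < δ₂ := by
    have : 2 * δ ≤ δ₂ := hm.le.trans ((min_le_left _ _).trans (min_le_right _ _))
    linarith
  have hδ3 : δ < δ₃ := by
    have : 2 * δ ≤ δ₃ := hm.le.trans ((min_le_right _ _).trans (min_le_left _ _))
    linarith
  have hδ4 : δ < δ₄ := by
    have : 2 * δ ≤ δ₄ := hm.le.trans ((min_le_right _ _).trans (min_le_right _ _))
    linarith
  obtain ⟨hρs, hρsupp, hρ0, hρ1, hρB, hρB'⟩ := hρ δ hδ
  have hρs1 : ContDiff ℝ 1 (ρ δ) := hρs.of_le (by exact_mod_cast le_top)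
  have hρc : HasCompactSupport (ρ δ) := HasCompactSupport.of_support_subset_isCompact
    (isCompact_closedBall 0 δ) (hρsupp.trans ball_subset_closedBall)
  have hρcl : tsupport (ρ δ) ⊆ closedBall 0 δ :=
    closure_minimal (hρsupp.trans ball_subset_closedBall) isClosed_closedBall
  have hdv : ∀ j, (fun q => fderiv ℝ (ρ δ ⋆[ContinuousLinearMap.lsmul ℝ ℝ, μ] u) q (e j)) =
      (ρ δ ⋆[ContinuousLinearMap.lsmul ℝ ℝ, μ] fun q => fderiv ℝ u q (e j)) := fun j =>
    funext fun q => fderiv_convolution_lsmul_right hρs.continuous hu huc q (e j)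
  have hwc : ∀ j, Continuous fun q => fderiv ℝ u q (e j) := fun j =>
    hu'.clm_apply continuous_const
  have hosc : ∀ j p q, dist q p < δ₂ → ‖fderiv ℝ u q (e j) - fderiv ℝ u p (e j)‖ ≤ κ * ‖e j‖ := by
    intro j p q hq
    have := (h2 hq).le
    rw [dist_eq_norm] at this
    rw [← sub_apply]
    exact ContinuousLinearMap.le_of_opNorm_le _ this _
  have hejs : ∀ j, ‖e j‖ ≤ ∑ j, ‖e j‖ := fun j =>
    Finset.single_le_sum (f := fun j => ‖e j‖) (fun j _ => norm_nonneg _) (Finset.mem_univ j)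
  refine ⟨ρ δ ⋆[ContinuousLinearMap.lsmul ℝ ℝ, μ] u,
    hρc.contDiff_convolution_left _ hρs hu.continuous.locallyIntegrable, fun p hp => ⟨?_, ?_, ?_⟩⟩
  · rw [← dist_eq_norm]
    refine (dist_convolution_le hκ.le hρsupp hρ0 hρ1 hu.continuous.aestronglyMeasurable
      fun q hq => (h1 (lt_trans hq hδ1)).le).trans ?_
    rw [← hκT]
    refine le_mul_of_one_le_right hκ.le ?_
    simp only [T]; linarith
  · intro j
    rw [fderiv_convolution_lsmul_right hρs.continuous hu huc, ← dist_eq_norm]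
    refine (dist_convolution_le (ε := κ * ‖e j‖) (by positivity) hρsupp hρ0 hρ1
      (hwc j).aestronglyMeasurable fun q hq => ?_).trans ?_
    · rw [dist_eq_norm]
      exact hosc j p q (lt_trans hq hδ2)
    · rw [← hκT]
      gcongr
      have := hejs j
      simp only [T]; linarith
  · have hφs : ContDiff ℝ ∞ fun q => ρ δ (p - q) := by fun_prop
    have hφc : HasCompactSupport fun q => ρ δ (p - q) :=
      hρc.comp_homeomorph (Homeomorph.subLeft p)
    have hφsupp : tsupport (fun q => ρ δ (p - q)) ⊆ O := by
      refine (closure_minimal (t := closedBall p δ) ?_ isClosed_closedBall).trans ?_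
      · intro q hq
        have : p - q ∈ ball (0 : E) δ := hρsupp hq
        rw [mem_ball_zero_iff] at this
        rw [mem_closedBall, dist_eq_norm, norm_sub_rev]
        exact this.le
      · exact (closedBall_subset_closedBall hδ4.le).trans
          ((closedBall_subset_cthickening hp _).trans h4)
    have hw := hweak _ hφs hφc hφsupp
    have hiij : ∀ i j, Integrable (fun q => fderiv ℝ (fun q => ρ δ (p - q) * g i j q) q (e i) •
        fderiv ℝ u q (e j)) μ := by
      intro i j
      have hc1 : ContDiff ℝ 1 fun q => ρ δ (p - q) * g i j q := by
        have := hg i j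
        fun_prop
      exact (((hc1.continuous_fderiv one_ne_zero).clm_apply continuous_const).smul
        (hwc j)).integrable_of_hasCompactSupport
        ((hφc.mul_right (f' := g i j)).fderiv_apply ℝ (e i)).smul_right
    have hif : Integrable (fun q => ρ δ (p - q) • f q) μ :=
      (hφs.continuous.smul hf).integrable_of_hasCompactSupport hφc.smul_right
    rw [integral_add (integrable_finsetSum _ fun i _ => integrable_finsetSum _ fun j _ => hiij i j)
      hif, integral_finsetSum _ (fun i _ => integrable_finsetSum _ fun j _ => hiij i j)] at hw
    simp_rw [integral_finsetSum _ (fun j (_ : j ∈ Finset.univ) => hiij _ j)] at hw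
    have hmain : ∀ i j, ‖g i j p • (∫ q, fderiv ℝ (ρ δ) (p - q) (e i) • fderiv ℝ u q (e j) ∂μ) +
        ∫ q, fderiv ℝ (fun q => ρ δ (p - q) * g i j q) q (e i) • fderiv ℝ u q (e j) ∂μ‖ ≤
        2 * B * Λ i j * ‖e i‖ * (κ * ‖e j‖) * V := by
      intro i j
      refine norm_commutator_mollifier_le hδ hρs hρsupp ?_ hρB' (hg i j) (hΛ i j) (hwc j) (e i) p
        fun q hq => hosc j p q (lt_of_le_of_lt hq hδ2)
      intro x
      rw [abs_of_nonneg (hρ0 x)]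
      exact hρB x
    have hfp : ‖(∫ q, ρ δ (p - q) • f q ∂μ) - f p‖ ≤ κ := by
      rw [← convolution_lsmul_swap, ← dist_eq_norm]
      exact dist_convolution_le hκ.le hρsupp hρ0 hρ1 hf.aestronglyMeasurable
        fun q hq => (h3 (lt_trans hq hδ3)).le
    simp_rw [hdv, fderiv_convolution_lsmul_left hρs1 hρc (hwc _)]
    set X : ι → ι → F := fun i j => g i j p •
      (∫ q, fderiv ℝ (ρ δ) (p - q) (e i) • fderiv ℝ u q (e j) ∂μ) with hX
    set Y : ι → ι → F := fun i j =>
      ∫ q, fderiv ℝ (fun q => ρ δ (p - q) * g i j q) q (e i) • fderiv ℝ u q (e j) ∂μ with hY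
    -- The weak equation tested with `ρ δ (p - ·)` says that the `Y i j` sum to minus the
    -- mollification of `f`. Each `X i j + Y i j` is a Friedrichs commutator.
    have hrew : (∑ i, ∑ j, X i j) - f p =
        (∑ i, ∑ j, (X i j + Y i j)) + ((∫ q, ρ δ (p - q) • f q ∂μ) - f p) := by
      simp only [Finset.sum_add_distrib]
      have hw' : (∑ i, ∑ j, Y i j) + ∫ q, ρ δ (p - q) • f q ∂μ = 0 := hw
      rw [eq_neg_of_add_eq_zero_left hw']
      abel
    calc ‖(∑ i, ∑ j, X i j) - f p‖ ≤ ‖∑ i, ∑ j, (X i j + Y i j)‖ + κ := by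
          rw [hrew]
          exact (norm_add_le _ _).trans (by gcongr)
      _ ≤ (∑ i, ∑ j, 2 * B * Λ i j * ‖e i‖ * (κ * ‖e j‖) * V) + κ := by
          gcongr
          exact norm_sum_le_of_le _ fun i _ => norm_sum_le_of_le _ fun j _ => hmain i j
      _ = κ * S + κ := by
          simp only [S, Finset.mul_sum]
          congr 1
          refine Finset.sum_congr rfl fun i _ => Finset.sum_congr rfl fun j _ => by ring
      _ ≤ κ * T := by
          have : 0 ≤ κ * ∑ j, ‖e j‖ := by positivity
          simp only [T]; linarith
      _ = ε := hκT

end Mollification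

section Cutoff

open Metric

variable {E : Type*} [NormedAddCommGroup E] [NormedSpace ℝ E]

-- The cutoff equals `1` on a whole neighbourhood of `K`, so multiplying by it changes neither
-- functions nor derivatives there.
open scoped Manifold in
theorem exists_contDiff_cutoff [FiniteDimensional ℝ E] {K O : Set E}
    (hK : IsCompact K) (hO : IsOpen O) (hKO : K ⊆ O) :
    ∃ (χ : E → ℝ) (O' : Set E), ContDiff ℝ ∞ χ ∧ HasCompactSupport χ ∧ tsupport χ ⊆ O ∧
      IsOpen O' ∧ K ⊆ O' ∧ O' ⊆ O ∧ ∀ x ∈ O', χ x = 1 := by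
  obtain ⟨δ, hδ, hsub⟩ := hK.exists_cthickening_subset_open hO hKO
  have hcomp : IsCompact (cthickening δ K) := hK.cthickening
  obtain ⟨χ, h1, h0, -⟩ := exists_contMDiffMap_one_nhds_of_subset_interior (n := (⊤ : ℕ∞)) 𝓘(ℝ, E)
    (s := K) (t := cthickening δ K) hK.isClosed
    ((self_subset_thickening hδ K).trans
      (interior_maximal (thickening_subset_cthickening δ K) isOpen_thickening))
  have hts : tsupport χ ⊆ cthickening δ K :=
    closure_minimal (fun x hx => by_contra fun h => hx (h0 x h)) isClosed_cthickening
  obtain ⟨O', hO', hKO', h1'⟩ := mem_nhdsSet_iff_exists.1 h1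
  exact ⟨χ, O' ∩ O, χ.contMDiff.contDiff,
    HasCompactSupport.of_support_subset_isCompact hcomp ((subset_tsupport _).trans hts),
    hts.trans hsub, hO'.inter hO, fun x hx => ⟨hKO' hx, hKO hx⟩, Set.inter_subset_right,
    fun x hx => h1' hx.1⟩

theorem ContDiffOn.contDiff_smul_of_tsupport_subset {F : Type*} [NormedAddCommGroup F]
    [NormedSpace ℝ F] {n : ℕ∞} {χ : E → ℝ} {u : E → F} {O : Set E}
    (hu : ContDiffOn ℝ n u O) (hO : IsOpen O) (hχ : ContDiff ℝ n χ) (hsupp : tsupport χ ⊆ O) :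
    ContDiff ℝ n fun x => χ x • u x := by
  refine contDiff_iff_contDiffAt.2 fun x => ?_
  by_cases hx : x ∈ tsupport χ
  · exact hχ.contDiffAt.smul (hu.contDiffAt (hO.mem_nhds (hsupp hx)))
  · have h0 : (fun x => χ x • u x) =ᶠ[nhds x] fun _ => 0 := by
      filter_upwards [notMem_tsupport_iff_eventuallyEq.1 hx] with y hy
      simp [hy]
    exact contDiffAt_const.congr_of_eventuallyEq h0

end Cutoff

section Mollification

open MeasureTheory

variable {E : Type*} [NormedAddCommGroup E] [NormedSpace ℝ E] [FiniteDimensional ℝ E]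
  [MeasurableSpace E] [BorelSpace E]
variable {F : Type*} [NormedAddCommGroup F] [NormedSpace ℝ F]

/-- Mollification of a weak solution of `∑ g^{μν} ∂_μ ∂_ν u = f` on an open set. -/
theorem exists_smooth_approx [CompleteSpace F] {μ : Measure E} [μ.IsAddHaarMeasure]
    {ι : Type*} [Fintype ι] (e : ι → E) {g : ι → ι → E → ℝ} {u f : E → F} {O K : Set E}
    (hg : ∀ i j, ContDiffOn ℝ 1 (g i j) O) (hu : ContDiffOn ℝ 1 u O)
    (hf : ContinuousOn f O) (hO : IsOpen O) (hK : IsCompact K) (hKO : K ⊆ O)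
    (hweak : ∀ φ : E → ℝ, ContDiff ℝ ∞ φ → HasCompactSupport φ → tsupport φ ⊆ O →
      ∫ p, ((∑ i, ∑ j, fderiv ℝ (fun q => φ q * g i j q) p (e i) • fderiv ℝ u p (e j))
        + φ p • f p) ∂μ = 0)
    {ε : ℝ} (hε : 0 < ε) :
    ∃ v : E → F, ContDiff ℝ ∞ v ∧ ∀ p ∈ K, ‖v p - u p‖ ≤ ε ∧
      (∀ j, ‖fderiv ℝ v p (e j) - fderiv ℝ u p (e j)‖ ≤ ε) ∧
      ‖(∑ i, ∑ j, g i j p • fderiv ℝ (fun q => fderiv ℝ v q (e j)) p (e i)) - f p‖ ≤ ε := by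
  obtain ⟨χ, O', hχ, hχc, hχO, hO', hKO', hO'O, hχ1⟩ := exists_contDiff_cutoff hK hO hKO
  have hχ' : ContDiff ℝ 1 χ := hχ.of_le (by exact_mod_cast le_top)
  have hueq : ∀ p ∈ O', (fun x => χ x • u x) =ᶠ[nhds p] u := fun p hp => by
    filter_upwards [hO'.mem_nhds hp] with x hx
    rw [hχ1 x hx, one_smul]
  have hfc : Continuous fun x => χ x • f x := by
    refine continuous_of_tsupport fun x hx => ?_
    exact hχ.continuous.continuousAt.smul (hf.continuousAt
      (hO.mem_nhds (hχO (tsupport_smul_subset_left χ f hx))))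
  -- Test functions are restricted to `O'`, where `χ = 1`; there the truncated equation coincides
  -- with the original one.
  have hweak' : ∀ φ : E → ℝ, ContDiff ℝ ∞ φ → HasCompactSupport φ → tsupport φ ⊆ O' →
      ∫ p, ((∑ i, ∑ j, fderiv ℝ (fun q => φ q * χ q • g i j q) p (e i) •
        fderiv ℝ (fun x => χ x • u x) p (e j)) + φ p • χ p • f p) ∂μ = 0 := by
    intro φ hφ hφc hφO'
    rw [← hweak φ hφ hφc (hφO'.trans hO'O)]
    refine integral_congr_ae (Filter.Eventually.of_forall fun p => ?_)
    by_cases hp : p ∈ O'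
    · have hgeq : ∀ i j, (fun q => φ q * χ q • g i j q) =ᶠ[nhds p] fun q => φ q * g i j q := by
        intro i j
        filter_upwards [hO'.mem_nhds hp] with x hx
        rw [hχ1 x hx, one_smul]
      simp only [(hueq p hp).fderiv_eq, hχ1 p hp, one_smul, (hgeq _ _).fderiv_eq]
    · have h0 : φ =ᶠ[nhds p] 0 := notMem_tsupport_iff_eventuallyEq.1 fun h => hp (hφO' h)
      have h1 : ∀ h : E → ℝ, fderiv ℝ (fun q => φ q * h q) p = 0 := by
        intro h
        have : (fun q => φ q * h q) =ᶠ[nhds p] fun _ => 0 := by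
          filter_upwards [h0] with q hq
          simp [hq]
        rw [this.fderiv_eq]
        simp
      simp only [h1, h0.self_of_nhds]
      simp
  obtain ⟨v, hv, hvK⟩ := exists_smooth_approx_of_compactSupport (μ := μ) e
    (g := fun i j x => χ x • g i j x)
    (u := fun x => χ x • u x) (f := fun x => χ x • f x) (O := O') (K := K)
    (fun i j => (hg i j).contDiff_smul_of_tsupport_subset hO hχ' hχO)
    (fun i j => hχc.smul_right) (hu.contDiff_smul_of_tsupport_subset hO hχ' hχO)
    hχc.smul_right hfc hχc.smul_right hO' hK hKO' hweak' hε
  refine ⟨v, hv, fun p hp => ?_⟩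
  have := hvK p hp
  simpa only [(hueq p (hKO' hp)).fderiv_eq, hχ1 p (hKO' hp), one_smul] using this

end Mollification

/-! ### The energy identity, for smooth functions and for weak solutions -/

section EnergyIdentity

open MeasureTheory Filter Topology
open scoped RealInnerProductSpace

theorem Finset.sum_sum_sum_swap_outer_inner {ι R : Type*} [Fintype ι] [AddCommMonoid R]
    (T : ι → ι → ι → R) :
    ∑ i, ∑ a, ∑ b, T i a b = ∑ i, ∑ a, ∑ b, T b a i := by
  calc ∑ i, ∑ a, ∑ b, T i a b = ∑ a, ∑ i, ∑ b, T i a b := Finset.sum_comm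
    _ = ∑ a, ∑ b, ∑ i, T i a b := Finset.sum_congr rfl fun a _ => Finset.sum_comm
    _ = ∑ b, ∑ a, ∑ i, T i a b := Finset.sum_comm

/-- This is the part of the divergence of the energy current in which derivatives fall on the
gradient `z`. By symmetry of `g` and of the Hessian `H`, the two terms with `Y i * g a b` are equal
and together cancel the terms `2 g^{ia} Y^b ⟪z_a, H_ib⟫`. What survives contains `H` only through
the wave operator `∑ g^{ij} H_ij`. -/
theorem sum_current_mul_hessian {ι F : Type*} [Fintype ι] [NormedAddCommGroup F]
    [InnerProductSpace ℝ F]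
    (g : ι → ι → ℝ) (hg : ∀ i j, g i j = g j i) (Y : ι → ℝ) (z : ι → F) (H : ι → ι → F)
    (hH : ∀ i j, H i j = H j i) :
    ∑ i, ∑ a, ∑ b, (2 * g i a * Y b - Y i * g a b) * (⟪H i a, z b⟫ + ⟪z a, H i b⟫) =
      2 * ⟪∑ i, ∑ j, g i j • H i j, ∑ b, Y b • z b⟫ := by
  have e1 : ⟪∑ i, ∑ j, g i j • H i j, ∑ b, Y b • z b⟫ =
      ∑ i, ∑ a, ∑ b, g i a * Y b * ⟪H i a, z b⟫ := by
    simp only [sum_inner]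
    simp only [inner_sum, real_inner_smul_left, real_inner_smul_right, mul_assoc, mul_left_comm]
  have e3 : ∑ i, ∑ a, ∑ b, Y i * g a b * ⟪H i a, z b⟫ =
      ∑ i, ∑ a, ∑ b, Y i * g a b * ⟪z a, H i b⟫ := by
    refine Finset.sum_congr rfl fun i _ => ?_
    rw [Finset.sum_comm]
    refine Finset.sum_congr rfl fun a _ => Finset.sum_congr rfl fun b _ => ?_
    rw [hg, real_inner_comm]
  have e4 : ∑ i, ∑ a, ∑ b, Y i * g a b * ⟪z a, H i b⟫ =
      ∑ i, ∑ a, ∑ b, g i a * Y b * ⟪z a, H i b⟫ := by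
    rw [Finset.sum_sum_sum_swap_outer_inner]
    refine Finset.sum_congr rfl fun i _ => Finset.sum_congr rfl fun a _ =>
      Finset.sum_congr rfl fun b _ => ?_
    rw [hg a i, hH b i]; ring
  have split : ∀ i a b, (2 * g i a * Y b - Y i * g a b) * (⟪H i a, z b⟫ + ⟪z a, H i b⟫) =
      2 * (g i a * Y b * ⟪H i a, z b⟫) + 2 * (g i a * Y b * ⟪z a, H i b⟫)
        - Y i * g a b * ⟪H i a, z b⟫ - Y i * g a b * ⟪z a, H i b⟫ := fun i a b => by ring
  simp only [split, Finset.sum_sub_distrib, Finset.sum_add_distrib, ← Finset.mul_sum]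
  rw [e1, e3, e4]
  ring

theorem tendsto_setIntegral_comp_of_uniform {E : Type*} [NormedAddCommGroup E]
    [MeasurableSpace E] [BorelSpace E] {μ : Measure E} [IsFiniteMeasureOnCompacts μ]
    {Y : Type*} [NormedAddCommGroup Y] [NormedSpace ℝ Y] [FiniteDimensional ℝ Y]
    {K : Set E} (hK : IsCompact K) {Φ : E → Y → ℝ}
    (hΦ : ContinuousOn (Function.uncurry Φ) (K ×ˢ Set.univ)) {y : E → Y} {ym : ℕ → E → Y}
    (hy : ContinuousOn y K) (hym : ∀ m, ContinuousOn (ym m) K)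
    (hlim : ∀ m, ∀ p ∈ K, ‖ym m p - y p‖ ≤ 1 / ((m : ℝ) + 1)) :
    Tendsto (fun m => ∫ p in K, Φ p (ym m p) ∂μ) atTop (𝓝 (∫ p in K, Φ p (y p) ∂μ)) := by
  -- The values of `y` and of all `ym m` stay in the ball of radius `D + 1`, over which the
  -- integrand is bounded by compactness; dominated convergence applies.
  obtain ⟨D, hD⟩ := hK.exists_bound_of_continuousOn hy
  have hball : IsCompact (Metric.closedBall (0 : Y) (D + 1)) := isCompact_closedBall _ _
  obtain ⟨B, hB⟩ := (hK.prod hball).exists_bound_of_continuousOn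
    (hΦ.mono (Set.prod_mono_right (Set.subset_univ _)))
  have hcont : ∀ {w : E → Y}, ContinuousOn w K → ContinuousOn (fun p => Φ p (w p)) K := by
    intro w hw
    exact hΦ.comp (continuousOn_id.prodMk hw) fun p hp => ⟨hp, trivial⟩
  refine tendsto_integral_of_dominated_convergence (fun _ => B) ?_ ?_ ?_ ?_
  · exact fun m => (hcont (hym m)).aestronglyMeasurable hK.measurableSet
  · exact integrableOn_const hK.measure_lt_top.ne
  · intro m
    filter_upwards [ae_restrict_mem hK.measurableSet] with p hp
    refine hB (p, ym m p) ⟨hp, ?_⟩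
    rw [mem_closedBall_zero_iff]
    have h1 : ‖ym m p‖ ≤ ‖y p‖ + ‖ym m p - y p‖ := norm_le_norm_add_norm_sub' _ _
    have h2 : 1 / ((m : ℝ) + 1) ≤ 1 := by
      rw [div_le_one (by positivity)]
      linarith [(Nat.cast_nonneg m : (0 : ℝ) ≤ m)]
    linarith [hlim m p hp, hD p hp]
  · filter_upwards [ae_restrict_mem hK.measurableSet] with p hp
    have hyt : Tendsto (fun m => ym m p) atTop (𝓝 (y p)) := by
      rw [tendsto_iff_norm_sub_tendsto_zero]
      exact squeeze_zero (fun _ => norm_nonneg _) (fun m => hlim m p hp)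
        tendsto_one_div_add_atTop_nhds_zero_nat
    have hw : Tendsto (fun m => ((p, ym m p) : E × Y)) atTop (𝓝[K ×ˢ Set.univ] (p, y p)) :=
      tendsto_nhdsWithin_iff.2 ⟨tendsto_const_nhds.prodMk_nhds hyt,
        Eventually.of_forall fun m => ⟨hp, trivial⟩⟩
    exact (hΦ (p, y p) ⟨hp, trivial⟩).tendsto.comp hw

variable {E : Type*} [NormedAddCommGroup E] [NormedSpace ℝ E] [FiniteDimensional ℝ E]
  [MeasurableSpace E] [BorelSpace E]
variable {F : Type*} [NormedAddCommGroup F] [InnerProductSpace ℝ F]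

/-- Divergence theorem for the energy current of a smooth function. -/
theorem energy_identity_of_contDiff {μ : Measure E} [μ.IsAddHaarMeasure]
    {ι : Type*} [Fintype ι] (e : ι → E) {g : ι → ι → E → ℝ} {Y : ι → E → ℝ} {v : E → F} {O : Set E}
    (hO : IsOpen O) (hsymm : ∀ i j, g i j = g j i)
    (hg : ∀ i j, ContDiffOn ℝ 1 (g i j) O) (hY : ∀ i, ContDiffOn ℝ 1 (Y i) O)
    (hv : ContDiff ℝ ∞ v) {ψ : E → ℝ} (hψ : ContDiff ℝ 1 ψ) (hψc : HasCompactSupport ψ)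
    (hψO : tsupport ψ ⊆ O) :
    ∫ p, (∑ i, fderiv ℝ ψ p (e i) * (∑ a, ∑ b, (2 * g i a p * Y b p - Y i p * g a b p) *
          ⟪fderiv ℝ v p (e a), fderiv ℝ v p (e b)⟫)
        + ψ p * (2 * ⟪∑ i, ∑ j, g i j p • fderiv ℝ (fun q => fderiv ℝ v q (e j)) p (e i),
            ∑ b, Y b p • fderiv ℝ v p (e b)⟫
          + ∑ i, ∑ a, ∑ b, fderiv ℝ (fun q => 2 * g i a q * Y b q - Y i q * g a b q) p (e i) *
          ⟪fderiv ℝ v p (e a), fderiv ℝ v p (e b)⟫)) ∂μ = 0 := by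
  have hz : ∀ a, ContDiff ℝ 1 fun q => fderiv ℝ v q (e a) := fun a =>
    ((contDiff_infty.1 hv 2).fderiv_right (m := 1) one_add_one_eq_two.le).clm_apply contDiff_const
  set c : ι → ι → ι → E → ℝ := fun i a b q => 2 * g i a q * Y b q - Y i q * g a b q with hc
  have hc1 : ∀ i a b, ContDiffOn ℝ 1 (c i a b) O := fun i a b =>
    ((contDiffOn_const.mul (hg i a)).mul (hY b)).sub ((hY i).mul (hg a b))
  set J : ι → E → ℝ := fun i q => ∑ a, ∑ b, c i a b q *
    ⟪fderiv ℝ v q (e a), fderiv ℝ v q (e b)⟫ with hJ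
  have hJ1 : ∀ i, ContDiffOn ℝ 1 (J i) O := fun i =>
    ContDiffOn.sum fun a _ => ContDiffOn.sum fun b _ =>
      (hc1 i a b).mul ((hz a).inner ℝ (hz b)).contDiffOn
  -- After multiplication by `ψ` the current is globally `C¹` with compact support, and the
  -- divergence theorem reduces to the vanishing of integrals of derivatives.
  have hJψ : ∀ i, ContDiff ℝ 1 fun q => ψ q • J i q := fun i =>
    (hJ1 i).contDiff_smul_of_tsupport_subset (n := 1) hO hψ hψO
  have hψJc : ∀ i, HasCompactSupport fun q => ψ q • J i q := fun i => hψc.smul_right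
  have h0 : ∫ p, ∑ i, fderiv ℝ (fun q => ψ q • J i q) p (e i) ∂μ = 0 := by
    rw [integral_finsetSum]
    · exact Finset.sum_eq_zero fun i _ => integral_fderiv_apply_eq_zero (hJψ i) (hψJc i) _
    · intro i _
      exact (((hJψ i).continuous_fderiv one_ne_zero).clm_apply
        continuous_const).integrable_of_hasCompactSupport ((hψJc i).fderiv_apply ℝ _)
  rw [← h0]
  refine integral_congr_ae (Eventually.of_forall fun p => ?_)
  by_cases hp : p ∈ tsupport ψ
  · have hpO : O ∈ 𝓝 p := hO.mem_nhds (hψO hp)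
    have hcd : ∀ i a b, HasFDerivAt (c i a b) (fderiv ℝ (c i a b) p) p := fun i a b =>
      (((hc1 i a b).contDiffAt hpO).differentiableAt one_ne_zero).hasFDerivAt
    have hzd : ∀ a, HasFDerivAt (fun q => fderiv ℝ v q (e a))
        (fderiv ℝ (fun q => fderiv ℝ v q (e a)) p) p := fun a =>
      ((hz a).differentiable one_ne_zero p).hasFDerivAt
    have hJd : ∀ i, fderiv ℝ (J i) p (e i) = ∑ a, ∑ b,
        (fderiv ℝ (c i a b) p (e i) * ⟪fderiv ℝ v p (e a), fderiv ℝ v p (e b)⟫ +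
          c i a b p * (⟪fderiv ℝ (fun q => fderiv ℝ v q (e a)) p (e i), fderiv ℝ v p (e b)⟫ +
            ⟪fderiv ℝ v p (e a), fderiv ℝ (fun q => fderiv ℝ v q (e b)) p (e i)⟫)) := by
      intro i
      have := HasFDerivAt.fun_sum (u := Finset.univ) fun a _ => HasFDerivAt.fun_sum
        (u := Finset.univ) fun b _ => (hcd i a b).mul ((hzd a).inner ℝ (hzd b))
      have h2 : fderiv ℝ (J i) p = _ := this.fderiv
      rw [h2]
      simp only [_root_.sum_apply, _root_.add_apply, _root_.smul_apply,
        ContinuousLinearMap.comp_apply, ContinuousLinearMap.prod_apply, fderivInnerCLM_apply,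
        smul_eq_mul]
      refine Finset.sum_congr rfl fun a _ => Finset.sum_congr rfl fun b _ => ?_
      ring
    have hψd : ∀ i, fderiv ℝ (fun q => ψ q • J i q) p (e i) =
        fderiv ℝ ψ p (e i) * J i p + ψ p * fderiv ℝ (J i) p (e i) := by
      intro i
      have := ((hψ.differentiable one_ne_zero p).hasFDerivAt.mul
        (((hJ1 i).contDiffAt hpO).differentiableAt one_ne_zero).hasFDerivAt).fderiv
      have h2 : fderiv ℝ (fun q => ψ q • J i q) p = fderiv ℝ (ψ * J i) p := rfl
      rw [h2, this]
      simp only [_root_.add_apply, _root_.smul_apply, smul_eq_mul]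
      ring
    have hHs : ∀ i j, fderiv ℝ (fun q => fderiv ℝ v q (e j)) p (e i) =
        fderiv ℝ (fun q => fderiv ℝ v q (e i)) p (e j) := by
      have hd : DifferentiableAt ℝ (fderiv ℝ v) p :=
        ((contDiff_infty.1 hv 2).fderiv_right (m := 1) one_add_one_eq_two.le).differentiable one_ne_zero p
      have hs : IsSymmSndFDerivAt ℝ v p := 
        (contDiff_infty.1 hv 2).contDiffAt.isSymmSndFDerivAt (by simp)
      intro i j
      rw [fderiv_clm_apply hd (by fun_prop), fderiv_clm_apply hd (by fun_prop)]
      simpa using hs (e i) (e j)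
    have halg := sum_current_mul_hessian (fun i j => g i j p) (fun i j => by rw [hsymm])
      (fun i => Y i p) (fun a => fderiv ℝ v p (e a))
      (fun i a => fderiv ℝ (fun q => fderiv ℝ v q (e a)) p (e i)) (fun i j => hHs i j)
    simp only [hψd, hJd, Finset.sum_add_distrib, ← Finset.mul_sum]
    rw [← halg]
    ring
  · have hψ0 : ψ =ᶠ[𝓝 p] 0 := notMem_tsupport_iff_eventuallyEq.1 hp
    have h1 : ∀ i, fderiv ℝ (fun q => ψ q • J i q) p = 0 := by
      intro i
      have : (fun q => ψ q • J i q) =ᶠ[𝓝 p] fun _ => 0 := by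
        filter_upwards [hψ0] with q hq
        simp [hq]
      rw [this.fderiv_eq]
      simp
    simp only [h1, hψ0.self_of_nhds, hψ0.fderiv_eq]
    simp

/-- Energy identity, in integrated form, for a `C¹` weak solution of `∑ g^{μν} ∂_μ ∂_ν u = f`. -/
theorem weak_energy_identity [FiniteDimensional ℝ F] {μ : Measure E} [μ.IsAddHaarMeasure]
    {ι : Type*} [Fintype ι] (e : ι → E) {g : ι → ι → E → ℝ} {Y : ι → E → ℝ} {u f : E → F}
    {O : Set E} (hO : IsOpen O) (hsymm : ∀ i j, g i j = g j i)
    (hg : ∀ i j, ContDiffOn ℝ 1 (g i j) O) (hY : ∀ i, ContDiffOn ℝ 1 (Y i) O)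
    (hu : ContDiffOn ℝ 1 u O) (hf : ContinuousOn f O)
    (hweak : ∀ φ : E → ℝ, ContDiff ℝ ∞ φ → HasCompactSupport φ → tsupport φ ⊆ O →
      ∫ p, ((∑ i, ∑ j, fderiv ℝ (fun q => φ q * g i j q) p (e i) • fderiv ℝ u p (e j))
        + φ p • f p) ∂μ = 0)
    {ψ : E → ℝ} (hψ : ContDiff ℝ 1 ψ) (hψc : HasCompactSupport ψ) (hψO : tsupport ψ ⊆ O) :
    ∫ p, (∑ i, fderiv ℝ ψ p (e i) * (∑ a, ∑ b, (2 * g i a p * Y b p - Y i p * g a b p) *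
          ⟪fderiv ℝ u p (e a), fderiv ℝ u p (e b)⟫)
        + ψ p * (2 * ⟪f p, ∑ b, Y b p • fderiv ℝ u p (e b)⟫
          + ∑ i, ∑ a, ∑ b, fderiv ℝ (fun q => 2 * g i a q * Y b q - Y i q * g a b q) p (e i) *
          ⟪fderiv ℝ u p (e a), fderiv ℝ u p (e b)⟫)) ∂μ = 0 := by
  set K := tsupport ψ with hKdef
  have hK : IsCompact K := hψc
  have hc1 : ∀ i a b, ContDiffOn ℝ 1 (fun q => 2 * g i a q * Y b q - Y i q * g a b q) O :=
    fun i a b => ((contDiffOn_const.mul (hg i a)).mul (hY b)).sub ((hY i).mul (hg a b))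
  have hz : ∀ {w : E → F}, ContDiffOn ℝ 1 w O → ∀ a, ContinuousOn (fun p => fderiv ℝ w p (e a)) O :=
    fun hw a => (hw.continuousOn_fderiv_of_isOpen hO le_rfl).clm_apply continuousOn_const
  -- The integrand as a function of the gradient and of the value of the wave operator. Individual
  -- second derivatives of the approximants need not converge, but this combination does.
  let Φ : E → (ι → F) × F → ℝ := fun p y =>
    ∑ i, fderiv ℝ ψ p (e i) * (∑ a, ∑ b, (2 * g i a p * Y b p - Y i p * g a b p) *
          ⟪y.1 a, y.1 b⟫)
        + ψ p * (2 * ⟪y.2, ∑ b, Y b p • y.1 b⟫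
          + ∑ i, ∑ a, ∑ b, fderiv ℝ (fun q => 2 * g i a q * Y b q - Y i q * g a b q) p (e i) *
          ⟪y.1 a, y.1 b⟫)
  have hΦ : ContinuousOn (Function.uncurry Φ) (K ×ˢ Set.univ) := by
    have lift : ∀ {h : E → ℝ}, ContinuousOn h K →
        ContinuousOn (fun y : E × ((ι → F) × F) => h y.1) (K ×ˢ Set.univ) := fun hh =>
      hh.comp continuousOn_fst fun y hy => hy.1
    have l1 : ∀ i, ContinuousOn (fun y : E × ((ι → F) × F) => fderiv ℝ ψ y.1 (e i))
        (K ×ˢ Set.univ) := fun i => lift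
      ((hψ.continuous_fderiv one_ne_zero).clm_apply continuous_const).continuousOn
    have l2 : ∀ i a b, ContinuousOn (fun y : E × ((ι → F) × F) =>
        2 * g i a y.1 * Y b y.1 - Y i y.1 * g a b y.1) (K ×ˢ Set.univ) := fun i a b =>
      lift (((hc1 i a b).continuousOn).mono hψO)
    have l3 : ContinuousOn (fun y : E × ((ι → F) × F) => ψ y.1) (K ×ˢ Set.univ) :=
      lift hψ.continuous.continuousOn
    have l4 : ∀ i, ContinuousOn (fun y : E × ((ι → F) × F) => Y i y.1) (K ×ˢ Set.univ) :=
      fun i => lift ((hY i).continuousOn.mono hψO)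
    have l5 : ∀ i a b, ContinuousOn (fun y : E × ((ι → F) × F) =>
        fderiv ℝ (fun q => 2 * g i a q * Y b q - Y i q * g a b q) y.1 (e i)) (K ×ˢ Set.univ) :=
      fun i a b => lift ((((hc1 i a b).continuousOn_fderiv_of_isOpen hO le_rfl).clm_apply
        continuousOn_const).mono hψO)
    have l6 : ∀ a b, ContinuousOn (fun y : E × ((ι → F) × F) => ⟪y.2.1 a, y.2.1 b⟫)
        (K ×ˢ Set.univ) := fun a b => by
      refine Continuous.continuousOn ?_
      fun_prop
    refine ContinuousOn.add ?_ (l3.mul (ContinuousOn.add ?_ ?_))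
    · exact continuousOn_finsetSum _ fun i _ => (l1 i).mul (continuousOn_finsetSum _ fun a _ =>
        continuousOn_finsetSum _ fun b _ => (l2 i a b).mul (l6 a b))
    · refine continuousOn_const.mul (ContinuousOn.inner (𝕜 := ℝ) ?_ ?_)
      · exact (continuous_snd.comp continuous_snd).continuousOn
      · refine continuousOn_finsetSum _ fun b _ => (l4 b).smul ?_
        refine Continuous.continuousOn ?_
        fun_prop
    · exact continuousOn_finsetSum _ fun i _ => continuousOn_finsetSum _ fun a _ =>
        continuousOn_finsetSum _ fun b _ => (l5 i a b).mul (l6 a b)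
  have hΦ0 : ∀ (y : E → (ι → F) × F) p, p ∉ K → Φ p (y p) = 0 := by
    intro y p hp
    have hψ0 : ψ =ᶠ[𝓝 p] 0 := notMem_tsupport_iff_eventuallyEq.1 hp
    simp only [Φ, hψ0.self_of_nhds, hψ0.fderiv_eq]
    simp
  have happ : ∀ m : ℕ, ∃ v : E → F, ContDiff ℝ ∞ v ∧ ∀ p ∈ K, ‖v p - u p‖ ≤ 1 / ((m : ℝ) + 1) ∧
      (∀ j, ‖fderiv ℝ v p (e j) - fderiv ℝ u p (e j)‖ ≤ 1 / ((m : ℝ) + 1)) ∧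
      ‖(∑ i, ∑ j, g i j p • fderiv ℝ (fun q => fderiv ℝ v q (e j)) p (e i)) - f p‖ ≤
        1 / ((m : ℝ) + 1) := fun m =>
    exists_smooth_approx e hg hu hf hO hK hψO hweak (by positivity)
  choose v hv hvK using happ
  let y : E → (ι → F) × F := fun p => (fun a => fderiv ℝ u p (e a), f p)
  let ym : ℕ → E → (ι → F) × F := fun m p => (fun a => fderiv ℝ (v m) p (e a),
    ∑ i, ∑ j, g i j p • fderiv ℝ (fun q => fderiv ℝ (v m) q (e j)) p (e i))
  have hy : ContinuousOn y K :=
    (continuousOn_pi.2 fun a => (hz hu a).mono hψO).prodMk (hf.mono hψO)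
  have hym : ∀ m, ContinuousOn (ym m) K := by
    intro m
    have h1 : ContDiff ℝ 1 (v m) := (hv m).of_le (by exact_mod_cast le_top)
    have h2 : ∀ a, ContDiff ℝ 1 fun q => fderiv ℝ (v m) q (e a) := fun a =>
      ((contDiff_infty.1 (hv m) 2).fderiv_right (m := 1) one_add_one_eq_two.le).clm_apply contDiff_const
    refine (continuousOn_pi.2 fun a => (hz h1.contDiffOn a).mono hψO).prodMk ?_
    refine continuousOn_finsetSum _ fun i _ => continuousOn_finsetSum _ fun j _ => ?_
    exact ((hg i j).continuousOn.mono hψO).smul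
      (((h2 j).continuous_fderiv one_ne_zero).clm_apply continuous_const).continuousOn
  have hlim := tendsto_setIntegral_comp_of_uniform (μ := μ) hK hΦ hy hym (fun m p hp => by
    obtain ⟨-, h2, h3⟩ := hvK m p hp
    refine max_le ?_ h3
    exact (pi_norm_le_iff_of_nonneg (by positivity)).2 h2)
  have hzero : ∀ m, ∫ p in K, Φ p (ym m p) ∂μ = 0 := by
    intro m
    rw [setIntegral_eq_integral_of_forall_compl_eq_zero (hΦ0 (ym m))]
    exact energy_identity_of_contDiff e hO hsymm hg hY (hv m) hψ hψc hψO
  simp only [hzero] at hlim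
  have := tendsto_nhds_unique hlim tendsto_const_nhds
  rwa [setIntegral_eq_integral_of_forall_compl_eq_zero (hΦ0 y)] at this

end EnergyIdentity

/-! ### Lorentzian forms and the dominant energy condition -/

section LorentzForms

variable {V : Type*} [AddCommGroup V] [Module ℝ V]

/-- A symmetric form which is positive definite on the orthogonal complement of each of its
timelike vectors. -/
def LinearMap.BilinForm.IsLorentz (b : LinearMap.BilinForm ℝ V) : Prop :=
  (∀ x y, b x y = b y x) ∧ ∀ ξ y, b ξ ξ < 0 → b ξ y = 0 → y ≠ 0 → 0 < b y y

namespace LinearMap.BilinForm.IsLorentz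

variable {b : LinearMap.BilinForm ℝ V}

theorem nonneg_of_orthogonal (hb : b.IsLorentz) {ξ y : V} (hξ : b ξ ξ < 0) (h : b ξ y = 0) :
    0 ≤ b y y := by
  rcases eq_or_ne y 0 with rfl | hy
  · simp
  · exact (hb.2 ξ y hξ h hy).le

theorem ne_zero_of_timelike (hb : b.IsLorentz) {ξ ζ : V} (hξ : b ξ ξ < 0) (hζ : b ζ ζ < 0) :
    b ξ ζ ≠ 0 := fun h =>
  absurd (hb.nonneg_of_orthogonal hξ h) (not_le.2 hζ)

/-- Cauchy–Schwarz on the orthogonal complement of `ξ`, from the nonnegativity of `b` at `b y y • x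
- b x y • y`. -/
theorem sq_le_mul_of_orthogonal (hb : b.IsLorentz) {ξ x y : V} (hξ : b ξ ξ < 0) (hx : b ξ x = 0)
    (hy : b ξ y = 0) : b x y ^ 2 ≤ b x x * b y y := by
  rcases eq_or_ne y 0 with rfl | hy0
  · simp
  have hyy := hb.2 ξ y hξ hy hy0
  have h := hb.nonneg_of_orthogonal (y := b y y • x - b x y • y) hξ (by simp [hx, hy])
  simp only [map_sub, map_smul, LinearMap.sub_apply, LinearMap.smul_apply, smul_eq_mul,
    hb.1 y x] at h
  have h2 : 0 ≤ b y y * (b x x * b y y - b x y ^ 2) := by linarith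
  linarith [nonneg_of_mul_nonneg_right h2 hyy]

/-- With `p = s ξ + p'` and `p'` orthogonal to `ξ`, the expression equals `(s b(ξ,ξ))² - b(ξ,ξ)
b(p',p')`. Both terms are nonnegative, and they vanish together only for `p = 0`. -/
theorem energy_pos (hb : b.IsLorentz) {ξ p : V} (hξ : b ξ ξ < 0) (hp : p ≠ 0) :
    0 < 2 * b ξ p * b ξ p - b ξ ξ * b p p := by
  set s := b ξ p / b ξ ξ with hs
  have hsξ : s * b ξ ξ = b ξ p := div_mul_cancel₀ _ hξ.ne
  have hperp : b ξ (p - s • ξ) = 0 := by simp [hsξ]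
  have hq := hb.nonneg_of_orthogonal hξ hperp
  have hexp : b p p = b (p - s • ξ) (p - s • ξ) + s ^ 2 * b ξ ξ := by
    simp only [map_sub, map_smul, LinearMap.sub_apply, LinearMap.smul_apply, smul_eq_mul,
      hb.1 p ξ, ← hsξ]
    ring
  rw [hexp, ← hsξ]
  have h1 : 2 * (s * b ξ ξ) * (s * b ξ ξ) - b ξ ξ * (b (p - s • ξ) (p - s • ξ) + s ^ 2 * b ξ ξ) =
      (s * b ξ ξ) ^ 2 + (- b ξ ξ) * b (p - s • ξ) (p - s • ξ) := by ring
  rw [h1]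
  rcases eq_or_ne (p - s • ξ) 0 with h0 | h0
  · have : s ≠ 0 := by
      rintro h
      rw [h, zero_smul, sub_zero] at h0
      exact hp h0
    have : 0 < (s * b ξ ξ) ^ 2 := by
      have := mul_ne_zero this hξ.ne
      positivity
    rw [h0]
    simpa using this
  · have := mul_pos (neg_pos.2 hξ) (hb.2 ξ _ hξ hperp h0)
    positivity

/-- The dominant energy condition. -/
theorem flux_nonneg (hb : b.IsLorentz) {ξ ζ : V} (hξ : b ξ ξ < 0) (hζ : b ζ ζ < 0)
    (hζξ : b ζ ξ < 0) (p : V) : 0 ≤ 2 * b ζ p * b ξ p - b ζ ξ * b p p := by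
  set s := b ξ p / b ξ ξ with hs
  set t := b ξ ζ / b ξ ξ with ht
  have hsξ : s * b ξ ξ = b ξ p := div_mul_cancel₀ _ hξ.ne
  have htξ : t * b ξ ξ = b ξ ζ := div_mul_cancel₀ _ hξ.ne
  have htpos : 0 < t := div_pos_of_neg_of_neg (by rwa [hb.1]) hξ
  have hp1 : b ξ (p - s • ξ) = 0 := by simp [hsξ]
  have hp2 : b ξ (ζ - t • ξ) = 0 := by simp [htξ]
  have hcs := hb.sq_le_mul_of_orthogonal hξ hp2 hp1
  have hq := hb.nonneg_of_orthogonal hξ hp1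
  have e1 : b p p = b (p - s • ξ) (p - s • ξ) + s ^ 2 * b ξ ξ := by
    simp only [map_sub, map_smul, LinearMap.sub_apply, LinearMap.smul_apply, smul_eq_mul,
      hb.1 p ξ, ← hsξ]
    ring
  have e2 : b ζ ζ = b (ζ - t • ξ) (ζ - t • ξ) + t ^ 2 * b ξ ξ := by
    simp only [map_sub, map_smul, LinearMap.sub_apply, LinearMap.smul_apply, smul_eq_mul,
      hb.1 ζ ξ, ← htξ]
    ring
  have e3 : b ζ p = b (ζ - t • ξ) (p - s • ξ) + t * s * b ξ ξ := by
    simp only [map_sub, map_smul, LinearMap.sub_apply, LinearMap.smul_apply, smul_eq_mul,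
      hb.1 ζ ξ, ← htξ, ← hsξ]
    ring
  rw [hb.1 ζ ξ, ← htξ, ← hsξ, e1, e3]
  set X := b (ζ - t • ξ) (p - s • ξ)
  set P := b (p - s • ξ) (p - s • ξ)
  set Z := b (ζ - t • ξ) (ζ - t • ξ)
  obtain ⟨m, hm⟩ : ∃ m, m = - b ξ ξ := ⟨_, rfl⟩
  have hbm : b ξ ξ = -m := by linarith
  have hm0 : 0 < m := by linarith
  rw [hbm] at e2 ⊢
  -- Cauchy–Schwarz gives `X² ≤ Z P`, and `Z < t² m` because `ζ` is timelike. After multiplication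
  -- by `t > 0` the flux becomes a square plus the nonnegative number `t² m P - X²`.
  have hX : X ^ 2 ≤ t ^ 2 * m * P := hcs.trans (by
    gcongr
    linarith)
  have h1 : 0 ≤ t * (2 * (X + t * s * -m) * (s * -m) - t * -m * (P + s ^ 2 * -m)) := by
    have : t * (2 * (X + t * s * -m) * (s * -m) - t * -m * (P + s ^ 2 * -m)) =
      (t * s * m - X) ^ 2 + (t ^ 2 * m * P - X ^ 2) := by ring
    rw [this]
    have := sq_nonneg (t * s * m - X)
    linarith
  exact nonneg_of_mul_nonneg_right h1 htpos

end LinearMap.BilinForm.IsLorentz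

end LorentzForms

/-! ### The energy current and its source in the 0-frame -/

namespace ZeroGeometry

open scoped RealInnerProductSpace

variable {n k : ℕ}

/-- If `Pᵀ G P = D` with `D² = 1`, then `G⁻¹ = P D Pᵀ`. -/
theorem IsLorentzian.exists_inv_eq {G : Matrix (Fin (n + 1)) (Fin (n + 1)) ℝ}
    (hG : IsLorentzian G) : ∃ P : Matrix (Fin (n + 1)) (Fin (n + 1)) ℝ, IsUnit P.det ∧
      IsUnit G.det ∧ G⁻¹ = P.transpose * Matrix.diagonal (Fin.cons (-1) fun _ => 1) * P := by
  obtain ⟨P, hP, h⟩ := hG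
  set D : Matrix (Fin (n + 1)) (Fin (n + 1)) ℝ := Matrix.diagonal (Fin.cons (-1) fun _ => 1)
  have hDD : D * D = 1 := by
    simp only [D, Matrix.diagonal_mul_diagonal]
    rw [← Matrix.diagonal_one]
    congr 1
    funext i
    refine Fin.cases ?_ (fun j => ?_) i <;> simp
  have hPt : IsUnit P.transpose.det := by rwa [Matrix.det_transpose]
  have hright : G * (P * D * P.transpose) = 1 := by
    have h1 : P.transpose * (G * (P * D * P.transpose)) = P.transpose := by
      calc _ = (P.transpose * G * P) * D * P.transpose := by simp only [Matrix.mul_assoc]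
        _ = P.transpose := by rw [h, hDD, Matrix.one_mul]
    calc G * (P * D * P.transpose)
        = P.transpose⁻¹ * (P.transpose * (G * (P * D * P.transpose))) := by
          rw [← Matrix.mul_assoc P.transpose⁻¹, Matrix.nonsing_inv_mul _ hPt, Matrix.one_mul]
      _ = 1 := by rw [h1, Matrix.nonsing_inv_mul _ hPt]
  refine ⟨P.transpose, hPt, ?_, ?_⟩
  · have := congrArg Matrix.det hright
    rw [Matrix.det_mul, Matrix.det_one] at this
    exact IsUnit.of_mul_eq_one _ this
  · rw [Matrix.transpose_transpose]
    exact Matrix.inv_eq_right_inv hright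

theorem sq_dotProduct_le {m : ℕ} (x y : Fin m → ℝ) :
    (∑ j, x j * y j) ^ 2 ≤ (∑ j, x j ^ 2) * ∑ j, y j ^ 2 :=
  Finset.sum_mul_sq_le_sq_mul_sq _ _ _

/-- In an adapted frame the form is `-X₀Y₀ + ∑ XⱼYⱼ`. For `X` timelike and orthogonal to `Y`,
Cauchy–Schwarz gives `X₀²Y₀² ≤ (∑ Xⱼ²)(∑ Yⱼ²)` with `∑ Xⱼ² < X₀²`, whence `Y₀² < ∑ Yⱼ²` unless `Y =
0`. -/
theorem IsLorentzian.isLorentz_inv {G : Matrix (Fin (n + 1)) (Fin (n + 1)) ℝ}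
    (hG : IsLorentzian G) : (Matrix.toBilin' G⁻¹).IsLorentz := by
  obtain ⟨P, hP, -, hinv⟩ := hG.exists_inv_eq
  have hform : ∀ x y, Matrix.toBilin' G⁻¹ x y =
      - (P.mulVec x 0 * P.mulVec y 0) + ∑ j : Fin n, P.mulVec x j.succ * P.mulVec y j.succ := by
    intro x y
    rw [Matrix.toBilin'_apply', hinv, ← Matrix.mulVec_mulVec, ← Matrix.mulVec_mulVec,
      Matrix.dotProduct_mulVec, Matrix.vecMul_transpose, dotProduct, Fin.sum_univ_succ]
    simp [Matrix.mulVec_diagonal]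
  refine ⟨fun x y => ?_, fun ξ y hξ hξy hy => ?_⟩
  · rw [hform, hform]
    simp only [mul_comm]
  · rw [hform] at hξ hξy ⊢
    have hPy : P.mulVec y ≠ 0 := fun h => hy (by
      have h2 := congrArg (P⁻¹.mulVec) h
      rwa [Matrix.mulVec_mulVec, Matrix.nonsing_inv_mul _ hP, Matrix.one_mulVec,
        Matrix.mulVec_zero] at h2)
    set X := P.mulVec ξ
    set Y := P.mulVec y
    have hcs := sq_dotProduct_le (fun j : Fin n => X j.succ) (fun j => Y j.succ)
    simp only [← pow_two] at hξ ⊢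
    set A := ∑ j : Fin n, X j.succ ^ 2
    set B := ∑ j : Fin n, Y j.succ ^ 2 with hB
    have hB0 : 0 ≤ B := Finset.sum_nonneg fun j _ => sq_nonneg _
    have h1 : (X 0 * Y 0) ^ 2 ≤ A * B := by
      have : X 0 * Y 0 = ∑ j : Fin n, X j.succ * Y j.succ := by linarith
      rw [this]; exact hcs
    have hA0 : 0 ≤ A := Finset.sum_nonneg fun j _ => sq_nonneg _
    have hX0 : 0 < X 0 ^ 2 := by linarith
    have hBpos : 0 < B := by
      rcases hB0.lt_or_eq with h | h
      · exact h
      · exfalso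
        rw [← h, mul_zero, mul_pow] at h1
        have hY0 : Y 0 = 0 := by
          have : Y 0 ^ 2 ≤ 0 := by
            by_contra hc
            have := mul_pos hX0 (not_le.1 hc)
            linarith
          exact pow_eq_zero_iff two_ne_zero |>.1 (le_antisymm this (sq_nonneg _))
        refine hPy (funext fun i => ?_)
        refine Fin.cases hY0 (fun j => ?_) i
        have := (Finset.sum_eq_zero_iff_of_nonneg (fun j _ => sq_nonneg (Y (Fin.succ j)))).1
          (hB.symm.trans h.symm) j (Finset.mem_univ j)
        exact pow_eq_zero_iff two_ne_zero |>.1 this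
    have h2 : X 0 ^ 2 * Y 0 ^ 2 < X 0 ^ 2 * B := by
      rw [mul_pow] at h1
      refine lt_of_le_of_lt h1 ?_
      gcongr
      linarith
    have := lt_of_mul_lt_mul_left h2 hX0.le
    linarith

/-- The coefficients of the energy current associated with the multiplier `-grad τ`. -/
def fluxCoeff (G : Fin (n + 1) → Fin (n + 1) → ℝ) (μ α β : Fin (n + 1)) : ℝ :=
  2 * G μ α * G 0 β - G 0 μ * G α β

/-- The energy current. -/
noncomputable def flux (G : Fin (n + 1) → Fin (n + 1) → ℝ)
    (w : Fin (n + 1) → Fibre k) (μ : Fin (n + 1)) : ℝ :=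
  ∑ α, ∑ β, fluxCoeff G μ α β * ⟪w α, w β⟫

/-- The energy density on the level sets of `τ`. -/
noncomputable def energyDensity (G : Fin (n + 1) → Fin (n + 1) → ℝ)
    (y : (Fin (n + 1) → Fibre k) × Fibre k) : ℝ :=
  flux G y.1 0 + ‖y.2‖ ^ 2

/-- The current decouples over the components of the fibre, each contributing the scalar
energy-momentum tensor in the directions `ζ` and `dτ`. Positivity of the flux thereby reduces to the
statements on scalar covectors. -/
theorem sum_mul_flux {G : Matrix (Fin (n + 1)) (Fin (n + 1)) ℝ}
    (hG : ∀ x y, Matrix.toBilin' G x y = Matrix.toBilin' G y x) (ζ : Fin (n + 1) → ℝ)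
    (w : Fin (n + 1) → Fibre k) :
    ∑ μ, ζ μ * flux (fun i j => G i j) w μ =
      ∑ i : Fin k, (2 * Matrix.toBilin' G ζ (fun α => w α i) *
          Matrix.toBilin' G (levelConormal n) (fun α => w α i) -
        Matrix.toBilin' G ζ (levelConormal n) *
          Matrix.toBilin' G (fun α => w α i) (fun α => w α i)) := by
  have hlevel : ∀ y : Fin (n + 1) → ℝ, Matrix.toBilin' G (levelConormal n) y = ∑ β, G 0 β * y β := by
    intro y
    rw [Matrix.toBilin'_apply, Fin.sum_univ_succ]
    simp [levelConormal]
  have hζ : Matrix.toBilin' G ζ (levelConormal n) = ∑ μ, ζ μ * G 0 μ := by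
    rw [hG, hlevel]
    exact Finset.sum_congr rfl fun _ _ => mul_comm _ _
  have hinner : ∀ α β, ⟪w α, w β⟫ = ∑ i : Fin k, w α i * w β i := fun α β => by
    rw [PiLp.inner_apply]
    exact Finset.sum_congr rfl fun i _ => by simp [mul_comm]
  have hcomp : ∀ p : Fin (n + 1) → ℝ, 2 * Matrix.toBilin' G ζ p *
        Matrix.toBilin' G (levelConormal n) p -
        Matrix.toBilin' G ζ (levelConormal n) * Matrix.toBilin' G p p =
      ∑ μ, ∑ α, ∑ β, ζ μ * (fluxCoeff (fun i j => G i j) μ α β * (p α * p β)) := by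
    intro p
    rw [hζ, hlevel, Matrix.toBilin'_apply, Matrix.toBilin'_apply]
    have t1 : (∑ μ, ∑ α, ζ μ * G μ α * p α) * (∑ β, G 0 β * p β) =
        ∑ μ, ∑ α, ∑ β, ζ μ * G μ α * p α * (G 0 β * p β) := by
      simp only [Finset.sum_mul]
      simp only [Finset.mul_sum]
    have t2 : (∑ μ, ζ μ * G 0 μ) * (∑ α, ∑ β, p α * G α β * p β) =
        ∑ μ, ∑ α, ∑ β, ζ μ * G 0 μ * (p α * G α β * p β) := by
      simp only [Finset.sum_mul]
      simp only [Finset.mul_sum]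
    rw [mul_assoc, t1, t2]
    simp only [Finset.mul_sum, ← Finset.sum_sub_distrib]
    refine Finset.sum_congr rfl fun μ _ => Finset.sum_congr rfl fun α _ =>
      Finset.sum_congr rfl fun β _ => ?_
    simp only [fluxCoeff]
    ring
  simp only [hcomp]
  rw [Finset.sum_comm]
  refine Finset.sum_congr rfl fun μ _ => ?_
  rw [Finset.sum_comm, flux, Finset.mul_sum]
  refine Finset.sum_congr rfl fun α _ => ?_
  rw [Finset.sum_comm, Finset.mul_sum]
  refine Finset.sum_congr rfl fun β _ => ?_
  rw [hinner, Finset.mul_sum, Finset.mul_sum]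

theorem sum_mul_flux_nonneg {G : Matrix (Fin (n + 1)) (Fin (n + 1)) ℝ}
    (hG : (Matrix.toBilin' G).IsLorentz) {ζ : Fin (n + 1) → ℝ}
    (hlevel : Matrix.toBilin' G (levelConormal n) (levelConormal n) < 0)
    (hζ : Matrix.toBilin' G ζ ζ < 0) (hζl : Matrix.toBilin' G ζ (levelConormal n) < 0)
    (w : Fin (n + 1) → Fibre k) : 0 ≤ ∑ μ, ζ μ * flux (fun i j => G i j) w μ := by
  rw [sum_mul_flux hG.1]
  exact Finset.sum_nonneg fun i _ => hG.flux_nonneg hlevel hζ hζl _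

theorem flux_zero_eq_sum {G : Fin (n + 1) → Fin (n + 1) → ℝ} (w : Fin (n + 1) → Fibre k) :
    flux G w 0 = ∑ μ, levelConormal n μ * flux G w μ := by
  rw [Fin.sum_univ_succ]
  simp [levelConormal]

theorem energyDensity_pos {G : Matrix (Fin (n + 1)) (Fin (n + 1)) ℝ}
    (hG : (Matrix.toBilin' G).IsLorentz)
    (hlevel : Matrix.toBilin' G (levelConormal n) (levelConormal n) < 0)
    {y : (Fin (n + 1) → Fibre k) × Fibre k} (hy : y ≠ 0) :
    0 < energyDensity (fun i j => G i j) y := by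
  rw [energyDensity, flux_zero_eq_sum, sum_mul_flux hG.1]
  have hterm : ∀ i : Fin k, 0 ≤ 2 * Matrix.toBilin' G (levelConormal n) (fun α => y.1 α i) *
      Matrix.toBilin' G (levelConormal n) (fun α => y.1 α i) -
      Matrix.toBilin' G (levelConormal n) (levelConormal n) *
        Matrix.toBilin' G (fun α => y.1 α i) (fun α => y.1 α i) := fun i =>
    hG.flux_nonneg hlevel hlevel hlevel _
  have hsum := Finset.sum_nonneg fun i (_ : i ∈ Finset.univ) => hterm i
  by_cases hw : y.1 = 0
  · have : y.2 ≠ 0 := fun h => hy (Prod.ext hw h)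
    have := norm_pos_iff.2 this
    positivity
  · obtain ⟨α, hα⟩ := Function.ne_iff.1 hw
    obtain ⟨i, hi⟩ : ∃ i, y.1 α i ≠ 0 := by
      by_contra! h
      exact hα (PiLp.ext h)
    have hpos := Finset.sum_pos' (fun i (_ : i ∈ Finset.univ) => hterm i) ⟨i, Finset.mem_univ i,
      hG.energy_pos hlevel (p := fun α => y.1 α i) fun h => hi (congrFun h α)⟩
    positivity

/-- The quadratic form by which the energy density of a solution of `L u = 0` changes along
`τ ∂_τ`. Here `dG ρ` stands for the derivative of `G` along the `ρ`-th element of the 0-frame. -/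
noncomputable def energySource (G : Fin (n + 1) → Fin (n + 1) → ℝ)
    (dG : Fin (n + 1) → Fin (n + 1) → Fin (n + 1) → ℝ) (B : Fin (n + 1) → EndFibre k)
    (Z : EndFibre k) (y : (Fin (n + 1) → Fibre k) × Fibre k) : ℝ :=
  2 * ⟪∑ μ, B μ (y.1 μ) + Z y.2 - ∑ ν, G 0 ν • y.1 ν, ∑ β, G 0 β • y.1 β⟫ + 2 * ⟪y.1 0, y.2⟫ +
    ∑ μ, ∑ α, ∑ β, (2 * dG μ μ α * G 0 β + 2 * G μ α * dG μ 0 β - dG μ 0 μ * G α β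
      - G 0 μ * dG μ α β) * ⟪y.1 α, y.1 β⟫ + 2 * flux G y.1 0

theorem energyDensity_smul (G : Fin (n + 1) → Fin (n + 1) → ℝ) (c : ℝ)
    (y : (Fin (n + 1) → Fibre k) × Fibre k) :
    energyDensity G (c • y) = c ^ 2 * energyDensity G y := by
  simp only [energyDensity, flux, Prod.smul_fst, Prod.smul_snd, Pi.smul_apply, inner_smul_left,
    inner_smul_right, norm_smul, mul_pow, Real.norm_eq_abs, sq_abs, mul_add, Finset.mul_sum]
  congr 1
  refine Finset.sum_congr rfl fun α _ => Finset.sum_congr rfl fun β _ => ?_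
  simp only [conj_trivial]
  ring

theorem energySource_smul (G : Fin (n + 1) → Fin (n + 1) → ℝ)
    (dG : Fin (n + 1) → Fin (n + 1) → Fin (n + 1) → ℝ) (B : Fin (n + 1) → EndFibre k)
    (Z : EndFibre k) (c : ℝ) (y : (Fin (n + 1) → Fibre k) × Fibre k) :
    energySource G dG B Z (c • y) = c ^ 2 * energySource G dG B Z y := by
  have h1 : ∑ μ, B μ ((c • y).1 μ) + Z (c • y).2 - ∑ ν, G 0 ν • (c • y).1 ν =
      c • (∑ μ, B μ (y.1 μ) + Z y.2 - ∑ ν, G 0 ν • y.1 ν) := by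
    simp only [Prod.smul_fst, Prod.smul_snd, Pi.smul_apply, map_smul, smul_sub, smul_add,
      Finset.smul_sum, smul_comm c]
  have h2 : ∑ β, G 0 β • (c • y).1 β = c • ∑ β, G 0 β • y.1 β := by
    simp only [Prod.smul_fst, Pi.smul_apply, Finset.smul_sum, smul_comm c]
  have h3 : ∀ α β, ⟪(c • y).1 α, (c • y).1 β⟫ = c ^ 2 * ⟪y.1 α, y.1 β⟫ := fun α β => by
    simp only [Prod.smul_fst, Pi.smul_apply, real_inner_smul_left, real_inner_smul_right]
    ring
  have h4 : ⟪(c • y).1 0, (c • y).2⟫ = c ^ 2 * ⟪y.1 0, y.2⟫ := by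
    simp only [Prod.smul_fst, Prod.smul_snd, Pi.smul_apply, real_inner_smul_left,
      real_inner_smul_right]
    ring
  have h5 : ∀ a b : Fibre k, ⟪c • a, c • b⟫ = c ^ 2 * ⟪a, b⟫ := fun a b => by
    rw [real_inner_smul_left, real_inner_smul_right]
    ring
  rw [energySource, h1, h2, h5]
  simp only [energySource, h3, h4, flux, mul_add, Finset.mul_sum, mul_left_comm _ (c ^ 2)]

end ZeroGeometry

/-! ### Compactness arguments for families of quadratic functions -/

section Compactness

open Set

/-- The minimum of `max r d` over `K` is positive and serves as `δ`. -/
theorem IsCompact.exists_pos_forall_lt {X : Type*} [TopologicalSpace X] {K : Set X}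
    (hK : IsCompact K) {r d : X → ℝ} (hr : ContinuousOn r K) (hd : ContinuousOn d K)
    (h : ∀ x ∈ K, r x ≤ 0 → 0 < d x) : ∃ δ > 0, ∀ x ∈ K, r x < δ → 0 < d x := by
  have hm : ContinuousOn (fun x => max (r x) (d x)) K := hr.sup hd
  rcases K.eq_empty_or_nonempty with rfl | hne
  · exact ⟨1, one_pos, fun x hx => hx.elim⟩
  obtain ⟨x₀, hx₀, hmin⟩ := hK.exists_isMinOn hne hm
  have hpos : 0 < max (r x₀) (d x₀) := by
    rcases le_or_gt (r x₀) 0 with h0 | h0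
    · exact lt_max_of_lt_right (h x₀ hx₀ h0)
    · exact lt_max_of_lt_left h0
  refine ⟨_, hpos, fun x hx hlt => ?_⟩
  rcases le_max_iff.1 (isMinOn_iff.1 hmin x hx) with h1 | h1
  · exact absurd hlt (not_lt.2 h1)
  · exact lt_of_lt_of_le hpos h1

variable {X : Type*} [TopologicalSpace X] {Y : Type*} [NormedAddCommGroup Y] [NormedSpace ℝ Y]

theorem nonneg_of_homogeneous {d : Y → ℝ}
    (hhom : ∀ (c : ℝ) y, d (c • y) = c ^ 2 * d y) (h : ∀ y, ‖y‖ = 1 → 0 ≤ d y) (y : Y) :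
    0 ≤ d y := by
  rcases eq_or_ne y 0 with rfl | hy
  · have := hhom 0 0
    simp at this
    exact this.ge
  · have hn : ‖y‖ ≠ 0 := norm_ne_zero_iff.2 hy
    have h1 := h (‖y‖⁻¹ • y) (by rw [norm_smul, norm_inv, norm_norm, inv_mul_cancel₀ hn])
    have h2 : d y = ‖y‖ ^ 2 * d (‖y‖⁻¹ • y) := by
      rw [← hhom, smul_smul, mul_inv_cancel₀ hn, one_smul]
    rw [h2]
    positivity

variable [FiniteDimensional ℝ Y] {K : Set X}

/-- A family of quadratic functions which is positive definite for `r = 0` is nonnegative for small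
`r`. -/
theorem IsCompact.exists_pos_forall_quadratic_nonneg (hK : IsCompact K) {r : X → ℝ}
    (hr : ContinuousOn r K) {d : X → Y → ℝ}
    (hd : ContinuousOn (Function.uncurry d) (K ×ˢ univ))
    (hhom : ∀ x ∈ K, ∀ (c : ℝ) y, d x (c • y) = c ^ 2 * d x y)
    (h : ∀ x ∈ K, r x ≤ 0 → ∀ y, y ≠ 0 → 0 < d x y) :
    ∃ δ > 0, ∀ x ∈ K, r x < δ → ∀ y, 0 ≤ d x y := by
  have hS : IsCompact (K ×ˢ Metric.sphere (0 : Y) 1) := hK.prod (isCompact_sphere 0 1)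
  obtain ⟨δ, hδ, hlt⟩ := hS.exists_pos_forall_lt (r := fun z => r z.1) (d := Function.uncurry d)
    (hr.comp continuousOn_fst fun z hz => hz.1) (hd.mono (prod_mono_right (subset_univ _)))
    (fun z hz hrz => h z.1 hz.1 hrz z.2 (by
      rintro h0
      have := hz.2
      simp [h0] at this))
  refine ⟨δ, hδ, fun x hx hrx => nonneg_of_homogeneous (hhom x hx) fun y hy => ?_⟩
  exact (hlt (x, y) ⟨hx, by simpa using hy⟩ hrx).le

/-- The quotient `q / d` is bounded over `K` times the unit sphere, and homogeneity does the rest.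
The constant is taken to be a natural number because it becomes an exponent of `τ`. -/
theorem IsCompact.exists_forall_quadratic_le (hK : IsCompact K) {q d : X → Y → ℝ}
    (hq : ContinuousOn (Function.uncurry q) (K ×ˢ univ))
    (hd : ContinuousOn (Function.uncurry d) (K ×ˢ univ))
    (hqhom : ∀ x ∈ K, ∀ (c : ℝ) y, q x (c • y) = c ^ 2 * q x y)
    (hdhom : ∀ x ∈ K, ∀ (c : ℝ) y, d x (c • y) = c ^ 2 * d x y)
    (hpos : ∀ x ∈ K, ∀ y, y ≠ 0 → 0 < d x y) :
    ∃ M : ℕ, ∀ x ∈ K, ∀ y, q x y ≤ M * d x y := by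
  have hS : IsCompact (K ×ˢ Metric.sphere (0 : Y) 1) := hK.prod (isCompact_sphere 0 1)
  have hpos' : ∀ z ∈ K ×ˢ Metric.sphere (0 : Y) 1, 0 < Function.uncurry d z := by
    intro z hz
    refine hpos z.1 hz.1 z.2 ?_
    rintro h0
    have := hz.2
    simp [h0] at this
  have hmono : K ×ˢ Metric.sphere (0 : Y) 1 ⊆ K ×ˢ univ := prod_mono_right (subset_univ _)
  obtain ⟨B, hB⟩ := hS.exists_bound_of_continuousOn
    ((hq.mono hmono).div (hd.mono hmono) fun z hz => (hpos' z hz).ne')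
  obtain ⟨M, hM⟩ := exists_nat_ge B
  refine ⟨M, fun x hx y => ?_⟩
  have := nonneg_of_homogeneous (d := fun y => M * d x y - q x y)
    (fun c y => by rw [hqhom x hx, hdhom x hx]; ring) (fun y hy => ?_) y
  · linarith
  · have hz : (x, y) ∈ K ×ˢ Metric.sphere (0 : Y) 1 := ⟨hx, by simpa using hy⟩
    have h1 : q x y / d x y ≤ M :=
      (Real.le_norm_self _).trans ((hB (x, y) hz).trans hM)
    have h2 : 0 < d x y := hpos' (x, y) hz
    rw [div_le_iff₀ h2] at h1
    linarith

end Compactness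

/-! ### Joint continuity of the energy density and its source -/

namespace ZeroGeometry

open scoped RealInnerProductSpace

variable {n k : ℕ} {X : Type*} [TopologicalSpace X] {K : Set X}

theorem continuous_energyDensity :
    Continuous fun z : (Fin (n + 1) → Fin (n + 1) → ℝ) × ((Fin (n + 1) → Fibre k) × Fibre k) =>
      energyDensity z.1 z.2 := by
  simp only [energyDensity, flux, fluxCoeff]
  fun_prop

theorem continuous_energySource :
    Continuous fun z : ((Fin (n + 1) → Fin (n + 1) → ℝ) ×
        (Fin (n + 1) → Fin (n + 1) → Fin (n + 1) → ℝ) × (Fin (n + 1) → EndFibre k) × EndFibre k) ×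
        ((Fin (n + 1) → Fibre k) × Fibre k) =>
      energySource z.1.1 z.1.2.1 z.1.2.2.1 z.1.2.2.2 z.2 := by
  have hB : ∀ μ : Fin (n + 1), Continuous fun z : ((Fin (n + 1) → Fin (n + 1) → ℝ) ×
        (Fin (n + 1) → Fin (n + 1) → Fin (n + 1) → ℝ) × (Fin (n + 1) → EndFibre k) × EndFibre k) ×
        ((Fin (n + 1) → Fibre k) × Fibre k) => z.1.2.2.1 μ (z.2.1 μ) := fun μ =>
    Continuous.clm_apply (by fun_prop) (by fun_prop)
  have hZ : Continuous fun z : ((Fin (n + 1) → Fin (n + 1) → ℝ) ×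
        (Fin (n + 1) → Fin (n + 1) → Fin (n + 1) → ℝ) × (Fin (n + 1) → EndFibre k) × EndFibre k) ×
        ((Fin (n + 1) → Fibre k) × Fibre k) => z.1.2.2.2 z.2.2 :=
    Continuous.clm_apply (by fun_prop) (by fun_prop)
  simp only [energySource, flux, fluxCoeff]
  refine Continuous.add (Continuous.add (Continuous.add ?_ ?_) ?_) ?_
  · refine continuous_const.mul (Continuous.inner (𝕜 := ℝ) (Continuous.sub (Continuous.add
      (continuous_finsetSum _ fun μ _ => hB μ) hZ) ?_) ?_) <;> fun_prop
  all_goals fun_prop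

theorem continuousOn_energyDensity {G : X → Fin (n + 1) → Fin (n + 1) → ℝ}
    (hG : ∀ i j, ContinuousOn (fun x => G x i j) K) :
    ContinuousOn (Function.uncurry fun x (y : (Fin (n + 1) → Fibre k) × Fibre k) =>
      energyDensity (G x) y) (K ×ˢ Set.univ) := by
  have hG' : ContinuousOn G K := continuousOn_pi.2 fun i => continuousOn_pi.2 fun j => hG i j
  have hz : ContinuousOn (fun z : X × ((Fin (n + 1) → Fibre k) × Fibre k) => (G z.1, z.2))
      (K ×ˢ Set.univ) :=
    (hG'.comp continuousOn_fst fun z hz => hz.1).prodMk continuousOn_snd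
  refine ((continuous_energyDensity (n := n) (k := k)).comp_continuousOn hz).congr ?_
  rintro ⟨x, y⟩ -
  simp only [Function.uncurry_apply_pair, Function.comp_apply]

theorem continuousOn_energySource {G : X → Fin (n + 1) → Fin (n + 1) → ℝ}
    {dG : X → Fin (n + 1) → Fin (n + 1) → Fin (n + 1) → ℝ} {B : X → Fin (n + 1) → EndFibre k}
    {Z : X → EndFibre k}
    (hG : ∀ i j, ContinuousOn (fun x => G x i j) K)
    (hdG : ∀ l i j, ContinuousOn (fun x => dG x l i j) K)
    (hB : ∀ i, ContinuousOn (fun x => B x i) K) (hZ : ContinuousOn Z K) :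
    ContinuousOn (Function.uncurry fun x (y : (Fin (n + 1) → Fibre k) × Fibre k) =>
      energySource (G x) (dG x) (B x) (Z x) y) (K ×ˢ Set.univ) := by
  have hG' : ContinuousOn G K := continuousOn_pi.2 fun i => continuousOn_pi.2 fun j => hG i j
  have hdG' : ContinuousOn dG K := continuousOn_pi.2 fun l => continuousOn_pi.2 fun i =>
    continuousOn_pi.2 fun j => hdG l i j
  have hB' : ContinuousOn B K := continuousOn_pi.2 hB
  have hz : ContinuousOn (fun z : X × ((Fin (n + 1) → Fibre k) × Fibre k) =>
      ((G z.1, dG z.1, B z.1, Z z.1), z.2)) (K ×ˢ Set.univ) :=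
    ((hG'.prodMk (hdG'.prodMk (hB'.prodMk hZ))).comp continuousOn_fst
      fun z hz => hz.1).prodMk continuousOn_snd
  refine ((continuous_energySource (n := n) (k := k)).comp_continuousOn hz).congr ?_
  rintro ⟨x, y⟩ -
  simp only [Function.uncurry_apply_pair, Function.comp_apply]

end ZeroGeometry

/-! ### Regularity of the coefficients up to `τ = 0`, and the principal symbol -/

namespace ZeroGeometry

open Filter Topology Set

variable {n k : ℕ} {V : Type*} [NormedAddCommGroup V] [NormedSpace ℝ V]

theorem coordFrame_zero : coordFrame n 0 = ((1 : ℝ), 0) := rfl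

theorem coordFrame_succ (j : Fin n) :
    coordFrame n j.succ = ((0 : ℝ), EuclideanSpace.single j (1 : ℝ)) := rfl

theorem sum_coordFrame (y : Spacetime n) :
    y = y.1 • coordFrame n 0 + ∑ j : Fin n, y.2 j • coordFrame n j.succ := by
  refine Prod.ext ?_ ?_
  · simp [coordFrame_zero, coordFrame_succ, Prod.fst_sum]
  · ext i
    simp [coordFrame_zero, coordFrame_succ, Prod.snd_sum, Finset.sum_apply, Pi.single_apply]

theorem contDiffOn_one_of_continuousOn_coordFrame {f : Spacetime n → V} {O : Set (Spacetime n)}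
    (hO : IsOpen O) (hf : DifferentiableOn ℝ f O)
    (h : ∀ μ, ContinuousOn (fun p => fderiv ℝ f p (coordFrame n μ)) O) : ContDiffOn ℝ 1 f O := by
  have h01 : (1 : WithTop ℕ∞) = 0 + 1 := (zero_add 1).symm
  rw [h01, contDiffOn_succ_iff_fderiv_of_isOpen hO]
  refine ⟨hf, by simp, contDiffOn_zero.2 (continuousOn_clm_apply.2 fun y => ?_)⟩
  rw [sum_coordFrame y]
  simp only [map_add, map_sum, map_smul]
  exact ((h 0).const_smul _).add (continuousOn_finsetSum _ fun j _ => (h j.succ).const_smul _)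

theorem chartM_eq_prod (U : Set (EuclideanSpace ℝ (Fin n))) : chartM U = Ico (0 : ℝ) 1 ×ˢ U := by
  ext p
  simp [chartM, and_assoc]

theorem interior_chartM {U : Set (EuclideanSpace ℝ (Fin n))} (hU : IsOpen U) :
    interior (chartM U) = chartM U ∩ {p | 0 < p.1} := by
  rw [chartM_eq_prod, interior_prod_eq, interior_Ico, hU.interior_eq]
  ext p
  simp only [mem_prod, mem_Ioo, mem_inter_iff, mem_Ico, mem_ofPred_eq]
  constructor
  · rintro ⟨⟨h1, h2⟩, h3⟩
    exact ⟨⟨⟨h1.le, h2⟩, h3⟩, h1⟩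
  · rintro ⟨⟨⟨_, h2⟩, h3⟩, h1⟩
    exact ⟨⟨h1, h2⟩, h3⟩

/-- Functions which are continuous up to `τ = 0`, `C¹` in the interior, and whose derivatives along
the 0-frame are continuous up to `τ = 0`. -/
def ContinuousZeroC1On (S : Set (Spacetime n)) (f : Spacetime n → V) : Prop :=
  ContinuousOn f S ∧ ContDiffOn ℝ 1 f (interior S) ∧ ∀ μ, ContinuousOn (zeroDeriv μ f) S

theorem continuousOn_fderiv_of_zeroDeriv {f w : Spacetime n → V} {O : Set (Spacetime n)}
    (hpos : ∀ p ∈ O, 0 < p.1) {μ : Fin (n + 1)} (hw : ContinuousOn w O)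
    (h : ∀ p ∈ O, w p = zeroDeriv μ f p) :
    ContinuousOn (fun p => fderiv ℝ f p (coordFrame n μ)) O := by
  refine ((continuousOn_fst.inv₀ fun p hp => (hpos p hp).ne').smul hw).congr fun p hp => ?_
  change _ = p.1⁻¹ • w p
  rw [h p hp, zeroDeriv, smul_smul, inv_mul_cancel₀ (hpos p hp).ne', one_smul]

/-- At `τ = 0` the full derivative `fderiv` may be a default value, but the factor `τ` in
`zeroDeriv` annihilates it. Hence `fderivWithin`, which is continuous up to the boundary, can
replace it. -/
theorem ContDiffOn.continuousZeroC1On {U : Set (EuclideanSpace ℝ (Fin n))} (hU : IsOpen U)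
    {f : Spacetime n → V} (hf : ContDiffOn ℝ ∞ f (chartM U)) :
    ContinuousZeroC1On (chartM U) f := by
  have huniq : UniqueDiffOn ℝ (chartM U) := by
    rw [chartM_eq_prod]
    exact (uniqueDiffOn_Ico 0 1).prod hU.uniqueDiffOn
  refine ⟨hf.continuousOn, (hf.of_le (by exact_mod_cast le_top)).mono interior_subset,
    fun μ => ?_⟩
  have h1 : ContinuousOn (fun p => p.1 • fderivWithin ℝ f (chartM U) p (coordFrame n μ))
      (chartM U) :=
    continuousOn_fst.smul ((hf.continuousOn_fderivWithin huniq (by simp)).clm_apply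
      continuousOn_const)
  refine h1.congr fun p hp => ?_
  rcases hp.1.eq_or_lt with h0 | h0
  · simp [zeroDeriv, ← h0]
  · have hint : p ∈ interior (chartM U) := by
      rw [interior_chartM hU]
      exact ⟨hp, h0⟩
    simp only [zeroDeriv, fderivWithin_of_mem_nhds (mem_interior_iff_mem_nhds.1 hint)]

/-- Near `τ = 0` the local bound by `τ^η`, with `η > 0`, squeezes the function to its prescribed
value `0`. -/
theorem continuousOn_of_weighted_bound {V : Type*} [NormedAddCommGroup V]
    {S : Set (Spacetime n)} (hS : ∀ p ∈ S, 0 ≤ p.1) {η : ℝ}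
    (hη : 0 < η) {h : Spacetime n → V} (hpos : ContinuousOn h (S ∩ {p | 0 < p.1}))
    (h0 : ∀ p ∈ S, p.1 = 0 → h p = 0)
    (hb : ∀ p ∈ S, ∃ W ∈ 𝓝 p, ∃ B : ℝ, ∀ q ∈ W ∩ (S ∩ {p | 0 < p.1}), ‖h q‖ ≤ B * q.1 ^ η) :
    ContinuousOn h S := by
  intro p hp
  rcases (hS p hp).eq_or_lt with hp0 | hp0
  · obtain ⟨W, hW, B, hB⟩ := hb p hp
    rw [ContinuousWithinAt, h0 p hp hp0.symm]
    have hlim : Tendsto (fun q : Spacetime n => B * q.1 ^ η) (𝓝[S] p) (𝓝 0) := by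
      have hc : Continuous fun q : Spacetime n => B * q.1 ^ η :=
        continuous_const.mul (continuous_fst.rpow_const fun _ => Or.inr hη.le)
      have := (hc.tendsto p).mono_left (nhdsWithin_le_nhds (s := S))
      rwa [← hp0, Real.zero_rpow hη.ne', mul_zero] at this
    refine squeeze_zero_norm' ?_ hlim
    filter_upwards [self_mem_nhdsWithin, mem_nhdsWithin_of_mem_nhds hW] with q hq hqW
    rcases (hS q hq).eq_or_lt with hq0 | hq0
    · simp [h0 q hq hq0.symm, ← hq0, Real.zero_rpow hη.ne']
    · exact hB q ⟨hqW, hq, hq0⟩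
  · have hopen : {p : Spacetime n | 0 < p.1} ∈ 𝓝 p :=
      (isOpen_lt continuous_const continuous_fst).mem_nhds hp0
    exact (continuousWithinAt_inter hopen).1 (hpos p ⟨hp, hp0⟩)

theorem WeightedZeroC1On.eq_zero {S : Set (Spacetime n)} {η : ℝ} (hη : 0 < η)
    {f : Spacetime n → V} (hf : WeightedZeroC1On S η f) {p : Spacetime n} (hp : p ∈ S)
    (h0 : p.1 = 0) : f p = 0 := by
  obtain ⟨v, -, hv⟩ := hf
  rw [hv p hp, h0, Real.zero_rpow hη.ne', zero_smul]

/-- The product rule reads `V_μ(τ^η v) = τ^η (V_μ v + η δ_{μ0} v)`: derivatives along the 0-frame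
preserve the weight. The function and these derivatives are thus `O(τ^η)` and extend continuously by
`0`. -/
theorem WeightedZeroC1On.continuousZeroC1On {U : Set (EuclideanSpace ℝ (Fin n))} (hU : IsOpen U)
    {η : ℝ} (hη : 0 < η) {f : Spacetime n → V} (hf : WeightedZeroC1On (chartM U) η f) :
    ContinuousZeroC1On (chartM U) f := by
  have hf0 := fun p hp h0 => hf.eq_zero hη (p := p) hp h0
  obtain ⟨v, ⟨⟨hvc, hvb⟩, hvd, hvw⟩, hv⟩ := hf
  choose w hw hwv using hvw
  have hint := interior_chartM hU
  rw [hint] at hvd hwv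
  have hS : ∀ p ∈ chartM U, 0 ≤ p.1 := fun p hp => hp.1
  have hopen : IsOpen (chartM U ∩ {p | 0 < p.1}) := hint ▸ isOpen_interior
  have hpow : ∀ p ∈ chartM U ∩ {p | 0 < p.1}, HasFDerivAt (fun q : Spacetime n => q.1 ^ η)
      ((η * p.1 ^ (η - 1)) • ContinuousLinearMap.fst ℝ ℝ _) p := fun p hp =>
    hasFDerivAt_fst.rpow_const (Or.inl (ne_of_gt hp.2))
  have hfd : ∀ p ∈ chartM U ∩ {p | 0 < p.1}, HasFDerivAt f
      (p.1 ^ η • fderiv ℝ v p +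
        ((η * p.1 ^ (η - 1)) • ContinuousLinearMap.fst ℝ ℝ _).smulRight (v p)) p := by
    intro p hp
    have h1 := (hpow p hp).smul (hvd.differentiableAt (hopen.mem_nhds hp)).hasFDerivAt
    refine h1.congr_of_eventuallyEq ?_
    filter_upwards [hopen.mem_nhds hp] with q hq
    exact hv q hq.1
  have hzd : ∀ μ, ∀ p ∈ chartM U ∩ {p | 0 < p.1}, zeroDeriv μ f p =
      p.1 ^ η • (w μ p + (η * (coordFrame n μ).1) • v p) := by
    intro μ p hp
    have hmul : p.1 * p.1 ^ (η - 1) = p.1 ^ η := by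
      rw [mul_comm, ← Real.rpow_add_one (ne_of_gt hp.2)]
      simp
    rw [hwv μ p hp, zeroDeriv, zeroDeriv, (hfd p hp).fderiv]
    simp only [_root_.add_apply, _root_.smul_apply, ContinuousLinearMap.smulRight_apply,
      ContinuousLinearMap.coe_fst', smul_eq_mul, smul_add, smul_smul]
    congr 2
    · ring
    · rw [← hmul]; ring
  have hpowc : ContinuousOn (fun p : Spacetime n => p.1 ^ η) (chartM U ∩ {p | 0 < p.1}) :=
    (continuous_fst.rpow_const fun _ => Or.inr hη.le).continuousOn
  have hcont : ∀ μ, ContinuousOn (zeroDeriv μ f) (chartM U ∩ {p | 0 < p.1}) := fun μ =>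
    (hpowc.smul ((hw μ).1.add (hvc.const_smul (η * (coordFrame n μ).1)))).congr fun p hp =>
      hzd μ p hp
  refine ⟨?_, ?_, fun μ => ?_⟩
  · refine continuousOn_of_weighted_bound hS hη ((hpowc.smul hvc).congr fun p hp => hv p hp.1)
      hf0 fun p hp => ?_
    obtain ⟨W, hW, B, hB⟩ := hvb p hp
    refine ⟨W, hW, B, fun q hq => ?_⟩
    have hq0 : 0 ≤ q.1 ^ η := Real.rpow_nonneg (hS q hq.2.1) _
    rw [hv q hq.2.1, norm_smul, Real.norm_of_nonneg hq0, mul_comm]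
    gcongr
    exact hB q hq
  · rw [hint]
    exact contDiffOn_one_of_continuousOn_coordFrame hopen
      (fun p hp => (hfd p hp).differentiableAt.differentiableWithinAt)
      fun μ => continuousOn_fderiv_of_zeroDeriv (fun p hp => hp.2) (hcont μ) fun p _ => rfl
  · refine continuousOn_of_weighted_bound hS hη (hcont μ)
      (fun p _ h0 => by simp [zeroDeriv, h0]) fun p hp => ?_
    obtain ⟨W, hW, B, hB⟩ := hvb p hp
    obtain ⟨W', hW', B', hB'⟩ := (hw μ).2 p hp
    refine ⟨W ∩ W', inter_mem hW hW', B' + |η * (coordFrame n μ).1| * B, fun q hq => ?_⟩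
    have hq0 : 0 ≤ q.1 ^ η := Real.rpow_nonneg (hS q hq.2.1) _
    rw [hzd μ q hq.2, norm_smul, Real.norm_of_nonneg hq0, mul_comm]
    gcongr
    refine (norm_add_le _ _).trans ?_
    rw [norm_smul, Real.norm_eq_abs]
    gcongr
    · exact hB' q ⟨hq.1.2, hq.2⟩
    · exact hB q ⟨hq.1.1, hq.2⟩

/-- Stated in the form in which the metric coefficients arise: a linear functional applied to a sum
of a smooth and a weighted matrix coefficient. -/
theorem ContinuousZeroC1On.clm_comp_add {W : Type*} [NormedAddCommGroup W] [NormedSpace ℝ W]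
    {U : Set (EuclideanSpace ℝ (Fin n))} (hU : IsOpen U) {f g : Spacetime n → V}
    (hf : ContinuousZeroC1On (chartM U) f) (hg : ContinuousZeroC1On (chartM U) g)
    (T : V →L[ℝ] W) : ContinuousZeroC1On (chartM U) fun p => T (f p + g p) := by
  refine ⟨T.continuous.comp_continuousOn (hf.1.add hg.1), (hf.2.1.add hg.2.1).continuousLinearMap_comp T,
    fun μ => ?_⟩
  have h1 : ContinuousOn (fun p => T (zeroDeriv μ f p + zeroDeriv μ g p)) (chartM U) :=
    T.continuous.comp_continuousOn ((hf.2.2 μ).add (hg.2.2 μ))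
  refine h1.congr fun p hp => ?_
  rcases hp.1.eq_or_lt with h0 | h0
  · simp [zeroDeriv, ← h0]
  · have hint : interior (chartM U) ∈ 𝓝 p := by
      refine isOpen_interior.mem_nhds ?_
      rw [interior_chartM hU]
      exact ⟨hp, h0⟩
    have hfd := ((hf.2.1.contDiffAt hint).differentiableAt one_ne_zero).hasFDerivAt
    have hgd := ((hg.2.1.contDiffAt hint).differentiableAt one_ne_zero).hasFDerivAt
    have h2 : HasFDerivAt (fun p => T (f p + g p)) (T.comp (fderiv ℝ f p + fderiv ℝ g p)) p :=
      T.hasFDerivAt.comp p (hfd.add hgd)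
    simp only [zeroDeriv]
    rw [h2.fderiv]
    simp

/-- Polarization. -/
theorem eq_zero_of_quadratic_eq_zero {ι : Type*} [Fintype ι] {D : ι → ι → V}
    (hsymm : ∀ i j, D i j = D j i)
    (h : ∀ ζ : ι → ℝ, ∑ i, ∑ j, (ζ i * ζ j) • D i j = 0) (i j : ι) : D i j = 0 := by
  classical
  have hsingle : ∀ (a b : ι), ∑ i, ∑ j, ((Pi.single a 1 : ι → ℝ) i * (Pi.single b 1 : ι → ℝ) j) •
      D i j = D a b := by
    intro a b
    rw [Finset.sum_eq_single a, Finset.sum_eq_single b]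
    · simp
    · intro c _ hc
      simp [Pi.single_eq_of_ne hc]
    · simp
    · intro c _ hc
      simp [Pi.single_eq_of_ne hc]
    · simp
  have hd : ∀ a, D a a = 0 := fun a => by rw [← hsingle a a]; exact h _
  have h2 := h (Pi.single i 1 + Pi.single j 1)
  simp only [Pi.add_apply, add_mul, mul_add, add_smul, Finset.sum_add_distrib, hsingle, hd,
    hsymm j i, zero_add, add_zero] at h2
  rw [← two_smul ℝ] at h2
  exact (smul_eq_zero.1 h2).resolve_left two_ne_zero

theorem toBilin'_symm_apply {G : Matrix (Fin (n + 1)) (Fin (n + 1)) ℝ}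
    (hG : ∀ x y, Matrix.toBilin' G x y = Matrix.toBilin' G y x) (i j : Fin (n + 1)) :
    G i j = G j i := by
  have := hG (Pi.single i 1) (Pi.single j 1)
  simpa [Matrix.toBilin'_apply'] using this

/-- Both coefficient families are symmetric, so by polarization the symbol determines each
coefficient and not only the quadratic form. -/
theorem second_eq_of_principalSymbol {L : ZeroOp n k} {p : Spacetime n}
    {G : Matrix (Fin (n + 1)) (Fin (n + 1)) ℝ} (hG : IsLorentzian G)
    (h : ∀ ζ, L.principalSymbol p ζ = dualMetric G ζ • ContinuousLinearMap.id ℝ (Fibre k))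
    (μ ν : Fin (n + 1)) :
    L.second μ ν p = -(G⁻¹ μ ν • ContinuousLinearMap.id ℝ (Fibre k)) := by
  refine eq_neg_of_add_eq_zero_left (eq_zero_of_quadratic_eq_zero
    (D := fun μ ν => L.second μ ν p + G⁻¹ μ ν • ContinuousLinearMap.id ℝ (Fibre k))
    (fun i j => ?_) (fun ζ => ?_) μ ν)
  · simp only [L.symm i j, toBilin'_symm_apply hG.isLorentz_inv.1 i j]
  · have h1 := h ζ
    rw [ZeroOp.principalSymbol, neg_eq_iff_eq_neg] at h1
    simp only [smul_add, Finset.sum_add_distrib, h1, dualMetric, smul_smul, ← Finset.sum_smul]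
    have : ∑ i, ∑ j, ζ i * ζ j * G⁻¹ i j = ζ ⬝ᵥ G⁻¹.mulVec ζ := by
      simp only [dotProduct, Matrix.mulVec, Finset.mul_sum]
      exact Finset.sum_congr rfl fun i _ => Finset.sum_congr rfl fun j _ => by ring
    rw [this, neg_add_cancel]

end ZeroGeometry

/-! ### The weak wave equation and its energy identity in the 0-frame -/

namespace ZeroGeometry

open Filter Topology Set MeasureTheory
open scoped RealInnerProductSpace

variable {n k : ℕ}

instance : (volume : Measure (Spacetime n)).IsAddHaarMeasure :=
  Measure.prod.instIsAddHaarMeasure volume volume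

/-- The 0-gradient of `u` together with `u`. -/
noncomputable def zeroJet (u : Spacetime n → Fibre k) (p : Spacetime n) :
    (Fin (n + 1) → Fibre k) × Fibre k :=
  (fun μ => zeroDeriv μ u p, u p)

/-- `L u = 0`, for `L` with principal part `-∑ G^{μν} V_μ V_ν`, as an equation for
`∑ τ² G^{μν} ∂_μ ∂_ν u`. -/
theorem ZeroOp.IsDistribSolutionOn.weak_wave_equation {L : ZeroOp n k} {O : Set (Spacetime n)}
    (hO : IsOpen O) {G : Fin (n + 1) → Fin (n + 1) → Spacetime n → ℝ}
    (hG : ∀ i j, ContDiffOn ℝ 1 (G i j) O)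
    (hL : ∀ p ∈ O, ∀ i j, L.second i j p = -(G i j p • ContinuousLinearMap.id ℝ (Fibre k)))
    {u : Spacetime n → Fibre k} (hu : L.IsDistribSolutionOn O u) {φ : Spacetime n → ℝ}
    (hφ : ContDiff ℝ ∞ φ) (hφc : HasCompactSupport φ) (hφO : tsupport φ ⊆ O) :
    ∫ p, ((∑ i, ∑ j, fderiv ℝ (fun q => φ q * (q.1 ^ 2 * G i j q)) p (coordFrame n i) •
        fderiv ℝ u p (coordFrame n j))
      + φ p • (∑ μ, L.first μ p (zeroDeriv μ u p) + L.zeroth p (u p) -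
          ∑ ν, G 0 ν p • zeroDeriv ν u p)) = 0 := by
  rw [← hu φ hφ hφc hφO]
  have hzero : ∀ p ∉ tsupport φ, ∀ {W : Type} [NormedAddCommGroup W] [NormedSpace ℝ W]
      (c : Spacetime n → ℝ) (h : Spacetime n → W),
      φ p = 0 ∧ fderiv ℝ (fun q => (c q * φ q) • h q) p = 0 := by
    intro p hp W _ _ c h
    have h0 : φ =ᶠ[𝓝 p] 0 := notMem_tsupport_iff_eventuallyEq.1 hp
    have : (fun q => (c q * φ q) • h q) =ᶠ[𝓝 p] fun _ => 0 := by
      filter_upwards [h0] with q hq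
      simp [hq]
    exact ⟨h0.self_of_nhds, by rw [this.fderiv_eq]; simp⟩
  rw [← setIntegral_eq_integral_of_forall_compl_eq_zero (s := O)]
  · refine setIntegral_congr_fun hO.measurableSet fun p hp => ?_
    have hpO : O ∈ 𝓝 p := hO.mem_nhds hp
    have hGd : ∀ i j, DifferentiableAt ℝ (G i j) p := fun i j =>
      ((hG i j).contDiffAt hpO).differentiableAt one_ne_zero
    have hφd : DifferentiableAt ℝ φ p := hφ.differentiable (by simp) p
    set m : Fin (n + 1) → Fin (n + 1) → Spacetime n → ℝ := fun i j q => q.1 * φ q * G i j q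
    have hmd : ∀ i j, HasFDerivAt (m i j) (fderiv ℝ (m i j) p) p := fun i j =>
      ((differentiableAt_fst.mul hφd).mul (hGd i j)).hasFDerivAt
    have e1 : ∀ i j, fderiv ℝ (fun q : Spacetime n => (q.1 * φ q) • L.second i j q) p
        (coordFrame n i) =
        -(fderiv ℝ (m i j) p (coordFrame n i) • ContinuousLinearMap.id ℝ (Fibre k)) := by
      intro i j
      have h1 : (fun q : Spacetime n => (q.1 * φ q) • L.second i j q) =ᶠ[𝓝 p]
          fun q => -(m i j q • ContinuousLinearMap.id ℝ (Fibre k)) := by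
        filter_upwards [hpO] with q hq
        rw [hL q hq, smul_neg, smul_smul]
      rw [h1.fderiv_eq, ((hmd i j).smul_const (ContinuousLinearMap.id ℝ (Fibre k))).fun_neg.fderiv]
      simp
    -- The coefficient `τ² G` carries one more factor `τ` under the derivative than the
    -- distributional form of `L u`. Differentiating it contributes only for `i = 0` and accounts
    -- for the first order term `-∑ G^{0ν} V_ν u`.
    have e2 : ∀ i j, fderiv ℝ (fun q : Spacetime n => φ q * (q.1 ^ 2 * G i j q)) p
        (coordFrame n i) =
        p.1 * fderiv ℝ (m i j) p (coordFrame n i) + (coordFrame n i).1 * (p.1 * φ p * G i j p) := by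
      intro i j
      have h1 : (fun q : Spacetime n => φ q * (q.1 ^ 2 * G i j q)) = fun q => q.1 * m i j q := by
        funext q
        simp only [m]
        ring
      have h2 : HasFDerivAt (fun q : Spacetime n => q.1 * m i j q) _ p :=
        (hasFDerivAt_fst (𝕜 := ℝ) (p := p)).mul (hmd i j)
      rw [h1, h2.fderiv]
      simp [m]
      ring
    have e3 : ∀ j, ∑ i, (coordFrame n i).1 * (p.1 * φ p * G i j p) = p.1 * φ p * G 0 j p := by
      intro j
      rw [Fin.sum_univ_succ]
      simp [coordFrame_zero, coordFrame_succ]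
    have e4 : ∑ i, ∑ j, ((coordFrame n i).1 * (p.1 * φ p * G i j p)) •
        fderiv ℝ u p (coordFrame n j) = φ p • ∑ j, G 0 j p • zeroDeriv j u p := by
      rw [Finset.sum_comm]
      simp only [← Finset.sum_smul, e3, Finset.smul_sum, zeroDeriv, smul_smul]
      exact Finset.sum_congr rfl fun j _ => by congr 1; ring
    have e5 : ∑ i, ∑ j, (p.1 * fderiv ℝ (m i j) p (coordFrame n i)) •
        fderiv ℝ u p (coordFrame n j) =
        -∑ i, ∑ j, (-(fderiv ℝ (m i j) p (coordFrame n i) •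
          ContinuousLinearMap.id ℝ (Fibre k))) (zeroDeriv j u p) := by
      simp only [← Finset.sum_neg_distrib]
      refine Finset.sum_congr rfl fun i _ => Finset.sum_congr rfl fun j _ => ?_
      simp [zeroDeriv, smul_smul]
    simp only [e1, e2, add_smul, Finset.sum_add_distrib, e4, e5, smul_sub, smul_add,
      Finset.smul_sum]
    abel
  · intro p hp
    have hp' : p ∉ tsupport φ := fun h => hp (hφO h)
    have h1 : ∀ i j, fderiv ℝ (fun q : Spacetime n => φ q * (q.1 ^ 2 * G i j q)) p = 0 := by
      intro i j
      have := (hzero p hp' (fun _ => 1) fun q => q.1 ^ 2 * G i j q).2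
      simpa using this
    simp only [h1, (hzero p hp' (fun _ => 1) fun _ => (0 : ℝ)).1]
    simp

/-- The energy identity for `L u = 0`, tested against `ψ`. -/
theorem ZeroOp.IsDistribSolutionOn.energy_identity {L : ZeroOp n k} {O : Set (Spacetime n)}
    (hO : IsOpen O) (hpos : ∀ p ∈ O, 0 < p.1)
    {G : Fin (n + 1) → Fin (n + 1) → Spacetime n → ℝ} (hsymm : ∀ i j, G i j = G j i)
    (hG : ∀ i j, ContDiffOn ℝ 1 (G i j) O)
    (hL : ∀ p ∈ O, ∀ i j, L.second i j p = -(G i j p • ContinuousLinearMap.id ℝ (Fibre k)))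
    (hB : ∀ i, ContinuousOn (L.first i) O) (hZ : ContinuousOn L.zeroth O)
    {u : Spacetime n → Fibre k} (hu1 : ContDiffOn ℝ 1 u O)
    (hu : L.IsDistribSolutionOn O u) {ψ : Spacetime n → ℝ}
    (hψ : ContDiff ℝ 1 ψ) (hψc : HasCompactSupport ψ) (hψO : tsupport ψ ⊆ O) :
    ∫ p, ((∑ i, fderiv ℝ ψ p (coordFrame n i) * flux (fun a b => G a b p) (zeroJet u p).1 i)
      + fderiv ℝ ψ p (coordFrame n 0) * ‖u p‖ ^ 2
      + ψ p * (p.1⁻¹ * energySource (fun a b => G a b p) (fun l a b => zeroDeriv l (G a b) p)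
          (fun i => L.first i p) (L.zeroth p) (zeroJet u p))) = 0 := by
  have hz : ∀ a, ContinuousOn (fun p => fderiv ℝ u p (coordFrame n a)) O := fun a =>
    (hu1.continuousOn_fderiv_of_isOpen hO le_rfl).clm_apply continuousOn_const
  have hw : ∀ a, ContinuousOn (zeroDeriv a u) O := fun a => continuousOn_fst.smul (hz a)
  have hf : ContinuousOn (fun p => ∑ μ, L.first μ p (zeroDeriv μ u p) + L.zeroth p (u p) -
          ∑ ν, G 0 ν p • zeroDeriv ν u p) O := by
    refine ContinuousOn.sub (ContinuousOn.add ?_ (hZ.clm_apply hu1.continuousOn)) ?_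
    · exact continuousOn_finsetSum _ fun μ _ => (hB μ).clm_apply (hw μ)
    · exact continuousOn_finsetSum _ fun ν _ => ((hG 0 ν).continuousOn).smul (hw ν)
  have hg : ∀ i j, ContDiffOn ℝ 1 (fun q : Spacetime n => q.1 ^ 2 * G i j q) O := fun i j =>
    (contDiff_fst.pow 2).contDiffOn.mul (hG i j)
  have main := weak_energy_identity (μ := volume) (coordFrame n)
    (g := fun i j q => q.1 ^ 2 * G i j q) (Y := fun b q => G 0 b q) hO
    (fun i j => by rw [hsymm]) hg (fun b => hG 0 b) hu1 hf
    -- The multiplier has components `Y^b = G^{0b}`, the metric gradient of `τ`.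
    (fun φ hφ hφc hφO => hu.weak_wave_equation hO hG hL hφ hφc hφO) hψ hψc hψO
  have hlow1 : ContDiff ℝ 1 fun q => ψ q • ‖u q‖ ^ 2 :=
    ContDiffOn.contDiff_smul_of_tsupport_subset (n := 1) (hu1.norm_sq ℝ) hO hψ hψO
  have hlowc : HasCompactSupport fun q => ψ q • ‖u q‖ ^ 2 := hψc.smul_right
  -- The zeroth order part of the energy: the integral of `∂_τ(ψ |u|²)` vanishes and is added to the
  -- identity for the gradient.
  have hlow := integral_fderiv_apply_eq_zero (μ := volume) hlow1 hlowc (coordFrame n 0)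
  have hlowi : Integrable fun p => fderiv ℝ (fun q => ψ q • ‖u q‖ ^ 2) p (coordFrame n 0) :=
    ((hlow1.continuous_fderiv one_ne_zero).clm_apply
      continuous_const).integrable_of_hasCompactSupport (hlowc.fderiv_apply ℝ _)
  -- Integrability of `f` need not be checked: if `f` is not integrable, neither is the sum, and its
  -- integral is `0` by convention.
  have hadd : ∀ {f g : Spacetime n → ℝ}, ∫ p, f p = 0 → ∫ p, g p = 0 → Integrable g →
      ∫ p, (f p + g p) = 0 := by
    intro f g h1 h2 hg
    by_cases hfi : Integrable f
    · rw [integral_add hfi hg, h1, h2, add_zero]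
    · refine integral_undef fun h => hfi ?_
      exact (h.sub hg).congr (Eventually.of_forall fun p => by simp)
  rw [← hadd main hlow hlowi]
  refine integral_congr_ae (Eventually.of_forall fun p => ?_)
  by_cases hp : p ∈ tsupport ψ
  · have hpO : O ∈ 𝓝 p := hO.mem_nhds (hψO hp)
    have hp0 : p.1 ≠ 0 := (hpos p (hψO hp)).ne'
    have hGd : ∀ i j, HasFDerivAt (G i j) (fderiv ℝ (G i j) p) p := fun i j =>
      (((hG i j).contDiffAt hpO).differentiableAt one_ne_zero).hasFDerivAt
    have hlowp : fderiv ℝ (fun q => ψ q • ‖u q‖ ^ 2) p (coordFrame n 0) =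
        fderiv ℝ ψ p (coordFrame n 0) * ‖u p‖ ^ 2 +
          ψ p * (2 * ⟪u p, fderiv ℝ u p (coordFrame n 0)⟫) := by
      have h1 := (hψ.differentiable one_ne_zero p).hasFDerivAt
      have h2 := ((hu1.contDiffAt hpO).differentiableAt one_ne_zero).hasFDerivAt.norm_sq
      have h3 : HasFDerivAt (fun q => ψ q • ‖u q‖ ^ 2) _ p := h1.smul h2
      rw [h3.fderiv]
      simp
      ring
    -- Besides the derivatives of `G`, the factor `τ²` in the current is differentiated for `i = 0`;
    -- this produces the term `2 * flux G y.1 0` of `energySource`.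
    have hcd : ∀ i a b, fderiv ℝ (fun q : Spacetime n => 2 * (q.1 ^ 2 * G i a q) * G 0 b q -
        G 0 i q * (q.1 ^ 2 * G a b q)) p (coordFrame n i) =
        p.1 * ((2 * zeroDeriv i (G i a) p * G 0 b p + 2 * G i a p * zeroDeriv i (G 0 b) p -
          zeroDeriv i (G 0 i) p * G a b p - G 0 i p * zeroDeriv i (G a b) p) +
          2 * (coordFrame n i).1 * fluxCoeff (fun a b => G a b p) i a b) := by
      intro i a b
      have hsq : HasFDerivAt (fun q : Spacetime n => q.1 ^ 2)
          ((2 * p.1) • ContinuousLinearMap.fst ℝ ℝ _) p := by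
        have := (hasFDerivAt_fst (𝕜 := ℝ) (p := p)).pow 2
        simpa using this
      have h1 : HasFDerivAt (fun q : Spacetime n => 2 * (q.1 ^ 2 * G i a q) * G 0 b q -
        G 0 i q * (q.1 ^ 2 * G a b q)) _ p :=
        (((hsq.mul (hGd i a)).const_mul 2).mul (hGd 0 b)).sub
          ((hGd 0 i).mul (hsq.mul (hGd a b)))
      rw [h1.fderiv]
      simp [zeroDeriv, fluxCoeff]
      ring
    have hflux : ∀ i, flux (fun a b => G a b p) (zeroJet u p).1 i =
        ∑ a, ∑ b, (2 * (p.1 ^ 2 * G i a p) * G 0 b p - G 0 i p * (p.1 ^ 2 * G a b p)) *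
          ⟪fderiv ℝ u p (coordFrame n a), fderiv ℝ u p (coordFrame n b)⟫ := by
      intro i
      simp only [flux, fluxCoeff, zeroJet, zeroDeriv, real_inner_smul_left, real_inner_smul_right]
      exact Finset.sum_congr rfl fun a _ => Finset.sum_congr rfl fun b _ => by ring
    have hin : ∀ a b, ⟪(zeroJet u p).1 a, (zeroJet u p).1 b⟫ =
        p.1 ^ 2 * ⟪fderiv ℝ u p (coordFrame n a), fderiv ℝ u p (coordFrame n b)⟫ := by
      intro a b
      simp only [zeroJet, zeroDeriv, real_inner_smul_left, real_inner_smul_right]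
      ring
    have hsum0 : ∑ i, ∑ a, ∑ b, (2 * (coordFrame n i).1 * fluxCoeff (fun a b => G a b p) i a b) *
        ⟪(zeroJet u p).1 a, (zeroJet u p).1 b⟫ =
        2 * flux (fun a b => G a b p) (zeroJet u p).1 0 := by
      rw [Fin.sum_univ_succ]
      simp [coordFrame_zero, coordFrame_succ, flux, Finset.mul_sum, mul_assoc]
    have hsrc : p.1⁻¹ * energySource (fun a b => G a b p) (fun l a b => zeroDeriv l (G a b) p)
          (fun i => L.first i p) (L.zeroth p) (zeroJet u p) =
        2 * ⟪∑ μ, L.first μ p (zeroDeriv μ u p) + L.zeroth p (u p) -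
          ∑ ν, G 0 ν p • zeroDeriv ν u p, ∑ b, G 0 b p • fderiv ℝ u p (coordFrame n b)⟫
        + 2 * ⟪u p, fderiv ℝ u p (coordFrame n 0)⟫
        + ∑ i, ∑ a, ∑ b, fderiv ℝ (fun q : Spacetime n => 2 * (q.1 ^ 2 * G i a q) * G 0 b q -
          G 0 i q * (q.1 ^ 2 * G a b q)) p (coordFrame n i) *
          ⟪fderiv ℝ u p (coordFrame n a), fderiv ℝ u p (coordFrame n b)⟫ := by
      have t1 : ∑ b, G 0 b p • zeroDeriv b u p =
          p.1 • ∑ b, G 0 b p • fderiv ℝ u p (coordFrame n b) := by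
        simp only [zeroDeriv, Finset.smul_sum, smul_comm p.1]
      have t2 : ∀ x : Fibre k, ⟪x, ∑ b, G 0 b p • zeroDeriv b u p⟫ =
          p.1 * ⟪x, ∑ b, G 0 b p • fderiv ℝ u p (coordFrame n b)⟫ := fun x => by
        rw [t1, real_inner_smul_right]
      have t3 : ⟪zeroDeriv 0 u p, u p⟫ = p.1 * ⟪u p, fderiv ℝ u p (coordFrame n 0)⟫ := by
        rw [zeroDeriv, real_inner_smul_left, real_inner_comm]
      have t4 : ∑ i, ∑ a, ∑ b, fderiv ℝ (fun q : Spacetime n => 2 * (q.1 ^ 2 * G i a q) * G 0 b q -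
          G 0 i q * (q.1 ^ 2 * G a b q)) p (coordFrame n i) *
          ⟪fderiv ℝ u p (coordFrame n a), fderiv ℝ u p (coordFrame n b)⟫ = p.1⁻¹ *
          (∑ i, ∑ a, ∑ b, (2 * zeroDeriv i (G i a) p * G 0 b p + 2 * G i a p * zeroDeriv i (G 0 b) p
            - zeroDeriv i (G 0 i) p * G a b p - G 0 i p * zeroDeriv i (G a b) p) *
            ⟪(zeroJet u p).1 a, (zeroJet u p).1 b⟫ +
            2 * flux (fun a b => G a b p) (zeroJet u p).1 0) := by
        rw [← hsum0]
        simp only [← Finset.sum_add_distrib, Finset.mul_sum, hin, hcd]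
        refine Finset.sum_congr rfl fun i _ => Finset.sum_congr rfl fun a _ =>
          Finset.sum_congr rfl fun b _ => ?_
        field_simp
      rw [t4, energySource]
      have t5 : (zeroJet u p).2 = u p := rfl
      have t6 : ∀ μ, (zeroJet u p).1 μ = zeroDeriv μ u p := fun μ => rfl
      simp only [t5, t6, t2, t3]
      field_simp
      ring
    beta_reduce
    rw [hlowp, hsrc]
    simp only [hflux]
    ring
  · have hψ0 : ψ =ᶠ[𝓝 p] 0 := notMem_tsupport_iff_eventuallyEq.1 hp
    have h1 : (fun q => ψ q • ‖u q‖ ^ 2) =ᶠ[𝓝 p] fun _ => 0 := by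
      filter_upwards [hψ0] with q hq
      simp [hq]
    simp only [h1.fderiv_eq, hψ0.self_of_nhds, hψ0.fderiv_eq]
    simp

end ZeroGeometry

/-! ### The weighted cutoff in time -/

section TimeCutoff

open Filter Topology Set

theorem Real.smoothTransition.deriv_eq_zero {x : ℝ} (hx : x < 0 ∨ 1 < x) :
    deriv Real.smoothTransition x = 0 := by
  rcases hx with hx | hx
  · have : Real.smoothTransition =ᶠ[𝓝 x] fun _ => 0 := by
      filter_upwards [eventually_lt_nhds hx] with y hy
      exact Real.smoothTransition.zero_of_nonpos hy.le
    rw [this.deriv_eq, deriv_const]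
  · have : Real.smoothTransition =ᶠ[𝓝 x] fun _ => 1 := by
      filter_upwards [eventually_gt_nhds hx] with y hy
      exact Real.smoothTransition.one_of_one_le hy.le
    rw [this.deriv_eq, deriv_const]

theorem Real.smoothTransition.hasDerivAt (x : ℝ) :
    HasDerivAt Real.smoothTransition (deriv Real.smoothTransition x) x :=
  ((Real.smoothTransition.contDiff (n := 1)).differentiable (by simp) x).hasDerivAt

theorem Real.smoothTransition.deriv_nonneg (x : ℝ) : 0 ≤ deriv Real.smoothTransition x :=
  Real.smoothTransition.monotone.deriv_nonneg

theorem Real.smoothTransition.exists_deriv_le : ∃ B, 0 ≤ B ∧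
    ∀ x, deriv Real.smoothTransition x ≤ B := by
  have hc : Continuous (deriv Real.smoothTransition) :=
    (Real.smoothTransition.contDiff (n := 1)).continuous_deriv (by simp)
  obtain ⟨B, hB⟩ := (isCompact_Icc (a := (0 : ℝ)) (b := 1)).exists_bound_of_continuousOn
    hc.continuousOn
  have hB0 : 0 ≤ B := (norm_nonneg _).trans (hB 0 (by simp))
  refine ⟨B, hB0, fun x => ?_⟩
  by_cases hx : x ∈ Icc (0 : ℝ) 1
  · exact (le_abs_self _).trans (hB x hx)
  · rw [Real.smoothTransition.deriv_eq_zero]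
    · exact hB0
    · simp only [mem_Icc, not_and_or, not_le] at hx
      exact hx

/-- A smooth cutoff to `ε ≤ t ≤ s`, times `t⁻ᵐ`. -/
noncomputable def timeCutoff (ε s : ℝ) (m : ℕ) (t : ℝ) : ℝ :=
  Real.smoothTransition ((t - ε) / ε) * Real.smoothTransition (s - t) * (t ^ m)⁻¹

variable {ε s : ℝ} {m : ℕ}

theorem timeCutoff_eq_zero_of_le (hε : 0 < ε) {t : ℝ} (ht : t ≤ ε) : timeCutoff ε s m t = 0 := by
  rw [timeCutoff, Real.smoothTransition.zero_of_nonpos, zero_mul, zero_mul]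
  exact div_nonpos_of_nonpos_of_nonneg (by linarith) hε.le

theorem timeCutoff_eq_zero_of_ge {t : ℝ} (ht : s ≤ t) : timeCutoff ε s m t = 0 := by
  rw [timeCutoff, Real.smoothTransition.zero_of_nonpos (x := s - t) (by linarith), mul_zero,
    zero_mul]

theorem timeCutoff_nonneg {t : ℝ} (ht : 0 ≤ t) : 0 ≤ timeCutoff ε s m t := by
  have h1 := Real.smoothTransition.nonneg ((t - ε) / ε)
  have h2 := Real.smoothTransition.nonneg (s - t)
  rw [timeCutoff]
  positivity

theorem timeCutoff_of_two_mul_le (hε : 0 < ε) {t : ℝ} (ht : 2 * ε ≤ t) :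
    timeCutoff ε s m t = Real.smoothTransition (s - t) * (t ^ m)⁻¹ := by
  rw [timeCutoff, Real.smoothTransition.one_of_one_le, one_mul]
  rw [le_div_iff₀ hε]
  linarith

theorem contDiff_timeCutoff (hε : 0 < ε) : ContDiff ℝ 1 (timeCutoff ε s m) := by
  refine contDiff_iff_contDiffAt.2 fun t => ?_
  rcases lt_or_ge t ε with ht | ht
  · have : timeCutoff ε s m =ᶠ[𝓝 t] fun _ => 0 := by
      filter_upwards [eventually_lt_nhds ht] with y hy
      exact timeCutoff_eq_zero_of_le hε hy.le
    exact contDiffAt_const.congr_of_eventuallyEq this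
  · have h1 : ContDiff ℝ 1 fun t => Real.smoothTransition ((t - ε) / ε) :=
      (Real.smoothTransition.contDiff (n := 1)).comp (by fun_prop)
    have h2 : ContDiff ℝ 1 fun t => Real.smoothTransition (s - t) :=
      (Real.smoothTransition.contDiff (n := 1)).comp (by fun_prop)
    have h3 : ContDiffAt ℝ 1 (fun t : ℝ => (t ^ m)⁻¹) t :=
      (contDiffAt_id.pow m).inv (pow_ne_zero _ (by simp only [id]; linarith))
    exact (h1.contDiffAt.mul h2.contDiffAt).mul h3

/-- Of the three factors, `t⁻ᵐ` contributes the good term `-(m / t)`, the initial transition lives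
on `[ε, 2ε]` with slope at most `B / ε`, and the final transition is decreasing and can be dropped.
-/
theorem deriv_timeCutoff_le {B : ℝ} (hB : ∀ x, deriv Real.smoothTransition x ≤ B) (hε : 0 < ε)
    {t : ℝ} (ht : 0 < t) :
    deriv (timeCutoff ε s m) t ≤ -(m / t * timeCutoff ε s m t) +
      (Icc ε (2 * ε)).indicator (fun _ => B / ε) t * (t ^ m)⁻¹ := by
  set T := Real.smoothTransition
  have hd1 : HasDerivAt (fun t => T ((t - ε) / ε)) (deriv T ((t - ε) / ε) * (1 / ε)) t :=
    (Real.smoothTransition.hasDerivAt _).comp t (((hasDerivAt_id t).sub_const ε).div_const ε)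
  have hd2 : HasDerivAt (fun t => T (s - t)) (deriv T (s - t) * (-1)) t :=
    (Real.smoothTransition.hasDerivAt _).comp t ((hasDerivAt_id t).const_sub s)
  have hd3 : HasDerivAt (fun t : ℝ => (t ^ m)⁻¹) (-(m / t * (t ^ m)⁻¹)) t := by
    have := (hasDerivAt_pow m t).inv (pow_ne_zero m ht.ne')
    convert! this using 1
    rcases m with _ | m
    · simp
    · simp only [Nat.add_sub_cancel]
      field_simp
      ring
  have hd : HasDerivAt (timeCutoff ε s m) _ t := (hd1.mul hd2).mul hd3
  rw [hd.deriv]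
  have hT1 := Real.smoothTransition.nonneg ((t - ε) / ε)
  have hT2 := Real.smoothTransition.nonneg (s - t)
  have hT2' := Real.smoothTransition.le_one (s - t)
  have hD2 := Real.smoothTransition.deriv_nonneg (s - t)
  have hD1 := Real.smoothTransition.deriv_nonneg ((t - ε) / ε)
  have hp : 0 < (t ^ m)⁻¹ := by positivity
  have h1 : deriv T ((t - ε) / ε) * (1 / ε) ≤ (Icc ε (2 * ε)).indicator (fun _ => B / ε) t := by
    by_cases hmem : t ∈ Icc ε (2 * ε)
    · rw [indicator_of_mem hmem, mul_one_div]
      gcongr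
      exact hB _
    · rw [indicator_of_notMem hmem, Real.smoothTransition.deriv_eq_zero, zero_mul]
      simp only [mem_Icc, not_and_or, not_le] at hmem
      rcases hmem with h | h
      · left
        exact div_neg_of_neg_of_pos (by linarith) hε
      · right
        rw [lt_div_iff₀ hε]
        linarith
  have h0 : 0 ≤ deriv T ((t - ε) / ε) * (1 / ε) := by positivity
  have h2 : deriv T ((t - ε) / ε) * (1 / ε) * T (s - t) ≤
      (Icc ε (2 * ε)).indicator (fun _ => B / ε) t :=
    (mul_le_of_le_one_right h0 hT2').trans h1
  have h3 : 0 ≤ T ((t - ε) / ε) * deriv T (s - t) := mul_nonneg hT1 hD2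
  have h4 : (deriv T ((t - ε) / ε) * (1 / ε) * T (s - t) + T ((t - ε) / ε) *
      (deriv T (s - t) * (-1))) * (t ^ m)⁻¹ ≤
      (Icc ε (2 * ε)).indicator (fun _ => B / ε) t * (t ^ m)⁻¹ := by
    gcongr
    linarith
  simp only [timeCutoff, Pi.mul_apply]
  change _ ≤ -(m / t * (T ((t - ε) / ε) * T (s - t) * (t ^ m)⁻¹)) + _
  linarith

end TimeCutoff

/-! ### Geometry of the domain and the spacetime cutoff -/

namespace ZeroGeometry

open Filter Topology Set MeasureTheory
open scoped RealInnerProductSpace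

variable {n : ℕ} {R₀ C τ₀ : ℝ}

theorem isCompact_Omega (hC : 0 < C) : IsCompact (Omega n R₀ C τ₀) := by
  have hsub : Omega n R₀ C τ₀ ⊆ Icc 0 τ₀ ×ˢ Metric.closedBall 0 R₀ := by
    rintro p ⟨h1, h2, h3⟩
    refine ⟨⟨h1, h2⟩, ?_⟩
    rw [mem_closedBall_zero_iff]
    have : 0 ≤ C * p.1 := by positivity
    linarith
  have hcl : IsClosed (Omega n R₀ C τ₀) :=
    (isClosed_le continuous_const continuous_fst).inter
      ((isClosed_le continuous_fst continuous_const).inter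
        (isClosed_le continuous_snd.norm
          (continuous_const.sub (continuous_const.mul continuous_fst))))
  exact (isCompact_Icc.prod (isCompact_closedBall 0 R₀)).of_isClosed_subset hcl hsub

theorem interior_Omega (hC : 0 < C) : interior (Omega n R₀ C τ₀) =
    {p | 0 < p.1 ∧ p.1 < τ₀ ∧ ‖p.2‖ < R₀ - C * p.1} := by
  refine Subset.antisymm (fun p hp => ?_) (interior_maximal (fun p hp => ?_) ?_)
  -- Moving an interior point slightly along `±∂_τ` already yields all three strict inequalities,
  -- since the lateral boundary narrows as `τ` grows.
  · have hmem : ∀ v : Spacetime n, ∃ t : ℝ, 0 < t ∧ p + t • v ∈ Omega n R₀ C τ₀ := by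
      intro v
      have hc : Tendsto (fun t : ℝ => p + t • v) (𝓝[>] 0) (𝓝 p) := by
        have : Continuous fun t : ℝ => p + t • v := by fun_prop
        have h := this.tendsto 0
        rw [zero_smul, add_zero] at h
        exact h.mono_left nhdsWithin_le_nhds
      have hev := hc.eventually (mem_interior_iff_mem_nhds.1 hp)
      obtain ⟨t, ht, ht'⟩ := (hev.and self_mem_nhdsWithin).exists
      exact ⟨t, ht', ht⟩
    obtain ⟨t, ht, h1, -, -⟩ := hmem (-1, 0)
    obtain ⟨t', ht', -, h2, h3⟩ := hmem (1, 0)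
    simp only [Prod.fst_add, Prod.smul_fst, Prod.snd_add, Prod.smul_snd, smul_eq_mul, smul_zero,
      add_zero] at h1 h2 h3
    refine ⟨by linarith, by linarith, ?_⟩
    have : 0 < C * t' := by positivity
    linarith
  · exact ⟨hp.1.le, hp.2.1.le, hp.2.2.le⟩
  · exact (isOpen_lt continuous_const continuous_fst).inter
      ((isOpen_lt continuous_fst continuous_const).inter (isOpen_lt continuous_snd.norm
        (continuous_const.sub (continuous_const.mul continuous_fst))))

theorem convex_Omega : Convex ℝ (Omega n R₀ C τ₀) := by
  rintro p ⟨h1, h2, h3⟩ q ⟨k1, k2, k3⟩ a b ha hb hab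
  refine ⟨?_, ?_, ?_⟩ <;>
    simp only [Prod.fst_add, Prod.smul_fst, Prod.snd_add, Prod.smul_snd, smul_eq_mul]
  · positivity
  · calc a * p.1 + b * q.1 ≤ a * τ₀ + b * τ₀ := by gcongr
      _ = τ₀ := by rw [← add_mul, hab, one_mul]
  · calc ‖a • p.2 + b • q.2‖ ≤ a * ‖p.2‖ + b * ‖q.2‖ := by
          refine (norm_add_le _ _).trans ?_
          rw [norm_smul, norm_smul, Real.norm_of_nonneg ha, Real.norm_of_nonneg hb]
      _ ≤ a * (R₀ - C * p.1) + b * (R₀ - C * q.1) := by gcongr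
      _ = (a + b) * R₀ - C * (a * p.1 + b * q.1) := by ring
      _ = _ := by rw [hab, one_mul]

/-- A defining function of the lateral boundary, positive inside. -/
noncomputable def lateralDefining (R₀ C : ℝ) (p : Spacetime n) : ℝ :=
  (R₀ - C * p.1) ^ 2 - ‖p.2‖ ^ 2

/-- Minus one half of the differential of `lateralDefining`. -/
def lateralCovector (R₀ C : ℝ) (p : Spacetime n) : Fin (n + 1) → ℝ :=
  Fin.cons (C * (R₀ - C * p.1)) fun j => p.2 j

theorem continuous_lateralDefining : Continuous (lateralDefining (n := n) R₀ C) := by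
  unfold lateralDefining
  fun_prop

theorem hasFDerivAt_lateralDefining (p : Spacetime n) :
    HasFDerivAt (lateralDefining R₀ C)
      ((2 * (R₀ - C * p.1)) • (-(C • ContinuousLinearMap.fst ℝ ℝ (EuclideanSpace ℝ (Fin n)))) -
        2 • (innerSL ℝ p.2).comp (ContinuousLinearMap.snd ℝ ℝ _)) p := by
  have h1 : HasFDerivAt (fun q : Spacetime n => (R₀ - C * q.1) ^ 2)
      ((2 * (R₀ - C * p.1)) • (-(C • ContinuousLinearMap.fst ℝ ℝ (EuclideanSpace ℝ (Fin n))))) p := by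
    have := (((hasFDerivAt_fst (𝕜 := ℝ) (p := p)).const_mul C).const_sub R₀).pow 2
    simpa using this
  exact h1.sub (hasFDerivAt_snd (𝕜 := ℝ) (p := p)).norm_sq

theorem contDiff_lateralDefining : ContDiff ℝ 1 (lateralDefining (n := n) R₀ C) := by
  unfold lateralDefining
  exact ((contDiff_const.sub (contDiff_const.mul contDiff_fst)).pow 2).sub
    (contDiff_snd.norm_sq ℝ)

theorem fderiv_lateralDefining_coordFrame (p : Spacetime n) (μ : Fin (n + 1)) :
    fderiv ℝ (lateralDefining R₀ C) p (coordFrame n μ) = -2 * lateralCovector R₀ C p μ := by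
  rw [(hasFDerivAt_lateralDefining p).fderiv]
  refine Fin.cases ?_ (fun j => ?_) μ
  · simp [coordFrame_zero, lateralCovector]
    ring
  · simp [coordFrame_succ, lateralCovector, EuclideanSpace.inner_single_right]

/-- The cutoff in time and space used to localize the energy identity. -/
noncomputable def energyCutoff (R₀ C δ ε s : ℝ) (m : ℕ) (p : Spacetime n) : ℝ :=
  timeCutoff ε s m p.1 * Real.smoothTransition ((lateralDefining R₀ C p - δ) / δ)

section Cutoff

variable {δ ε s : ℝ} {m : ℕ}

theorem contDiff_energyCutoff (hε : 0 < ε) :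
    ContDiff ℝ 1 (energyCutoff (n := n) R₀ C δ ε s m) := by
  have h1 : ContDiff ℝ 1 fun p : Spacetime n => timeCutoff ε s m p.1 :=
    (contDiff_timeCutoff hε).comp contDiff_fst
  have h2 : ContDiff ℝ 1 fun p : Spacetime n =>
      Real.smoothTransition ((lateralDefining R₀ C p - δ) / δ) := by
    refine (Real.smoothTransition.contDiff (n := 1)).comp ?_
    have := contDiff_lateralDefining (n := n) (R₀ := R₀) (C := C)
    fun_prop
  exact h1.mul h2

theorem tsupport_energyCutoff_subset (hε : 0 < ε) (hδ : 0 < δ) :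
    tsupport (energyCutoff (n := n) R₀ C δ ε s m) ⊆
      {p | ε ≤ p.1 ∧ p.1 ≤ s ∧ δ ≤ lateralDefining R₀ C p} := by
  refine closure_minimal (fun p hp => ?_) ?_
  · refine ⟨?_, ?_, ?_⟩
    · by_contra! h
      exact hp (by rw [energyCutoff, timeCutoff_eq_zero_of_le hε h.le, zero_mul])
    · by_contra! h
      exact hp (by rw [energyCutoff, timeCutoff_eq_zero_of_ge h.le, zero_mul])
    · by_contra! h
      refine hp ?_
      rw [energyCutoff, Real.smoothTransition.zero_of_nonpos, mul_zero]
      exact div_nonpos_of_nonpos_of_nonneg (by linarith) hδ.le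
  · exact (isClosed_le continuous_const continuous_fst).inter
      ((isClosed_le continuous_fst continuous_const).inter
        (isClosed_le continuous_const continuous_lateralDefining))

theorem tsupport_energyCutoff_subset_interior (hε : 0 < ε) (hδ : 0 < δ) (hC : 0 < C)
    (hCτ : C * τ₀ < R₀) (hs : s < τ₀) :
    tsupport (energyCutoff (n := n) R₀ C δ ε s m) ⊆ interior (Omega n R₀ C τ₀) := by
  refine (tsupport_energyCutoff_subset hε hδ).trans ?_
  rw [interior_Omega hC]
  rintro p ⟨h1, h2, h3⟩
  have h4 : C * p.1 ≤ C * τ₀ := by gcongr; linarith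
  refine ⟨by linarith, by linarith, ?_⟩
  refine lt_of_pow_lt_pow_left₀ 2 (by linarith) ?_
  rw [lateralDefining] at h3
  linarith

theorem fderiv_energyCutoff_coordFrame (hε : 0 < ε) (p : Spacetime n) (μ : Fin (n + 1)) :
    fderiv ℝ (energyCutoff R₀ C δ ε s m) p (coordFrame n μ) =
      deriv (timeCutoff ε s m) p.1 *
          Real.smoothTransition ((lateralDefining R₀ C p - δ) / δ) * levelConormal n μ -
        2 / δ * timeCutoff ε s m p.1 *
          deriv Real.smoothTransition ((lateralDefining R₀ C p - δ) / δ) *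
          lateralCovector R₀ C p μ := by
  have ht : HasFDerivAt (fun q : Spacetime n => timeCutoff ε s m q.1)
      (deriv (timeCutoff ε s m) p.1 • ContinuousLinearMap.fst ℝ ℝ (EuclideanSpace ℝ (Fin n))) p :=
    HasDerivAt.comp_hasFDerivAt p
      ((contDiff_timeCutoff hε).differentiable one_ne_zero p.1).hasDerivAt hasFDerivAt_fst
  have hr : HasFDerivAt (fun q : Spacetime n =>
      Real.smoothTransition ((lateralDefining R₀ C q - δ) / δ))
      (deriv Real.smoothTransition ((lateralDefining R₀ C p - δ) / δ) •
        (δ⁻¹ • fderiv ℝ (lateralDefining R₀ C) p)) p := by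
    refine HasDerivAt.comp_hasFDerivAt p (Real.smoothTransition.hasDerivAt _) ?_
    have := ((hasFDerivAt_lateralDefining (R₀ := R₀) (C := C)
      p).differentiableAt.hasFDerivAt.sub_const δ).const_mul δ⁻¹
    simpa only [div_eq_inv_mul] using this
  have h := ht.mul hr
  have h' : fderiv ℝ (energyCutoff R₀ C δ ε s m) p = _ := h.fderiv
  rw [h']
  have hl : (coordFrame n μ).1 = levelConormal n μ := by
    refine Fin.cases ?_ (fun j => ?_) μ
    · simp [coordFrame_zero, levelConormal]
    · simp [coordFrame_succ, levelConormal]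
  simp only [_root_.add_apply, _root_.smul_apply, ContinuousLinearMap.coe_fst', smul_eq_mul,
    fderiv_lateralDefining_coordFrame, hl]
  ring

end Cutoff

end ZeroGeometry

/-! ### The weighted energy estimate -/

namespace ZeroGeometry

open Filter Topology Set MeasureTheory
open scoped RealInnerProductSpace

variable {n : ℕ} {R₀ C τ₀ : ℝ}

/-- A current whose divergence is controlled by its own density, which leaves the domain through
the lateral boundary, and which decays fast enough at `τ = 0`, has vanishing density. -/
theorem density_eq_zero_of_divergence_le (hC : 0 < C) (hCτ : C * τ₀ < R₀) {s : ℝ} (hs : s < τ₀)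
    {J : Spacetime n → Fin (n + 1) → ℝ} {Q : Spacetime n → ℝ}
    (hJc : ∀ μ, ContinuousOn (fun p => J p μ) (interior (Omega n R₀ C τ₀)))
    (hQc : ContinuousOn Q (interior (Omega n R₀ C τ₀)))
    (hid : ∀ ψ : Spacetime n → ℝ, ContDiff ℝ 1 ψ → HasCompactSupport ψ →
      tsupport ψ ⊆ interior (Omega n R₀ C τ₀) →
      ∫ p, (∑ μ, fderiv ℝ ψ p (coordFrame n μ) * J p μ + ψ p * (p.1⁻¹ * Q p)) = 0)
    (hJ0 : ∀ p ∈ interior (Omega n R₀ C τ₀), 0 ≤ J p 0) {M : ℕ}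
    (hQ : ∀ p ∈ interior (Omega n R₀ C τ₀), p.1 ≤ s → Q p ≤ M * J p 0) {δ : ℝ} (hδ : 0 < δ)
    (hlat : ∀ p ∈ interior (Omega n R₀ C τ₀), lateralDefining R₀ C p < δ →
      0 ≤ ∑ μ, lateralCovector R₀ C p μ * J p μ) {K : ℝ} (hK : 0 ≤ K)
    (hdecay : ∀ p ∈ interior (Omega n R₀ C τ₀), p.1 ≤ s → J p 0 ≤ K * p.1 ^ (M + 2))
    {p₀ : Spacetime n} (hp₀ : p₀ ∈ interior (Omega n R₀ C τ₀)) (hp₀s : p₀.1 < s) :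
    J p₀ 0 = 0 := by
  by_contra hne
  have hJp₀ : 0 < J p₀ 0 := lt_of_le_of_ne (hJ0 p₀ hp₀) (Ne.symm hne)
  set O := interior (Omega n R₀ C τ₀) with hOdef
  have hO : IsOpen O := isOpen_interior
  have hOeq : ∀ p ∈ O, 0 < p.1 ∧ p.1 < τ₀ ∧ ‖p.2‖ < R₀ - C * p.1 := by
    intro p hp
    rw [hOdef, interior_Omega hC] at hp
    exact hp
  obtain ⟨hp₀1, hp₀2, hp₀3⟩ := hOeq p₀ hp₀
  have hr₀ : 0 < lateralDefining R₀ C p₀ := by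
    have : ‖p₀.2‖ ^ 2 < (R₀ - C * p₀.1) ^ 2 := by gcongr
    rw [lateralDefining]
    linarith
  -- The lateral cutoff varies only for `δ' ≤ r ≤ 2δ'`, with `r` the lateral defining function. This
  -- layer must lie in `r < δ`, where the flux is outgoing, and the cutoff must be positive at `p₀`.
  set δ' : ℝ := min (δ / 4) (lateralDefining R₀ C p₀ / 2)
  have hδ' : 0 < δ' := by positivity
  have hδδ : 2 * δ' < δ := by
    have : δ' ≤ δ / 4 := min_le_left _ _
    linarith
  have hδr : δ' < lateralDefining R₀ C p₀ := by
    have : δ' ≤ lateralDefining R₀ C p₀ / 2 := min_le_right _ _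
    linarith
  obtain ⟨B, hB0, hB⟩ := Real.smoothTransition.exists_deriv_le
  set T := Real.smoothTransition
  have hTc : Continuous T := Real.smoothTransition.continuous
  set β : Spacetime n → ℝ := fun p => T ((lateralDefining R₀ C p - δ') / δ') with hβ
  have hβc : Continuous β :=
    hTc.comp ((continuous_lateralDefining.sub continuous_const).div_const _)
  have hβ0 : ∀ p, 0 ≤ β p := fun p => Real.smoothTransition.nonneg _
  have hβ1 : ∀ p, β p ≤ 1 := fun p => Real.smoothTransition.le_one _
  -- For `2ε ≤ τ` the weighted density does not depend on `ε`, so it is bounded below near `p₀`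
  -- uniformly as `ε → 0`.
  set Θ : Spacetime n → ℝ := fun p =>
    p.1⁻¹ * (T (s - p.1) * (p.1 ^ (M + 1))⁻¹) * β p * J p 0 with hΘ
  have hΘp : 0 < Θ p₀ := by
    have h1 : 0 < T (s - p₀.1) := Real.smoothTransition.pos_of_pos (by linarith)
    have h2 : 0 < β p₀ := Real.smoothTransition.pos_of_pos (div_pos (by linarith) hδ')
    simp only [hΘ]
    positivity
  have hΘc : ContinuousAt Θ p₀ := by
    have h1 : ContinuousAt (fun p => J p 0) p₀ := (hJc 0).continuousAt (hO.mem_nhds hp₀)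
    have h2 : ContinuousAt (fun p : Spacetime n => p.1⁻¹) p₀ :=
      continuousAt_fst.inv₀ hp₀1.ne'
    have h3 : ContinuousAt (fun p : Spacetime n => (p.1 ^ (M + 1))⁻¹) p₀ :=
      (continuousAt_fst.pow _).inv₀ (pow_ne_zero _ hp₀1.ne')
    have h4 : ContinuousAt (fun p : Spacetime n => T (s - p.1)) p₀ :=
      (hTc.comp (continuous_const.sub continuous_fst)).continuousAt
    exact ((h2.mul (h4.mul h3)).mul hβc.continuousAt).mul h1
  obtain ⟨ρ, hρ, hball⟩ : ∃ ρ > 0, ∀ p ∈ Metric.closedBall p₀ ρ,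
      p ∈ O ∧ p₀.1 / 2 < p.1 ∧ p.1 < s ∧ Θ p₀ / 2 < Θ p := by
    have hev : ∀ᶠ p in 𝓝 p₀, p ∈ O ∧ p₀.1 / 2 < p.1 ∧ p.1 < s ∧ Θ p₀ / 2 < Θ p := by
      refine (hO.eventually_mem hp₀).and ((continuousAt_fst.eventually_const_lt (by linarith)).and
        ((continuousAt_fst.eventually_lt_const hp₀s).and
          (hΘc.eventually_const_lt (by linarith))))
    exact Metric.nhds_basis_closedBall.eventually_iff.1 hev
  set D := Metric.closedBall p₀ ρ
  have hDpos : 0 < volume.real D :=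
    ENNReal.toReal_pos (Metric.measure_closedBall_pos volume p₀ hρ).ne'
      measure_closedBall_lt_top.ne
  set V := (volume : Measure (EuclideanSpace ℝ (Fin n))).real (Metric.closedBall 0 R₀)
  have hV : 0 ≤ V := measureReal_nonneg
  -- The strip `ε ≤ τ ≤ 2ε` has volume at most `ε V` inside the domain and a bounded integrand; for
  -- small `ε` it cannot balance the contribution of `D`.
  obtain ⟨ε, hε, hε1, hε2⟩ : ∃ ε : ℝ, 0 < ε ∧ 2 * ε ≤ p₀.1 / 2 ∧
      2 * B * K * (ε * V) < Θ p₀ / 2 * volume.real D := by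
    set W := Θ p₀ / 2 * volume.real D
    have hW : 0 < W := by positivity
    refine ⟨min (p₀.1 / 4) (W / (2 * B * K * V + 1) / 2), by positivity, ?_, ?_⟩
    · have := min_le_left (p₀.1 / 4) (W / (2 * B * K * V + 1) / 2)
      linarith
    · have hden : 0 < 2 * B * K * V + 1 := by positivity
      have h1 : min (p₀.1 / 4) (W / (2 * B * K * V + 1) / 2) ≤ W / (2 * B * K * V + 1) / 2 :=
        min_le_right _ _
      have h2 : 0 < min (p₀.1 / 4) (W / (2 * B * K * V + 1) / 2) := by positivity
      set e := min (p₀.1 / 4) (W / (2 * B * K * V + 1) / 2)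
      calc 2 * B * K * (e * V) = (2 * B * K * V) * e := by ring
        _ ≤ (2 * B * K * V + 1) * (W / (2 * B * K * V + 1) / 2) := by
          gcongr
          linarith
        _ = W / 2 := by field_simp
        _ < W := by linarith
  set ψ : Spacetime n → ℝ := energyCutoff R₀ C δ' ε s (M + 1) with hψ
  have hψ1 : ContDiff ℝ 1 ψ := contDiff_energyCutoff hε
  have hψO : tsupport ψ ⊆ O := tsupport_energyCutoff_subset_interior hε hδ' hC hCτ hs
  have hψc : HasCompactSupport ψ :=
    (isCompact_Omega hC).of_isClosed_subset (isClosed_tsupport _) (hψO.trans interior_subset)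
  have hψs : ∀ p ∈ tsupport ψ, p.1 ≤ s := fun p hp =>
    (tsupport_energyCutoff_subset hε hδ' hp).2.1
  set I : Spacetime n → ℝ := fun p =>
    ∑ μ, fderiv ℝ ψ p (coordFrame n μ) * J p μ + ψ p * (p.1⁻¹ * Q p) with hI
  have hI0 : ∀ p ∉ tsupport ψ, I p = 0 := by
    intro p hp
    have h0 : ψ =ᶠ[𝓝 p] 0 := notMem_tsupport_iff_eventuallyEq.1 hp
    simp only [hI, h0.self_of_nhds, h0.fderiv_eq]
    simp
  have hIi : Integrable I := by
    have hcont : ContinuousOn I (tsupport ψ) := by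
      refine ContinuousOn.add (continuousOn_finsetSum _ fun μ _ => ContinuousOn.mul ?_
        ((hJc μ).mono hψO)) (hψ1.continuous.continuousOn.mul (ContinuousOn.mul ?_ (hQc.mono hψO)))
      · exact ((hψ1.continuous_fderiv one_ne_zero).clm_apply continuous_const).continuousOn
      · exact continuousOn_fst.inv₀ fun p hp => (hOeq p (hψO hp)).1.ne'
    have h1 : IntegrableOn I (tsupport ψ) := hcont.integrableOn_compact hψc
    exact (integrableOn_iff_integrable_of_support_subset fun p hp =>
      by_contra fun h => hp (hI0 p h)).1 h1
  set A : Set (Spacetime n) := Icc ε (2 * ε) ×ˢ Metric.closedBall 0 R₀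
  have hDψ : ∀ p ∈ D, p ∈ tsupport ψ := by
    intro p hp
    by_contra h
    obtain ⟨-, h1, h2, h3⟩ := hball p hp
    have h4 : ψ p = 0 := image_eq_zero_of_notMem_tsupport h
    rw [hψ, energyCutoff, timeCutoff_of_two_mul_le hε (by linarith)] at h4
    have h5 : Θ p = 0 := by
      have : Θ p = p.1⁻¹ * (T (s - p.1) * (p.1 ^ (M + 1))⁻¹ * β p) * J p 0 := by
        simp only [hΘ]; ring
      rw [this, h4]
      ring
    linarith
  -- Integrating this bound gives `0 ≤ 2 B K ε V - (Θ p₀ / 2) vol(D)`, contrary to the choice of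
  -- `ε`.
  have hbound : ∀ p,
      I p ≤ A.indicator (fun _ => 2 * B * K) p - D.indicator (fun _ => Θ p₀ / 2) p := by
    intro p
    by_cases hp : p ∈ tsupport ψ
    · have hpO := hψO hp
      obtain ⟨hp1, hp2, hp3⟩ := hOeq p hpO
      have hps := hψs p hp
      have hJp := hJ0 p hpO
      set α := timeCutoff ε s (M + 1) p.1
      have hα0 : 0 ≤ α := timeCutoff_nonneg hp1.le
      have hψp : ψ p = α * β p := rfl
      have hdiv : ∑ μ, fderiv ℝ ψ p (coordFrame n μ) * J p μ =
          deriv (timeCutoff ε s (M + 1)) p.1 * β p * J p 0 - 2 / δ' * α *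
            deriv T ((lateralDefining R₀ C p - δ') / δ') *
            ∑ μ, lateralCovector R₀ C p μ * J p μ := by
        have h0 : J p 0 = ∑ μ, levelConormal n μ * J p μ := by
          rw [Fin.sum_univ_succ]
          simp [levelConormal]
        rw [h0, Finset.mul_sum, Finset.mul_sum, ← Finset.sum_sub_distrib]
        refine Finset.sum_congr rfl fun μ _ => ?_
        rw [hψ, fderiv_energyCutoff_coordFrame hε]
        ring
      have hlatp : 0 ≤ 2 / δ' * α * deriv T ((lateralDefining R₀ C p - δ') / δ') *
            ∑ μ, lateralCovector R₀ C p μ * J p μ := by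
        rcases lt_or_ge (lateralDefining R₀ C p) δ with h | h
        · have h1 := Real.smoothTransition.deriv_nonneg ((lateralDefining R₀ C p - δ') / δ')
          have h2 := hlat p hpO h
          exact mul_nonneg (mul_nonneg (by positivity) h1) h2
        · rw [Real.smoothTransition.deriv_eq_zero]
          · simp
          · right
            rw [lt_div_iff₀ hδ']
            linarith
      have hQp : α * β p * (p.1⁻¹ * Q p) ≤ α * β p * (p.1⁻¹ * (M * J p 0)) := by
        have := hβ0 p
        gcongr
        exact hQ p hpO hps
      have hdt := deriv_timeCutoff_le (s := s) (m := M + 1) hB hε hp1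
      have hdt' : deriv (timeCutoff ε s (M + 1)) p.1 * (β p * J p 0) ≤
          (-(((M + 1 : ℕ) : ℝ) / p.1 * α) + (Icc ε (2 * ε)).indicator (fun _ => B / ε) p.1 *
            (p.1 ^ (M + 1))⁻¹) * (β p * J p 0) :=
        mul_le_mul_of_nonneg_right hdt (mul_nonneg (hβ0 p) hJp)
      have hind : (Icc ε (2 * ε)).indicator (fun _ => B / ε) p.1 *
            (p.1 ^ (M + 1))⁻¹ * (β p * J p 0) ≤ A.indicator (fun _ => 2 * B * K) p := by
        by_cases hmem : p.1 ∈ Icc ε (2 * ε)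
        · have hpA : p ∈ A := ⟨hmem, by
            rw [mem_closedBall_zero_iff]
            have : 0 ≤ C * p.1 := by positivity
            linarith⟩
          rw [indicator_of_mem hmem, indicator_of_mem hpA]
          -- The decay exponent exceeds that of the weight by one, so the factor `B / ε` meets `τ ≤
          -- 2ε` and leaves a constant.
          have h1 : β p * J p 0 ≤ K * p.1 ^ (M + 2) :=
            (mul_le_of_le_one_left hJp (hβ1 p)).trans (hdecay p hpO hps)
          calc B / ε * (p.1 ^ (M + 1))⁻¹ * (β p * J p 0)
              ≤ B / ε * (p.1 ^ (M + 1))⁻¹ * (K * p.1 ^ (M + 2)) := by gcongr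
            _ = B * K / ε * p.1 := by
              rw [pow_succ p.1 (M + 1)]
              field_simp
            _ ≤ B * K / ε * (2 * ε) := by
              gcongr
              exact hmem.2
            _ = 2 * B * K := by field_simp
        · rw [indicator_of_notMem hmem, zero_mul, zero_mul]
          exact indicator_nonneg (fun _ _ => by positivity) _
      have hDp : D.indicator (fun _ => Θ p₀ / 2) p ≤ p.1⁻¹ * α * (β p * J p 0) := by
        by_cases hpD : p ∈ D
        · obtain ⟨-, h1, h2, h3⟩ := hball p hpD
          rw [indicator_of_mem hpD]
          have h4 : α = T (s - p.1) * (p.1 ^ (M + 1))⁻¹ :=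
            timeCutoff_of_two_mul_le hε (by linarith)
          have h5 : Θ p = p.1⁻¹ * α * (β p * J p 0) := by
            rw [h4]
            simp only [hΘ]
            ring
          linarith
        · rw [indicator_of_notMem hpD]
          have := hβ0 p
          positivity
      have hIp : I p = deriv (timeCutoff ε s (M + 1)) p.1 * (β p * J p 0) - 2 / δ' * α *
            deriv T ((lateralDefining R₀ C p - δ') / δ') *
            ∑ μ, lateralCovector R₀ C p μ * J p μ + α * β p * (p.1⁻¹ * Q p) := by
        simp only [hI]
        rw [hdiv, hψp]
        ring
      -- The weight has exponent `M + 1` rather than `M` so that a strictly negative multiple of the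
      -- density is left over.
      have hcancel : -(((M + 1 : ℕ) : ℝ) / p.1 * α) * (β p * J p 0) +
          α * β p * (p.1⁻¹ * (M * J p 0)) = -(p.1⁻¹ * α * (β p * J p 0)) := by
        push_cast
        field_simp
        ring
      rw [add_mul] at hdt'
      linarith
    · rw [hI0 p hp, indicator_of_notMem fun h => hp (hDψ p h), sub_zero]
      exact indicator_nonneg (fun _ _ => by positivity) _
  have hA : MeasurableSet A := measurableSet_Icc.prod Metric.isClosed_closedBall.measurableSet
  have hD : MeasurableSet D := Metric.isClosed_closedBall.measurableSet
  have hAfin : volume A ≠ ⊤ :=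
    (isCompact_Icc.prod (isCompact_closedBall (0 : EuclideanSpace ℝ (Fin n)) R₀)).measure_lt_top.ne
  have hi1 : Integrable (A.indicator fun _ => 2 * B * K) :=
    (integrable_indicator_iff hA).2 (integrableOn_const hAfin)
  have hi2 : Integrable (D.indicator fun _ => Θ p₀ / 2) :=
    (integrable_indicator_iff hD).2 (integrableOn_const measure_closedBall_lt_top.ne)
  have hint := integral_mono hIi (hi1.sub hi2) hbound
  have hAvol : volume.real A = ε * V := by
    rw [Measure.volume_eq_prod, measureReal_prod_prod, Real.volume_real_Icc_of_le (by linarith)]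
    congr 1
    ring
  have hzero : ∫ p, I p = 0 := hid ψ hψ1 hψc hψO
  simp only [Pi.sub_apply] at hint
  rw [hzero, integral_sub hi1 hi2, integral_indicator_const _ hA, integral_indicator_const _ hD,
    smul_eq_mul, smul_eq_mul, hAvol] at hint
  linarith

end ZeroGeometry

/-! ### Unique continuation in two steps: near `τ = 0`, then up to `τ₀` -/

namespace ZeroGeometry

open Filter Topology Set MeasureTheory
open scoped RealInnerProductSpace

variable {n k : ℕ} {R₀ C τ₀ : ℝ}

theorem levelConormal_zero : levelConormal n 0 = 1 := rfl

theorem levelConormal_succ (j : Fin n) : levelConormal n j.succ = 0 := rfl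

theorem sum_mul_levelConormal (f : Fin (n + 1) → ℝ) : ∑ μ, f μ * levelConormal n μ = f 0 := by
  rw [Fin.sum_univ_succ]
  simp [levelConormal_zero, levelConormal_succ]

theorem norm_zeroDeriv_le_zeroGradNorm {V : Type*} [NormedAddCommGroup V] [NormedSpace ℝ V]
    (f : Spacetime n → V) (μ : Fin (n + 1)) (p : Spacetime n) :
    ‖zeroDeriv μ f p‖ ≤ zeroGradNorm f p :=
  Real.le_sqrt_of_sq_le (Finset.single_le_sum (f := fun μ => ‖zeroDeriv μ f p‖ ^ 2)
    (fun _ _ => sq_nonneg _) (Finset.mem_univ μ))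

theorem continuousOn_zeroDeriv_of_contDiffOn {V : Type*} [NormedAddCommGroup V] [NormedSpace ℝ V]
    {f : Spacetime n → V} {O : Set (Spacetime n)} (hO : IsOpen O) (hf : ContDiffOn ℝ 1 f O)
    (μ : Fin (n + 1)) : ContinuousOn (zeroDeriv μ f) O :=
  continuousOn_fst.smul
    ((hf.continuousOn_fderiv_of_isOpen hO le_rfl).clm_apply continuousOn_const)

theorem continuousOn_toBilin' {X : Type*} [TopologicalSpace X] {K : Set X}
    {G : X → Matrix (Fin (n + 1)) (Fin (n + 1)) ℝ} (hG : ∀ i j, ContinuousOn (fun x => G x i j) K)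
    {ζ ξ : X → Fin (n + 1) → ℝ} (hζ : Continuous ζ) (hξ : Continuous ξ) :
    ContinuousOn (fun x => Matrix.toBilin' (G x) (ζ x) (ξ x)) K := by
  simp only [Matrix.toBilin'_apply]
  refine continuousOn_finsetSum _ fun i _ => continuousOn_finsetSum _ fun j _ => ?_
  exact (((continuous_apply i).comp hζ).continuousOn.mul (hG i j)).mul
    ((continuous_apply j).comp hξ).continuousOn

theorem continuous_lateralCovector : Continuous (lateralCovector (n := n) R₀ C) := by
  refine continuous_pi fun μ => ?_
  refine Fin.cases ?_ (fun j => ?_) μ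
  · simp only [lateralCovector, Fin.cons_zero]
    fun_prop
  · simp only [lateralCovector, Fin.cons_succ]
    fun_prop

/-- Unique continuation for solutions of wave equations in the 0-frame. -/
theorem eq_zero_of_zeroJet_le (hC : 0 < C) (hCτ : C * τ₀ < R₀) (hτ₀ : τ₀ ≤ 1) {L : ZeroOp n k}
    {G : Fin (n + 1) → Fin (n + 1) → Spacetime n → ℝ} (hsymm : ∀ i j, G i j = G j i)
    (hG1 : ∀ i j, ContDiffOn ℝ 1 (G i j) (interior (Omega n R₀ C τ₀)))
    (hGc : ∀ i j, ContinuousOn (G i j) (Omega n R₀ C τ₀))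
    (hdG : ∀ l i j, ContinuousOn (zeroDeriv l (G i j)) (Omega n R₀ C τ₀))
    (hL : ∀ p ∈ interior (Omega n R₀ C τ₀), ∀ i j,
      L.second i j p = -(G i j p • ContinuousLinearMap.id ℝ (Fibre k)))
    (hB : ∀ i, ContinuousOn (L.first i) (Omega n R₀ C τ₀))
    (hZ : ContinuousOn L.zeroth (Omega n R₀ C τ₀))
    (hLor : ∀ p ∈ Omega n R₀ C τ₀, (Matrix.toBilin' (Matrix.of fun i j => G i j p)).IsLorentz)
    (hlevel : ∀ p ∈ Omega n R₀ C τ₀, Matrix.toBilin' (Matrix.of fun i j => G i j p)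
      (levelConormal n) (levelConormal n) < 0)
    (hlat : ∀ p ∈ Omega n R₀ C τ₀, lateralDefining R₀ C p ≤ 0 →
      Matrix.toBilin' (Matrix.of fun i j => G i j p) (lateralCovector R₀ C p)
          (lateralCovector R₀ C p) < 0 ∧
        Matrix.toBilin' (Matrix.of fun i j => G i j p) (lateralCovector R₀ C p)
          (levelConormal n) < 0)
    {m : ℕ} (hm : ∀ p ∈ Omega n R₀ C τ₀, p.1 = 0 → ∀ y,
      energySource (fun a b => G a b p) (fun l a b => zeroDeriv l (G a b) p)
        (fun i => L.first i p) (L.zeroth p) y ≤ m * energyDensity (fun a b => G a b p) y)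
    {u : Spacetime n → Fibre k} (hu1 : ContDiffOn ℝ 1 u (interior (Omega n R₀ C τ₀)))
    (hu : L.IsDistribSolutionOn (interior (Omega n R₀ C τ₀)) u) {K : ℝ}
    (hK : ∀ p ∈ interior (Omega n R₀ C τ₀), ‖zeroJet u p‖ ≤ K * p.1 ^ (m + 2))
    {p₀ : Spacetime n} (hp₀ : p₀ ∈ interior (Omega n R₀ C τ₀)) : u p₀ = 0 := by
  set Ω := Omega n R₀ C τ₀ with hΩ
  have hO : IsOpen (interior Ω) := isOpen_interior
  have hsub : interior Ω ⊆ Ω := interior_subset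
  have hΩc : IsCompact Ω := isCompact_Omega hC
  have hOeq : ∀ p ∈ interior Ω, 0 < p.1 ∧ p.1 < τ₀ := by
    intro p hp
    rw [hΩ, interior_Omega hC] at hp
    exact ⟨hp.1, hp.2.1⟩
  set E : Spacetime n → (Fin (n + 1) → Fibre k) × Fibre k → ℝ := fun p y =>
    energyDensity (fun a b => G a b p) y with hE
  set S : Spacetime n → (Fin (n + 1) → Fibre k) × Fibre k → ℝ := fun p y =>
    energySource (fun a b => G a b p) (fun l a b => zeroDeriv l (G a b) p)
      (fun i => L.first i p) (L.zeroth p) y with hS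
  have hEc : ContinuousOn (Function.uncurry E) (Ω ×ˢ univ) := continuousOn_energyDensity hGc
  have hSc : ContinuousOn (Function.uncurry S) (Ω ×ˢ univ) :=
    continuousOn_energySource hGc hdG hB hZ
  have hEhom : ∀ p ∈ Ω, ∀ (c : ℝ) y, E p (c • y) = c ^ 2 * E p y := fun p _ c y =>
    energyDensity_smul _ c y
  have hShom : ∀ p ∈ Ω, ∀ (c : ℝ) y, S p (c • y) = c ^ 2 * S p y := fun p _ c y =>
    energySource_smul _ _ _ _ c y
  have hEpos : ∀ p ∈ Ω, ∀ y, y ≠ 0 → 0 < E p y := fun p hp y hy =>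
    energyDensity_pos (hLor p hp) (hlevel p hp) hy
  have hE0 : ∀ p ∈ Ω, E p 0 = 0 := fun p hp => by
    have := hEhom p hp 0 0
    simpa using this
  have hEnn : ∀ p ∈ Ω, ∀ y, 0 ≤ E p y := by
    intro p hp y
    rcases eq_or_ne y 0 with rfl | hy
    · exact (hE0 p hp).ge
    · exact (hEpos p hp y hy).le
  have hju : ContinuousOn (zeroJet u) (interior Ω) :=
    (continuousOn_pi.2 fun μ => continuousOn_zeroDeriv_of_contDiffOn hO hu1 μ).prodMk
      hu1.continuousOn
  set J : Spacetime n → Fin (n + 1) → ℝ := fun p μ =>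
    flux (fun a b => G a b p) (zeroJet u p).1 μ + levelConormal n μ * ‖u p‖ ^ 2 with hJ
  have hJE : ∀ p, J p 0 = E p (zeroJet u p) := fun p => by
    simp only [hJ, hE, energyDensity, levelConormal_zero, one_mul, zeroJet]
  set Q : Spacetime n → ℝ := fun p => S p (zeroJet u p) with hQ
  have hpair : ContinuousOn (fun p => (p, zeroJet u p)) (interior Ω) := continuousOn_id.prodMk hju
  have hmaps : MapsTo (fun p => (p, zeroJet u p)) (interior Ω) (Ω ×ˢ univ) := fun p hp =>
    ⟨hsub hp, mem_univ _⟩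
  have hQc : ContinuousOn Q (interior Ω) := by
    have h := hSc.comp hpair hmaps
    simpa only [Function.comp_def, Function.uncurry_apply_pair] using h
  have hJc : ∀ μ, ContinuousOn (fun p => J p μ) (interior Ω) := by
    intro μ
    have hj1 : ∀ α, ContinuousOn (fun p => (zeroJet u p).1 α) (interior Ω) := fun α =>
      continuousOn_zeroDeriv_of_contDiffOn hO hu1 α
    have hGO : ∀ i j, ContinuousOn (G i j) (interior Ω) := fun i j => (hGc i j).mono hsub
    refine ContinuousOn.add ?_ (continuousOn_const.mul (hu1.continuousOn.norm.pow 2))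
    refine continuousOn_finsetSum _ fun α _ => continuousOn_finsetSum _ fun β _ => ?_
    refine ContinuousOn.mul ?_ ((hj1 α).inner (hj1 β))
    exact ((continuousOn_const.mul (hGO μ α)).mul (hGO 0 β)).sub ((hGO 0 μ).mul (hGO α β))
  have hid : ∀ ψ : Spacetime n → ℝ, ContDiff ℝ 1 ψ → HasCompactSupport ψ →
      tsupport ψ ⊆ interior Ω →
      ∫ p, (∑ μ, fderiv ℝ ψ p (coordFrame n μ) * J p μ + ψ p * (p.1⁻¹ * Q p)) = 0 := by
    intro ψ hψ hψc hψO
    rw [← hu.energy_identity hO (fun p hp => (hOeq p hp).1) hsymm hG1 hL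
      (fun i => (hB i).mono hsub) (hZ.mono hsub) hu1 hψ hψc hψO]
    refine integral_congr_ae (Eventually.of_forall fun p => ?_)
    simp only [hJ, mul_add, Finset.sum_add_distrib, ← mul_assoc]
    rw [← Finset.sum_mul, sum_mul_levelConormal]
  have hJ0 : ∀ p ∈ interior Ω, 0 ≤ J p 0 := fun p hp => by
    rw [hJE]
    exact hEnn p (hsub hp) _
  -- The lateral condition is assumed only at the boundary; being open, it persists on a
  -- neighbourhood `lateralDefining < δ`, where the cutoff varies.
  obtain ⟨δ, hδ, hδlat⟩ := hΩc.exists_pos_forall_lt (r := lateralDefining R₀ C)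
    (d := fun p => min
      (-Matrix.toBilin' (Matrix.of fun i j => G i j p) (lateralCovector R₀ C p)
          (lateralCovector R₀ C p))
      (-Matrix.toBilin' (Matrix.of fun i j => G i j p) (lateralCovector R₀ C p)
          (levelConormal n)))
    continuous_lateralDefining.continuousOn
    ((continuousOn_toBilin' (fun i j => hGc i j) continuous_lateralCovector
        continuous_lateralCovector).neg.inf
      (continuousOn_toBilin' (fun i j => hGc i j) continuous_lateralCovector
        continuous_const).neg)
    (fun p hp hr => lt_min (neg_pos.2 (hlat p hp hr).1) (neg_pos.2 (hlat p hp hr).2))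
  have hJlat : ∀ p ∈ interior Ω, lateralDefining R₀ C p < δ →
      0 ≤ ∑ μ, lateralCovector R₀ C p μ * J p μ := by
    intro p hp hr
    have hd := lt_min_iff.1 (hδlat p (hsub hp) hr)
    have h1 := sum_mul_flux_nonneg (hLor p (hsub hp)) (hlevel p (hsub hp)) (neg_pos.1 hd.1)
      (neg_pos.1 hd.2) (zeroJet u p).1
    have h2 : 0 ≤ lateralCovector R₀ C p 0 := by
      have : C * p.1 ≤ C * τ₀ := by
        gcongr
        exact (hOeq p hp).2.le
      exact mul_nonneg hC.le (by linarith)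
    simp only [hJ, mul_add, Finset.sum_add_distrib, ← mul_assoc]
    rw [← Finset.sum_mul, sum_mul_levelConormal]
    exact add_nonneg h1 (mul_nonneg h2 (sq_nonneg _))
  obtain ⟨A, hA⟩ := hΩc.exists_forall_quadratic_le (q := E) (d := fun _ y => ‖y‖ ^ 2) hEc
    (continuous_snd.norm.pow 2).continuousOn hEhom
    (fun _ _ c y => by rw [norm_smul, mul_pow, Real.norm_eq_abs, sq_abs])
    (fun _ _ y hy => by
      have := norm_pos_iff.2 hy
      positivity)
  -- The energy is quadratic in the jet, so decay of order `m + 2` of the jet gives order `2(m + 2)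
  -- ≥ (m + 1) + 2`, as required for the constant `m + 1`.
  have hJA : ∀ p ∈ interior Ω, J p 0 ≤ A * K ^ 2 * p.1 ^ (m + 1 + 2) := by
    intro p hp
    obtain ⟨h0, h1⟩ := hOeq p hp
    calc J p 0 ≤ A * ‖zeroJet u p‖ ^ 2 := (hJE p).trans_le (hA p (hsub hp) _)
      _ ≤ A * (K * p.1 ^ (m + 2)) ^ 2 := by
        gcongr
        exact hK p hp
      _ = A * K ^ 2 * p.1 ^ (2 * (m + 2)) := by ring
      _ ≤ A * K ^ 2 * p.1 ^ (m + 1 + 2) := by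
        gcongr ?_ * ?_
        exact pow_le_pow_of_le_one h0.le (h1.le.trans hτ₀) (by omega)
  have hA0 : (0 : ℝ) ≤ A * K ^ 2 := by positivity
  have hDc : ContinuousOn (Function.uncurry fun p y => (m + 1) * E p y - S p y) (Ω ×ˢ univ) := by
    refine ((hEc.const_smul (m + 1 : ℝ)).sub hSc).congr ?_
    rintro ⟨p, y⟩ -
    simp only [Function.uncurry_apply_pair, Pi.sub_apply, Pi.smul_apply, smul_eq_mul]
  -- At `τ = 0` the form `(m + 1) E - S ≥ E` is positive definite, hence it stays nonnegative for
  -- small `τ`.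
  obtain ⟨s, hs, hsS⟩ := hΩc.exists_pos_forall_quadratic_nonneg (r := fun p => p.1)
    (d := fun p y => (m + 1) * E p y - S p y) continuousOn_fst
    hDc
    (fun p hp c y => by
      rw [hEhom p hp, hShom p hp]
      ring)
    (fun p hp hr y hy => by
      have h1 := hm p hp (le_antisymm hr hp.1) y
      have h2 := hEpos p hp y hy
      change S p y ≤ m * E p y at h1
      linarith)
  have hτ₀pos : 0 < τ₀ := (hOeq p₀ hp₀).1.trans (hOeq p₀ hp₀).2
  set s₁ := min s τ₀ / 2 with hs₁
  have hs₁0 : 0 < s₁ := by positivity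
  have hs₁s : s₁ < s := (half_lt_self (by positivity)).trans_le (min_le_left _ _)
  have hs₁τ : s₁ < τ₀ := (half_lt_self (by positivity)).trans_le (min_le_right _ _)
  have hnear : ∀ p ∈ interior Ω, p.1 < s₁ → J p 0 = 0 := fun p hp hps =>
    density_eq_zero_of_divergence_le hC hCτ hs₁τ hJc hQc hid hJ0 (M := m + 1)
      (fun q hq hqs => by
        have := hsS q (hsub hq) (hqs.trans_lt hs₁s) (zeroJet u q)
        rw [hJE]
        push_cast
        linarith)
      hδ hJlat hA0 (fun q hq _ => hJA q hq) hp hps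
  obtain ⟨M, hM⟩ := hΩc.exists_forall_quadratic_le hSc hEc hShom hEhom hEpos
  obtain ⟨s₂, hs₂, hs₂τ⟩ := exists_between (hOeq p₀ hp₀).2
  -- Since the density vanishes for `τ < s₁`, it is bounded by a multiple of `τ^(M + 2)` for the
  -- possibly much larger global constant `M`.
  have hJp : J p₀ 0 = 0 := by
    refine density_eq_zero_of_divergence_le hC hCτ hs₂τ hJc hQc hid hJ0 (M := M)
      (fun q hq _ => by
        rw [hJE]
        exact hM q (hsub hq) _)
      hδ hJlat (K := A * K ^ 2 * (s₁ ^ (M + 2))⁻¹) (by positivity) (fun q hq _ => ?_) hp₀ hs₂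
    obtain ⟨h0, h1⟩ := hOeq q hq
    rcases lt_or_ge q.1 s₁ with hlt | hge
    · rw [hnear q hq hlt]
      positivity
    · calc J q 0 ≤ A * K ^ 2 * q.1 ^ (m + 1 + 2) := hJA q hq
        _ ≤ A * K ^ 2 * 1 := by
          gcongr
          exact pow_le_one₀ h0.le (h1.le.trans hτ₀)
        _ ≤ A * K ^ 2 * ((s₁ ^ (M + 2))⁻¹ * q.1 ^ (M + 2)) := by
          gcongr
          rw [inv_mul_eq_div, one_le_div (by positivity)]
          gcongr
        _ = _ := by ring
  by_contra hne
  refine (hEpos p₀ (hsub hp₀) (zeroJet u p₀) fun h => hne ?_).ne' ((hJE p₀).symm.trans hJp)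
  exact congrArg Prod.snd h

end ZeroGeometry

/-! ### Time orientation of the lateral boundary, and the conclusion -/

namespace ZeroGeometry

open Filter Topology Set MeasureTheory
open scoped RealInnerProductSpace

variable {n k : ℕ} {R₀ C τ₀ : ℝ}

theorem toBilin'_inv_eq_dualMetric (G : Matrix (Fin (n + 1)) (Fin (n + 1)) ℝ)
    (ζ : Fin (n + 1) → ℝ) : Matrix.toBilin' G⁻¹ ζ ζ = dualMetric G ζ :=
  Matrix.toBilin'_apply' _ _ _

theorem modelMetric_mulVec_levelConormal (h : Matrix (Fin n) (Fin n) ℝ) :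
    (modelMetric h).mulVec (levelConormal n) = -levelConormal n := by
  ext μ
  rw [Matrix.mulVec, dotProduct, sum_mul_levelConormal]
  refine Fin.cases ?_ (fun j => ?_) μ <;> simp [modelMetric, levelConormal]

theorem toBilin'_modelMetric_inv_levelConormal {h : Matrix (Fin n) (Fin n) ℝ}
    (hL : IsLorentzian (modelMetric h)) (ζ : Fin (n + 1) → ℝ) :
    Matrix.toBilin' (modelMetric h)⁻¹ ζ (levelConormal n) = -ζ 0 := by
  obtain ⟨-, -, hdet, -⟩ := hL.exists_inv_eq
  have h1 : (modelMetric h)⁻¹.mulVec (levelConormal n) = -levelConormal n := by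
    have h2 := congrArg (fun v => (modelMetric h)⁻¹.mulVec v) (modelMetric_mulVec_levelConormal h)
    simp only [Matrix.mulVec_mulVec, Matrix.nonsing_inv_mul _ hdet, Matrix.one_mulVec,
      Matrix.mulVec_neg] at h2
    exact (neg_eq_iff_eq_neg.2 h2).symm
  rw [Matrix.toBilin'_apply', h1, dotProduct_neg, dotProduct, sum_mul_levelConormal]

/-- On a lateral boundary which is spacelike and meets `τ = 0` with a future directed conormal, the
conormal is future directed everywhere. -/
theorem toBilin'_lateralCovector_neg (hC : 0 < C) (hCτ : C * τ₀ < R₀)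
    {G : Spacetime n → Matrix (Fin (n + 1)) (Fin (n + 1)) ℝ}
    (hGc : ∀ i j, ContinuousOn (fun p => G p i j) (Omega n R₀ C τ₀))
    (hLor : ∀ p ∈ Omega n R₀ C τ₀, (Matrix.toBilin' (G p)).IsLorentz)
    (hlevel : ∀ p ∈ Omega n R₀ C τ₀,
      Matrix.toBilin' (G p) (levelConormal n) (levelConormal n) < 0)
    (hlat : ∀ p ∈ Omega n R₀ C τ₀, ‖p.2‖ = R₀ - C * p.1 →
      Matrix.toBilin' (G p) (lateralConormal C p.2) (lateralConormal C p.2) < 0)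
    (h0 : ∀ p ∈ Omega n R₀ C τ₀, p.1 = 0 →
      Matrix.toBilin' (G p) (lateralCovector R₀ C p) (levelConormal n) < 0)
    {p : Spacetime n} (hp : p ∈ Omega n R₀ C τ₀) (hr : lateralDefining R₀ C p ≤ 0) :
    Matrix.toBilin' (G p) (lateralCovector R₀ C p) (lateralCovector R₀ C p) < 0 ∧
      Matrix.toBilin' (G p) (lateralCovector R₀ C p) (levelConormal n) < 0 := by
  have hρpos : ∀ t ≤ τ₀, 0 < R₀ - C * t := by
    intro t ht
    have : C * t ≤ C * τ₀ := by gcongr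
    linarith
  have hx : ‖p.2‖ = R₀ - C * p.1 := by
    refine le_antisymm hp.2.2 (le_of_sq_le_sq ?_ (norm_nonneg _))
    rw [lateralDefining] at hr
    linarith
  have htimelike : ∀ q ∈ Omega n R₀ C τ₀, ‖q.2‖ = R₀ - C * q.1 →
      Matrix.toBilin' (G q) (lateralCovector R₀ C q) (lateralCovector R₀ C q) < 0 := by
    intro q hq hqx
    have hρ : 0 < R₀ - C * q.1 := hρpos _ hq.2.1
    -- On the lateral boundary `|x| = R₀ - C τ`, so the covector is a positive multiple of the given
    -- conormal.
    have hζ : lateralCovector R₀ C q = (R₀ - C * q.1) • lateralConormal C q.2 := by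
      ext μ
      refine Fin.cases ?_ (fun j => ?_) μ
      · simp [lateralCovector, lateralConormal, mul_comm]
      · simp only [lateralCovector, lateralConormal, Fin.cons_succ, Pi.smul_apply, smul_eq_mul, hqx]
        field_simp
    rw [hζ]
    simp only [map_smul, LinearMap.smul_apply, smul_eq_mul]
    have := hlat q hq hqx
    exact mul_neg_of_pos_of_neg hρ (mul_neg_of_pos_of_neg hρ this)
  refine ⟨htimelike p hp hx, ?_⟩
  have hρ : 0 < R₀ - C * p.1 := hρpos _ hp.2.1
  have hx0 : ‖p.2‖ ≠ 0 := by
    rw [hx]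
    exact hρ.ne'
  -- The generator of the lateral boundary through `p`, followed down to `τ = 0`. Along it the
  -- pairing of the conormal with `dτ` starts negative and cannot vanish, since two timelike
  -- covectors are never orthogonal.
  set γ : ℝ → Spacetime n := fun t => (t, ((R₀ - C * t) / ‖p.2‖) • p.2) with hγ
  have hγc : Continuous γ := by fun_prop
  have hγn : ∀ t ≤ τ₀, ‖(γ t).2‖ = R₀ - C * (γ t).1 := by
    intro t ht
    have h1 := hρpos t ht
    simp only [hγ, norm_smul, norm_div, norm_norm, Real.norm_of_nonneg h1.le]
    exact div_mul_cancel₀ _ hx0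
  have hγΩ : ∀ t ∈ Icc 0 p.1, γ t ∈ Omega n R₀ C τ₀ := fun t ht =>
    ⟨ht.1, ht.2.trans hp.2.1, (hγn t (ht.2.trans hp.2.1)).le⟩
  have hγp : γ p.1 = p := by
    simp only [hγ, ← hx, div_self hx0, one_smul]
  set f : ℝ → ℝ := fun t => Matrix.toBilin' (G (γ t)) (lateralCovector R₀ C (γ t)) (levelConormal n)
    with hf
  have hfc : ContinuousOn f (Icc 0 p.1) :=
    continuousOn_toBilin' (fun i j => (hGc i j).comp hγc.continuousOn hγΩ)
      (continuous_lateralCovector.comp hγc) continuous_const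
  have hf0 : f 0 < 0 := h0 _ (hγΩ 0 ⟨le_rfl, hp.1⟩) rfl
  have hfp : f p.1 = Matrix.toBilin' (G p) (lateralCovector R₀ C p) (levelConormal n) := by
    simp only [hf, hγp]
  rw [← hfp]
  by_contra! hge
  obtain ⟨t, ht, hft⟩ := intermediate_value_Icc hp.1 hfc ⟨hf0.le, hge⟩
  have htΩ := hγΩ t ht
  exact (hLor _ htΩ).ne_zero_of_timelike (htimelike _ htΩ (hγn t (ht.2.trans hp.2.1)))
    (hlevel _ htΩ) hft

theorem ZeroC1On.contDiffOn {S : Set (Spacetime n)} {V : Type*} [NormedAddCommGroup V]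
    [NormedSpace ℝ V] (hpos : ∀ p ∈ interior S, 0 < p.1) {u : Spacetime n → V}
    (hu : ZeroC1On S u) : ContDiffOn ℝ 1 u (interior S) := by
  refine contDiffOn_one_of_continuousOn_coordFrame isOpen_interior hu.2.1 fun μ => ?_
  obtain ⟨w, hw, hwu⟩ := hu.2.2 μ
  exact continuousOn_fderiv_of_zeroDeriv hpos
    (hw.1.mono fun p hp => ⟨interior_subset hp, hpos p hp⟩) hwu

theorem norm_zeroJet_le {u : Spacetime n → Fibre k} {p : Spacetime n} {c : ℝ}
    (h0 : ‖u p‖ ≤ c) (h1 : zeroGradNorm u p ≤ c) : ‖zeroJet u p‖ ≤ c := by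
  refine norm_prod_le_iff.2 ⟨?_, h0⟩
  exact (pi_norm_le_iff_of_nonneg ((norm_nonneg _).trans h0)).2 fun μ =>
    (norm_zeroDeriv_le_zeroGradNorm u μ p).trans h1

/-- A function in `⁰C¹` of the domain which vanishes in the interior vanishes for `τ > 0`. -/
theorem ZeroC1On.eq_zero_of_interior (hC : 0 < C) (hτ₀ : 0 < τ₀) (hCτ : C * τ₀ < R₀)
    {V : Type*} [NormedAddCommGroup V] [NormedSpace ℝ V] {u : Spacetime n → V}
    (hu : ZeroC1On (Omega n R₀ C τ₀) u) (h : ∀ p ∈ interior (Omega n R₀ C τ₀), u p = 0)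
    {p : Spacetime n} (hp : p ∈ Omega n R₀ C τ₀) (hp0 : 0 < p.1) : u p = 0 := by
  have hne : (interior (Omega n R₀ C τ₀)).Nonempty := by
    refine ⟨(τ₀ / 2, 0), ?_⟩
    rw [interior_Omega hC]
    have : 0 < C * τ₀ := by positivity
    refine ⟨half_pos hτ₀, half_lt_self hτ₀, ?_⟩
    simp only [norm_zero]
    linarith
  -- A convex set with nonempty interior lies in the closure of its interior.
  have hcl : p ∈ closure (interior (Omega n R₀ C τ₀)) := by
    rw [convex_Omega.closure_interior_eq_closure_of_nonempty_interior hne]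
    exact subset_closure hp
  have hmem : p ∈ Omega n R₀ C τ₀ ∩ {p | 0 < p.1} := ⟨hp, hp0⟩
  have hsub : interior (Omega n R₀ C τ₀) ⊆ Omega n R₀ C τ₀ ∩ {p | 0 < p.1} := fun q hq => by
    refine ⟨interior_subset hq, ?_⟩
    rw [interior_Omega hC] at hq
    exact hq.1
  have hc : ContinuousWithinAt u (interior (Omega n R₀ C τ₀)) p := (hu.1.1 p hmem).mono hsub
  have := hc.mem_closure_image hcl
  have himg : u '' interior (Omega n R₀ C τ₀) ⊆ {0} := by
    rintro _ ⟨q, hq, rfl⟩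
    exact h q hq
  simpa using closure_mono himg this

/-- The diagonal matrix coefficient `A ↦ -⟪ε, A ε⟫`. -/
noncomputable def negCoeff (ε : Fibre k) : EndFibre k →L[ℝ] ℝ :=
  -((innerSL ℝ ε).comp (ContinuousLinearMap.apply ℝ (Fibre k) ε))

theorem negCoeff_neg_smul_id {ε : Fibre k} (hε : ‖ε‖ = 1) (r : ℝ) :
    negCoeff ε (-(r • ContinuousLinearMap.id ℝ (Fibre k))) = r := by
  simp [negCoeff, real_inner_smul_right, hε]

end ZeroGeometry

theorem proposition3p1 (n k : ℕ) (R₀ : ℝ) (hR₀ : 0 < R₀)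
    -- the coefficients of `L₀` at `Ω ∩ {τ = 0} = {|x| ≤ R₀}`, on which alone `N` depends
    (a : Fin (n + 1) → Fin (n + 1) → EuclideanSpace ℝ (Fin n) → EndFibre k)
    (b : Fin (n + 1) → EuclideanSpace ℝ (Fin n) → EndFibre k)
    (c : EuclideanSpace ℝ (Fin n) → EndFibre k) :
    ∃ N : ℕ,
      ∀ (U : Set (EuclideanSpace ℝ (Fin n))) (η : ℝ)
        (gbar : Spacetime n → Matrix (Fin (n + 1)) (Fin (n + 1)) ℝ)
        (L₀ Lt : ZeroOp n k) (C τ₀ : ℝ),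
      IsOpen U → 0 < η →
      IsAsymptoticallyDeSitter U η gbar →
      -- the domain
      0 < τ₀ → τ₀ ≤ 1 / 2 → 0 < C → C * τ₀ < R₀ →
      Omega n R₀ C τ₀ ⊆ chartM U →
      (∀ p ∈ Omega n R₀ C τ₀, IsSpacelikeConormal (gbar p) (levelConormal n)) →
      (∀ p ∈ Omega n R₀ C τ₀, ‖p.2‖ = R₀ - C * p.1 →
        IsSpacelikeConormal (gbar p) (lateralConormal C p.2)) →
      -- the operator `L = L₀ + Lt`
      L₀.IsSmoothOn (chartM U) →
      Lt.IsWeightedZeroC1On (chartM U) η →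
      (∀ p ∈ chartM U, ∀ ζ : Fin (n + 1) → ℝ,
        (L₀ + Lt).principalSymbol p ζ =
          dualMetric (gbar p) ζ • ContinuousLinearMap.id ℝ (Fibre k)) →
      (∀ x : EuclideanSpace ℝ (Fin n), ‖x‖ ≤ R₀ →
        (∀ μ ν, L₀.second μ ν (0, x) = a μ ν x) ∧ (∀ μ, L₀.first μ (0, x) = b μ x) ∧
          L₀.zeroth (0, x) = c x) →
      ∀ u : Spacetime n → Fibre k,
        ZeroC1On (Omega n R₀ C τ₀) u →
        (L₀ + Lt).IsDistribSolutionOn (interior (Omega n R₀ C τ₀)) u →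
        (∃ K : ℝ, (∀ p ∈ Omega n R₀ C τ₀, ‖u p‖ ≤ K * p.1 ^ N) ∧
          ∀ p ∈ interior (Omega n R₀ C τ₀), zeroGradNorm u p ≤ K * p.1 ^ N) →
        ∀ p ∈ Omega n R₀ C τ₀, u p = 0 := by
  -- For `k = 0` there is no unit vector from which to read off the scalar principal part, but every
  -- function is zero.
  rcases Nat.eq_zero_or_pos k with rfl | hk
  · exact ⟨0, fun _ _ _ _ _ _ _ _ _ _ _ _ _ _ _ _ _ _ _ _ _ u _ _ _ p _ =>
      Subsingleton.elim _ _⟩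
  set ε : Fibre k := EuclideanSpace.single ⟨0, hk⟩ 1
  have hε : ‖ε‖ = 1 := by simp [ε]
  -- The bound of the source by the energy at `τ = 0`. It involves only `a`, `b`, `c`: the
  -- derivatives of the metric along the 0-frame are set to `0`, their value there.
  let SourceBound (m : ℕ) : Prop := ∀ x : EuclideanSpace ℝ (Fin n), ‖x‖ ≤ R₀ →
    ∀ y : (Fin (n + 1) → Fibre k) × Fibre k,
      energySource (fun i j => negCoeff ε (a i j x)) (fun _ _ _ => 0) (fun i => b i x) (c x) y ≤
        m * energyDensity (fun i j => negCoeff ε (a i j x)) y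
  -- The constant is chosen before the geometry is known. Whether a bound exists depends on `a`,
  -- `b`, `c` alone; any admissible geometry later shows that it does.
  obtain ⟨m, hm⟩ : ∃ m, (∃ m', SourceBound m') → SourceBound m := by
    by_cases h : ∃ m', SourceBound m'
    · exact ⟨h.choose, fun _ => h.choose_spec⟩
    · exact ⟨0, fun h' => absurd h' h⟩
  refine ⟨m + 2, ?_⟩
  intro U η gbar L₀ Lt C τ₀ hU hη hg hτ₀ hτ₀1 hC hCτ hΩU hlevel hlat hL₀ hLt hsymb hcoeff u hu
    hsol hdecay
  obtain ⟨K, hK0, hK1⟩ := hdecay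
  obtain ⟨hgL, h, g', -, -, hg', hgeq⟩ := hg
  set L := L₀ + Lt with hLdef
  set Ω := Omega n R₀ C τ₀ with hΩ
  have hsub : interior Ω ⊆ Ω := interior_subset
  have hsubU : interior Ω ⊆ interior (chartM U) := interior_mono hΩU
  have hOpos : ∀ p ∈ interior Ω, 0 < p.1 := by
    intro p hp
    rw [hΩ, interior_Omega hC] at hp
    exact hp.1
  have hsecond : ∀ p ∈ chartM U, ∀ i j,
      L.second i j p = -((gbar p)⁻¹ i j • ContinuousLinearMap.id ℝ (Fibre k)) :=
    fun p hp i j => second_eq_of_principalSymbol (hgL p hp) (hsymb p hp) i j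
  -- The inverse metric is read off from the operator, so its regularity up to `τ = 0` is inherited
  -- directly from the coefficients.
  set G : Fin (n + 1) → Fin (n + 1) → Spacetime n → ℝ := fun i j p =>
    negCoeff ε (L.second i j p) with hG
  have hGeq : ∀ p ∈ chartM U, ∀ i j, G i j p = (gbar p)⁻¹ i j := fun p hp i j => by
    simp only [hG, hsecond p hp i j, negCoeff_neg_smul_id hε]
  have hGmat : ∀ p ∈ Ω, (Matrix.of fun i j => G i j p) = (gbar p)⁻¹ := fun p hp => by
    ext i j
    exact hGeq p (hΩU hp) i j
  have hGz : ∀ i j, ContinuousZeroC1On (chartM U) (G i j) := fun i j =>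
    (ContDiffOn.continuousZeroC1On hU (hL₀.1 i j)).clm_comp_add hU
      ((hLt.1 i j).continuousZeroC1On hU hη) (negCoeff ε)
  have hGc : ∀ i j, ContinuousOn (G i j) Ω := fun i j => (hGz i j).1.mono hΩU
  have hdG : ∀ l i j, ContinuousOn (zeroDeriv l (G i j)) Ω := fun l i j =>
    ((hGz i j).2.2 l).mono hΩU
  have hB : ∀ i, ContinuousOn (L.first i) Ω := fun i =>
    ((hL₀.2.1 i).continuousOn.add ((hLt.2.1 i).continuousZeroC1On hU hη).1).mono hΩU
  have hZ : ContinuousOn L.zeroth Ω :=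
    (hL₀.2.2.continuousOn.add (hLt.2.2.continuousZeroC1On hU hη).1).mono hΩU
  have hLor : ∀ p ∈ Ω, (Matrix.toBilin' (Matrix.of fun i j => G i j p)).IsLorentz := fun p hp => by
    rw [hGmat p hp]
    exact (hgL p (hΩU hp)).isLorentz_inv
  have hlevel' : ∀ p ∈ Ω, Matrix.toBilin' (Matrix.of fun i j => G i j p)
      (levelConormal n) (levelConormal n) < 0 := fun p hp => by
    rw [hGmat p hp, toBilin'_inv_eq_dualMetric]
    exact hlevel p hp
  have hlat' := fun p (hp : p ∈ Ω) => toBilin'_lateralCovector_neg (p := p) hC hCτ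
    (G := fun p => Matrix.of fun i j => G i j p) hGc hLor hlevel'
    (fun q hq hqx => by
      rw [hGmat q hq, toBilin'_inv_eq_dualMetric]
      exact hlat q hq hqx)
    -- At `τ = 0` the metric is `-dτ² + h`, so pairing with `dτ` gives minus the `τ`-component, that
    -- is `-C R₀ < 0`.
    (fun q hq hq0 => by
      have hmodel : gbar q = modelMetric (h q.2) := by
        rw [hgeq q (hΩU hq)]
        ext i j
        simp [(hg' i j).eq_zero hη (hΩU hq) hq0]
      have hgq := hgL q (hΩU hq)
      rw [hmodel] at hgq
      rw [hGmat q hq, hmodel, toBilin'_modelMetric_inv_levelConormal hgq]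
      simp only [lateralCovector, hq0, Fin.cons_zero, mul_zero, sub_zero, neg_lt_zero]
      positivity)
    hp
  have hinit : ∀ x : EuclideanSpace ℝ (Fin n), ‖x‖ ≤ R₀ →
      ((0 : ℝ), x) ∈ Ω ∧ (∀ i j, G i j (0, x) = negCoeff ε (a i j x)) ∧
        (∀ l i j, zeroDeriv l (G i j) (0, x) = 0) ∧ (∀ i, L.first i (0, x) = b i x) ∧
        L.zeroth (0, x) = c x := by
    intro x hx
    obtain ⟨ha, hb, hc⟩ := hcoeff x hx
    have hmem : ((0 : ℝ), x) ∈ Ω := ⟨le_rfl, hτ₀.le, by simpa using hx⟩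
    have hmem' := hΩU hmem
    refine ⟨hmem, fun i j => ?_, fun l i j => ?_, fun i => ?_, ?_⟩
    · change negCoeff ε (L₀.second i j (0, x) + Lt.second i j (0, x)) = _
      rw [(hLt.1 i j).eq_zero hη hmem' rfl, ha, add_zero]
    · simp [zeroDeriv]
    · change L₀.first i (0, x) + Lt.first i (0, x) = _
      rw [(hLt.2.1 i).eq_zero hη hmem' rfl, hb, add_zero]
    · change L₀.zeroth (0, x) + Lt.zeroth (0, x) = _
      rw [hLt.2.2.eq_zero hη hmem' rfl, hc, add_zero]
  have hbound : SourceBound m := by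
    refine hm ?_
    -- The constant `M` obtained from compactness depends on the whole geometry, but serves only to
    -- show that some bound exists at `τ = 0`; `hm` then supplies the universal `m`.
    obtain ⟨M, hM⟩ := (isCompact_Omega (n := n) (R₀ := R₀) (τ₀ := τ₀) hC).exists_forall_quadratic_le
      (continuousOn_energySource hGc hdG hB hZ) (continuousOn_energyDensity hGc)
      (fun p _ r y => energySource_smul _ _ _ _ r y) (fun p _ r y => energyDensity_smul _ r y)
      (fun p hp y hy => energyDensity_pos (hLor p hp) (hlevel' p hp) hy)
    refine ⟨M, fun x hx y => ?_⟩
    obtain ⟨hmem, h1, h2, h3, h4⟩ := hinit x hx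
    have : energySource (fun i j => G i j (0, x)) (fun l i j => zeroDeriv l (G i j) (0, x))
        (fun i => L.first i (0, x)) (L.zeroth (0, x)) y ≤
          M * energyDensity (fun i j => G i j (0, x)) y := hM (0, x) hmem y
    simpa only [h1, h2, h3, h4] using this
  have hinterior : ∀ p ∈ interior Ω, u p = 0 := fun p hp =>
    eq_zero_of_zeroJet_le hC hCτ (by linarith) (L := L) (G := G)
      (fun i j => by simp only [hG, L.symm i j]) (fun i j => (hGz i j).2.1.mono hsubU) hGc hdG
      (fun q hq i j => by rw [hGeq q (hΩU (hsub hq)), hsecond q (hΩU (hsub hq))])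
      hB hZ hLor hlevel' hlat' (m := m)
      (fun q hq hq0 y => by
        obtain ⟨t, x⟩ := q
        obtain rfl : t = 0 := hq0
        have hx : ‖x‖ ≤ R₀ := by simpa using hq.2.2
        obtain ⟨-, h1, h2, h3, h4⟩ := hinit x hx
        simpa only [h1, h2, h3, h4] using hbound x hx y)
      (hu.contDiffOn hOpos) hsol
      (fun q hq => norm_zeroJet_le (hK0 q (hsub hq)) (hK1 q hq)) hp
  intro p hp
  rcases hp.1.eq_or_lt with h0 | h0
  -- At `τ = 0` membership in `ZeroC1On` says nothing about the value; the decay bound with positive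
  -- exponent `m + 2` forces it to be `0`.
  · have := hK0 p hp
    rw [← h0, zero_pow (by omega), mul_zero] at this
    exact norm_le_zero_iff.1 this
  · exact hu.eq_zero_of_interior hC hτ₀ hCτ hinterior hp h0
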